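/- Let $n\ge 2$, $m\ge 0$ be integers and $s>\frac n2$. Fix a smooth $\varphi:\mathbb R^n\to\mathbb R$ with $\varphi=1$ on $\{|\xi|\le 1\}$ and $\varphi=0$ on $\{|\xi|\ge 2\}$, and the Littlewood–Paley projectors $S_1=\varphi(D)$, $S_\lambda=\varphi(D/\lambda)-\varphi(2D/\lambda)$ for $\lambda=2,4,8,\dots$. For $u:\mathbb R^n\to\mathbb C^m$ write $u_\lambda=S_\lambda u$, $u_{\le 1}=S_1u$, and $$\|u\|_{\mathcal DH^s}^2=\sum_{\lambda\in\{1,2,4,\dots\}}\lambda^{2s}\|u_\lambda\|_{\mathcal DL^2_\lambda}^2,\qquad \|v\|_{\mathcal DL^2_\lambda}=\sup_{x_0\in\mathbb R^n}\ \sup_{\omega\in\mathbb S^{n-1}}\ \sum_{k\in\mathbb N}\big\|1_{\{|\lambda^{-1}(x-x_0)-k\omega|<1\}}\,v\big\|_{L^2}.$$ The space $\mathcal DH^s$ consists of the tempered functions (measurable, and integrable against some power $(1+|x|)^{-N}$) for which this norm is finite. Let $B:(\mathbb C^m\times\mathbb C^m)\times((\mathbb C^m)^n\times(\mathbb C^m)^n)\to\mathbb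 C^m$ be a complex bilinear map. For $u_0\in\mathcal DH^s$ put $M=\|u_0\|_{\mathcal DH^s}$, and for $0<\varepsilon\le 1$ let $u_0^\varepsilon(x)=\varepsilon u_0(\varepsilon x)$ and let $w=u^\varepsilon_{0,\le 1}=(u_0^\varepsilon)_{\le 1}$ be its low frequency part. Put $$N(w)=B\big((w,\bar w),(\nabla w,\nabla\bar w)\big)+\Delta w .$$ Then there is a constant $C$, depending only on $n,m,s,\varphi,B$ (and not on $\varepsilon$ or $u_0$), such that for all $0<\varepsilon\le1$ and all $u_0\in\mathcal DH^s$ one has $N(u^\varepsilon_{0,\le1})\in\mathcal DH^s$ and $$\|N(u^\varepsilon_{0,\le1})\|_{\mathcal DH^s}\le C\max\big(\varepsilon,\varepsilon^{s-\frac n2}\big)\max(M,M^2).$$ If moreover $\frac n2+1\le s<\frac n2+2$, then also $$\|N(u^\varepsilon_{0,\le1})\|_{\mathcal DH^s}\le C\min\big(\varepsilon,\varepsilon^{s-\frac n2}\big)\max(M,M^2).$$ In particular, for $M\ge1$ the factor $\max(M,M^2)$ is $M^2$. -/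

import Mathlib

open scoped ENNReal FourierTransform Laplacian
open MeasureTheory

noncomputable section

namespace DNLS

/-- The physical (and the frequency) space `ℝⁿ` with its Euclidean norm. -/
abbrev Sp (n : ℕ) : Type := EuclideanSpace ℝ (Fin n)

/-- The target space `ℂᵐ`. -/
abbrev Val (m : ℕ) : Type := EuclideanSpace ℂ (Fin m)

/-- A smooth cutoff at frequencies `≲ 1`, from which a Littlewood-Paley decomposition is built:
it equals `1` on the unit ball and vanishes outside the ball of radius `2`. -/
structure LPCutoff (n : ℕ) where
  toFun : Sp n → ℝ
  smooth : ContDiff ℝ ((⊤ : ℕ∞) : WithTop ℕ∞) toFun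
  eq_one : ∀ ξ, ‖ξ‖ ≤ 1 → toFun ξ = 1
  eq_zero : ∀ ξ, 2 ≤ ‖ξ‖ → toFun ξ = 0

/-- The symbol of the Littlewood-Paley projector `S_λ`, `λ = 2 ^ j`: it is `φ(ξ)` for `λ = 1`
(so that all frequencies below `1` are included there), and `φ(ξ/λ) - φ(2ξ/λ)` for `λ ≥ 2`. -/
def LPCutoff.symbol {n : ℕ} (φ : LPCutoff n) : ℕ → Sp n → ℝ
  | 0 => φ.toFun
  | j + 1 => fun ξ => φ.toFun (((2 : ℝ) ^ (j + 1))⁻¹ • ξ) - φ.toFun (((2 : ℝ) ^ j)⁻¹ • ξ)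

/-- The convolution kernel `K(x) = (2π)⁻ⁿ ∫ p(ξ) e^{i x·ξ} dξ` of the Fourier multiplier `p(D)`.
(Mathlib's inverse Fourier transform uses the phase `e^{2π i x·η}`, hence `ξ = 2π η`.) -/
def kernel {n : ℕ} (p : Sp n → ℝ) : Sp n → ℂ :=
  𝓕⁻ (fun η : Sp n => ((p ((2 * Real.pi) • η) : ℝ) : ℂ))

/-- The Fourier multiplier `p(D) u = K * u`. For `p` smooth with compact support `K` is a Schwartz
function, and the integral converges absolutely for every tempered function `u`. -/
def multiplier {n m : ℕ} (p : Sp n → ℝ) (u : Sp n → Val m) (x : Sp n) : Val m :=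
  ∫ y, kernel p (x - y) • u y

/-- The dyadic piece `u_λ = S_λ u` at frequency `λ = 2 ^ j`. -/
def LPCutoff.piece {n m : ℕ} (φ : LPCutoff n) (j : ℕ) (u : Sp n → Val m) : Sp n → Val m :=
  multiplier (φ.symbol j) u

/-- The low frequency part `u_{≤ 1}`. -/
def LPCutoff.low {n m : ℕ} (φ : LPCutoff n) (u : Sp n → Val m) : Sp n → Val m :=
  φ.piece 0 u

/-- Tempered functions: measurable, and integrable against some negative power of `1 + |x|`. -/
def IsTempered {n m : ℕ} (u : Sp n → Val m) : Prop :=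
  ∃ N : ℕ, Integrable (fun x => ((1 + ‖x‖) ^ N)⁻¹ • u x)

/-- The norm `𝒟L²_r`: the supremum over `x₀ ∈ ℝⁿ` and `θ ∈ 𝕊ⁿ⁻¹` of
`∑_{k ∈ ℕ} ‖ 1_{|r⁻¹ (x - x₀) - k θ| < 1} v ‖_{L²}`. -/
def normDL {n m : ℕ} (r : ℝ) (v : Sp n → Val m) : ℝ≥0∞ :=
  ⨆ x₀ : Sp n, ⨆ θ : Metric.sphere (0 : Sp n) 1,
    ∑' k : ℕ,
      eLpNorm ({x : Sp n | ‖r⁻¹ • (x - x₀) - (k : ℝ) • (θ : Sp n)‖ < 1}.indicator v) 2 volume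

/-- The norm `𝒟Hˢ`: `‖u‖² = ∑_{λ = 2 ^ j ≥ 1} λ^{2s} ‖u_λ‖²_{𝒟L²_λ}`. -/
def normDH {n m : ℕ} (φ : LPCutoff n) (s : ℝ) (u : Sp n → Val m) : ℝ≥0∞ :=
  (∑' j : ℕ, ENNReal.ofReal (((2 : ℝ) ^ j) ^ (2 * s)) *
    normDL ((2 : ℝ) ^ j) (φ.piece j u) ^ 2) ^ (1 / 2 : ℝ)

/-- The space `𝒟Hˢ`. -/
def MemDH {n m : ℕ} (φ : LPCutoff n) (s : ℝ) (u : Sp n → Val m) : Prop :=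
  IsTempered u ∧ normDH φ s u < ∞

/-- The rescaled initial data `u₀^ε(x) = ε u₀(ε x)`. -/
def rescale {n m : ℕ} (ε : ℝ) (u : Sp n → Val m) (x : Sp n) : Val m := ε • u (ε • x)

/-- Componentwise complex conjugation on `ℂᵐ`. -/
def conjV {m : ℕ} (v : Val m) : Val m := WithLp.toLp 2 (fun i => starRingEnd ℂ (v i))

/-- The gradient `(∂₁ w, …, ∂ₙ w)`. -/
def grad {n m : ℕ} (w : Sp n → Val m) (x : Sp n) : Fin n → Val m :=
  fun i => fderiv ℝ w x (EuclideanSpace.single i 1)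

/-- The bilinear forms `B((u, ū), (∇u, ∇ū))`, with values in `ℂᵐ`. -/
abbrev BilinForm (n m : ℕ) : Type :=
  (Val m × Val m) →ₗ[ℂ] ((Fin n → Val m) × (Fin n → Val m)) →ₗ[ℂ] Val m

/-- The time independent term `N(w) = B((w, w̄), (∇w, ∇w̄)) + Δ w`. -/
def forcing {n m : ℕ} (B : BilinForm n m) (w : Sp n → Val m) (x : Sp n) : Val m :=
  B (w x, conjV (w x)) (grad w x, fun i => conjV (grad w x i)) + Δ w x

end DNLS

end

/-! The symbol of the low frequency part is supported in |ξ| ≤ 2, so the frequencies of N(w) are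
bounded too. Only finitely many dyadic pieces of N(w) survive, and its 𝒟Hˢ norm is controlled by its
𝒟L²_1 norm (`piece_forcing_eq_zero`, `exists_normDH_forcing_le`). At unit scale the quadratic term
is estimated crudely, with w in L^∞ and ∇w in 𝒟L²_1; the linear term needs Δw in 𝒟L²_1
(`nDL_forcing_le`).

To bound w, split it into the rescaled dyadic pieces of u₀ (`low_eq_sum`). The piece λ = 2^j of u₀
becomes a piece of frequency ρ = ελ, and only ελ ≤ 4 matters. Scaling bounds it in 𝒟L²_R, R = λ/ε,
by ε^{1-n/2} λ^{-s} M (`nDL_lowPiece_le`). The main tool is a Bernstein inequality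
(`exists_nDL_one_le`): for ρ ≤ 4 and ρR ≥ 1, passing from radius R to radius 1 at frequency ρ costs
(ρ^{n-1} R)^{1/2}. For these ρ and R all powers of ε cancel, and λ^{n/2-s} M remains. Every
derivative adds a factor ελ. The sup norm costs ρ^{n/2} instead (`exists_smear_le`), which leaves ε
λ^{n/2-s} M.

The Bernstein inequality holds because a function of frequency ρ ≲ 1 is nearly constant on unit
balls. The sum of its L² norms over the unit balls along a ray is thus at most a constant times a
line integral of averages at scale 1/ρ. Cut the ray into segments of length R: each segment pairs h
with a translate of one fixed kernel, and a continuous partition into balls of radius R bounds the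
sum of these pairings by the 𝒟L²_R norm (`exists_tsum_pairing_le`).

With δ = s - n/2 > 0, summing over λ gives ‖w‖_∞ ≲ εM, ‖∂w‖ ≲ S₁M and ‖∂²w‖ ≲ S₂M, where S₁ = ∑
ελ·λ^{-δ} and S₂ = ∑ (ελ)²λ^{-δ}. Hence the bound (εS₁ + S₂) max(M, M²). Always εS₁ ≲ ε; moreover S₂
≲ ε^δ when δ < 2 and S₂ ≲ ε when δ ≥ 2. If 1 ≤ δ < 2 then also εS₁ ≲ ε^δ, which is the minimum
(`exists_dyadic_sums_le`). -/

noncomputable section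

namespace DNLS

open scoped SchwartzMap LineDeriv

/-- The `L²` norm of a nonnegative function. -/
def l2 {α : Type*} [MeasurableSpace α] (μ : Measure α) (h : α → ℝ≥0∞) : ℝ≥0∞ :=
  (∫⁻ x, h x ^ 2 ∂μ) ^ (1 / 2 : ℝ)

/-! ### L² norms of nonnegative functions: Cauchy-Schwarz and Minkowski. -/

section L2

variable {α β : Type*} [MeasurableSpace α] [MeasurableSpace β] {μ : Measure α} {ν : Measure β}

lemma rpow_half_sq (a : ℝ≥0∞) : (a ^ (1 / 2 : ℝ)) ^ 2 = a := by
  rw [← ENNReal.rpow_two, ← ENNReal.rpow_mul]; norm_num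

lemma sq_rpow_half (a : ℝ≥0∞) : (a ^ 2) ^ (1 / 2 : ℝ) = a := by
  rw [← ENNReal.rpow_two, ← ENNReal.rpow_mul]; norm_num

lemma le_of_sq_le_sq {a b : ℝ≥0∞} (h : a ^ 2 ≤ b ^ 2) : a ≤ b := by
  rw [← sq_rpow_half a, ← sq_rpow_half b]
  exact ENNReal.rpow_le_rpow h (by norm_num)

lemma l2_sq (μ : Measure α) (h : α → ℝ≥0∞) : l2 μ h ^ 2 = ∫⁻ x, h x ^ 2 ∂μ :=
  rpow_half_sq _

lemma l2_mono {f g : α → ℝ≥0∞} (h : ∀ᵐ x ∂μ, f x ≤ g x) : l2 μ f ≤ l2 μ g := by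
  unfold l2
  refine ENNReal.rpow_le_rpow (lintegral_mono_ae ?_) (by norm_num)
  filter_upwards [h] with x hx
  gcongr

lemma l2_const_mul {c : ℝ≥0∞} {f : α → ℝ≥0∞} (hf : Measurable f) :
    l2 μ (fun x => c * f x) = c * l2 μ f := by
  unfold l2
  simp_rw [mul_pow]
  rw [lintegral_const_mul _ (hf.pow_const 2), ENNReal.mul_rpow_of_nonneg _ _ (by norm_num),
    sq_rpow_half]

/-- The Cauchy-Schwarz inequality. -/
lemma lintegral_mul_le_l2 {f g : α → ℝ≥0∞} (hf : Measurable f) (hg : Measurable g) :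
    ∫⁻ x, f x * g x ∂μ ≤ l2 μ f * l2 μ g := by
  have := ENNReal.lintegral_mul_le_Lp_mul_Lq μ (p := 2) (q := 2)
    (by constructor <;> norm_num) hf.aemeasurable hg.aemeasurable
  simpa [l2, ENNReal.rpow_two] using this

lemma l2_add_le {f g : α → ℝ≥0∞} (hf : Measurable f) (hg : Measurable g) :
    l2 μ (fun x => f x + g x) ≤ l2 μ f + l2 μ g := by
  have := ENNReal.lintegral_Lp_add_le (μ := μ) (p := 2) hf.aemeasurable hg.aemeasurable
    (by norm_num)
  simpa [l2, ENNReal.rpow_two] using this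

lemma measurable_l2_prod [SFinite μ] {F : α → β → ℝ≥0∞} (hF : Measurable (Function.uncurry F)) :
    Measurable (fun y => l2 μ (fun x => F x y)) := by
  unfold l2
  refine Measurable.pow_const ?_ _
  exact Measurable.lintegral_prod_left' (f := fun p : α × β => F p.1 p.2 ^ 2) (hF.pow_const 2)

/-- Minkowski's integral inequality. -/
lemma l2_lintegral_le [SFinite μ] [SFinite ν] {F : α → β → ℝ≥0∞}
    (hF : Measurable (Function.uncurry F)) :
    l2 μ (fun x => ∫⁻ y, F x y ∂ν) ≤ ∫⁻ y, l2 μ (fun x => F x y) ∂ν := by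
  -- The squared inner integral is a double integral over ν × ν, so Fubini and Cauchy-Schwarz in x
  -- suffice, without duality.
  apply le_of_sq_le_sq
  have h1 : ∀ x, Measurable (F x) := fun x => hF.comp measurable_prodMk_left
  have h2 : ∀ y, Measurable (fun x => F x y) := fun y => hF.comp measurable_prodMk_right
  have hm : Measurable (fun y => l2 μ (fun x => F x y)) := measurable_l2_prod hF
  calc l2 μ (fun x => ∫⁻ y, F x y ∂ν) ^ 2
      = ∫⁻ x, (∫⁻ y, F x y ∂ν) ^ 2 ∂μ := l2_sq _ _
    _ = ∫⁻ x, ∫⁻ p, F x p.1 * F x p.2 ∂(ν.prod ν) ∂μ := by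
        refine lintegral_congr fun x => ?_
        rw [lintegral_prod_mul (h1 x).aemeasurable (h1 x).aemeasurable, sq]
    _ = ∫⁻ p, ∫⁻ x, F x p.1 * F x p.2 ∂μ ∂(ν.prod ν) := by
        apply lintegral_lintegral_swap
        apply Measurable.aemeasurable
        exact (hF.comp (measurable_fst.prodMk (measurable_fst.comp measurable_snd))).mul
          (hF.comp (measurable_fst.prodMk (measurable_snd.comp measurable_snd)))
    _ ≤ ∫⁻ p, l2 μ (fun x => F x p.1) * l2 μ (fun x => F x p.2) ∂(ν.prod ν) :=
        lintegral_mono fun p => lintegral_mul_le_l2 (h2 _) (h2 _)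
    _ = (∫⁻ y, l2 μ (fun x => F x y) ∂ν) ^ 2 := by
        rw [lintegral_prod_mul hm.aemeasurable hm.aemeasurable, sq]

end L2

/-! ### The 𝒟L²_r norm on nonnegative functions, and convolutions. -/

section NormDL

variable {n m : ℕ}

/-- The balls occurring in the norm `𝒟L²_r`. -/
def dBall (r : ℝ) (x₀ θ : Sp n) (k : ℕ) : Set (Sp n) :=
  Metric.ball (x₀ + ((k : ℝ) * r) • θ) r

/-- The norm `𝒟L²_r` of a nonnegative function. -/
def nDL (r : ℝ) (h : Sp n → ℝ≥0∞) : ℝ≥0∞ :=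
  ⨆ x₀ : Sp n, ⨆ θ : Metric.sphere (0 : Sp n) 1,
    ∑' k : ℕ, l2 (volume.restrict (dBall r x₀ θ k)) h

/-- Reduces the norm to extended nonnegative integrals over balls, where sums and integrals may be
exchanged without finiteness assumptions. -/
lemma normDL_eq {r : ℝ} (hr : 0 < r) (v : Sp n → Val m) :
    normDL r v = nDL r (fun x => ‖v x‖ₑ) := by
  unfold normDL nDL
  refine iSup_congr fun x₀ => iSup_congr fun θ => tsum_congr fun k => ?_
  have hset : {x : Sp n | ‖r⁻¹ • (x - x₀) - (k : ℝ) • (θ : Sp n)‖ < 1} = dBall r x₀ θ k := by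
    ext x
    have : x - (x₀ + ((k : ℝ) * r) • (θ : Sp n))
        = r • (r⁻¹ • (x - x₀) - (k : ℝ) • (θ : Sp n)) := by
      rw [smul_sub, smul_smul, mul_inv_cancel₀ hr.ne', one_smul, smul_smul, mul_comm r]
      abel
    simp only [Set.mem_ofPred_eq, dBall, Metric.mem_ball, dist_eq_norm, this, norm_smul,
      Real.norm_eq_abs, abs_of_pos hr]
    constructor
    · intro h; nlinarith
    · intro h; by_contra! h'; nlinarith
  rw [hset, eLpNorm_indicator_eq_eLpNorm_restrict (by exact Metric.isOpen_ball.measurableSet),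
    eLpNorm_eq_lintegral_rpow_enorm_toReal (by norm_num) (by norm_num)]
  simp [l2]

lemma tsum_le_nDL (r : ℝ) (h : Sp n → ℝ≥0∞) (x₀ : Sp n) (θ : Metric.sphere (0 : Sp n) 1) :
    ∑' k : ℕ, l2 (volume.restrict (dBall r x₀ θ k)) h ≤ nDL r h :=
  le_iSup_of_le x₀ (le_iSup_of_le θ le_rfl)

lemma nDL_le {r : ℝ} {h : Sp n → ℝ≥0∞} {b : ℝ≥0∞}
    (H : ∀ (x₀ : Sp n) (θ : Metric.sphere (0 : Sp n) 1),
      ∑' k : ℕ, l2 (volume.restrict (dBall r x₀ θ k)) h ≤ b) : nDL r h ≤ b :=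
  iSup_le fun x₀ => iSup_le fun θ => H x₀ θ

lemma nDL_mono {r : ℝ} {f g : Sp n → ℝ≥0∞} (h : ∀ x, f x ≤ g x) : nDL r f ≤ nDL r g :=
  nDL_le fun x₀ θ => (ENNReal.tsum_le_tsum fun _ => l2_mono (.of_forall h)).trans
    (tsum_le_nDL r g x₀ θ)

lemma nDL_const_mul {r : ℝ} {c : ℝ≥0∞} {f : Sp n → ℝ≥0∞} (hf : Measurable f) :
    nDL r (fun x => c * f x) ≤ c * nDL r f :=
  nDL_le fun x₀ θ => by
    simp_rw [l2_const_mul hf]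
    rw [ENNReal.tsum_mul_left]
    gcongr
    exact tsum_le_nDL r f x₀ θ

lemma nDL_add_le {r : ℝ} {f g : Sp n → ℝ≥0∞} (hf : Measurable f) (hg : Measurable g) :
    nDL r (fun x => f x + g x) ≤ nDL r f + nDL r g :=
  nDL_le fun x₀ θ => by
    calc _ ≤ ∑' k : ℕ, (l2 (volume.restrict (dBall r x₀ θ k)) f
          + l2 (volume.restrict (dBall r x₀ θ k)) g) :=
          ENNReal.tsum_le_tsum fun k => l2_add_le hf hg
      _ ≤ _ := by
          rw [ENNReal.tsum_add]
          exact add_le_add (tsum_le_nDL r f x₀ θ) (tsum_le_nDL r g x₀ θ)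

lemma nDL_zero (r : ℝ) : nDL r (fun _ : Sp n => 0) = 0 :=
  le_antisymm (nDL_le fun x₀ θ => by simp [l2]) zero_le

lemma nDL_sum_le {ι : Type*} (s : Finset ι) {r : ℝ} {f : ι → Sp n → ℝ≥0∞}
    (hf : ∀ i, Measurable (f i)) :
    nDL r (fun x => ∑ i ∈ s, f i x) ≤ ∑ i ∈ s, nDL r (f i) := by
  classical
  induction s using Finset.induction_on with
  | empty => simp [nDL_zero]
  | insert a s ha ih =>
    simp_rw [Finset.sum_insert ha]
    refine (nDL_add_le (hf a) (Finset.measurable_fun_sum s fun i _ => hf i)).trans ?_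
    gcongr

lemma l2_restrict_ball_comp_sub (c y : Sp n) (r : ℝ) (h : Sp n → ℝ≥0∞) :
    l2 (volume.restrict (Metric.ball c r)) (fun x => h (x - y))
      = l2 (volume.restrict (Metric.ball (c - y) r)) h := by
  unfold l2
  congr 1
  rw [← lintegral_indicator Metric.isOpen_ball.measurableSet,
    ← lintegral_indicator Metric.isOpen_ball.measurableSet,
    ← lintegral_sub_right_eq_self ((Metric.ball (c - y) r).indicator fun x => h x ^ 2) y]
  refine lintegral_congr fun x => ?_
  have : x ∈ Metric.ball c r ↔ x - y ∈ Metric.ball (c - y) r := by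
    simp [Metric.mem_ball, dist_eq_norm]
  simp only [Set.indicator]
  by_cases hx : x ∈ Metric.ball c r
  · rw [if_pos hx, if_pos (this.1 hx)]
  · rw [if_neg hx, if_neg (fun h => hx (this.2 h))]

lemma nDL_comp_sub_le (r : ℝ) (y : Sp n) (h : Sp n → ℝ≥0∞) :
    nDL r (fun x => h (x - y)) ≤ nDL r h :=
  nDL_le fun x₀ θ => by
    refine le_trans (le_of_eq ?_) (tsum_le_nDL r h (x₀ - y) θ)
    refine tsum_congr fun k => ?_
    unfold dBall
    rw [l2_restrict_ball_comp_sub]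
    congr 3
    abel

/-- Convolution with an integrable kernel is bounded on `𝒟L²_r`. -/
lemma nDL_convolution_le (r : ℝ) {K h : Sp n → ℝ≥0∞} (hK : Measurable K) (hh : Measurable h) :
    nDL r (fun x => ∫⁻ y, K y * h (x - y)) ≤ (∫⁻ y, K y) * nDL r h :=
  nDL_le fun x₀ θ => by
    have hm : Measurable (Function.uncurry fun x y : Sp n => K y * h (x - y)) :=
      (hK.comp measurable_snd).mul (hh.comp (measurable_fst.sub measurable_snd))
    -- The sum over k is moved inside the integral in y, so that the supremum defining the norm is
    -- taken separately for each translate.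
    calc _ ≤ ∑' k : ℕ, ∫⁻ y, l2 (volume.restrict (dBall r x₀ θ k)) (fun x => K y * h (x - y)) :=
          ENNReal.tsum_le_tsum fun k => l2_lintegral_le hm
      _ = ∫⁻ y, ∑' k : ℕ, l2 (volume.restrict (dBall r x₀ θ k)) (fun x => K y * h (x - y)) := by
          rw [lintegral_tsum fun k => (measurable_l2_prod hm).aemeasurable]
      _ ≤ ∫⁻ y, K y * nDL r h := by
          refine lintegral_mono fun y => ?_
          refine (tsum_le_nDL r (fun x => K y * h (x - y)) x₀ θ).trans ?_
          refine (nDL_const_mul (hh.comp (measurable_id.sub_const y))).trans ?_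
          gcongr
          exact nDL_comp_sub_le r y h
      _ = _ := lintegral_mul_const _ hK

end NormDL

/-! ### The weight 1 + |x|. -/

section Weight

variable {E : Type*} [NormedAddCommGroup E]

/-- The weight `1 + ‖x‖`. -/
def wt (x : E) : ℝ≥0∞ := 1 + ‖x‖ₑ

lemma one_le_wt (x : E) : 1 ≤ wt x := le_self_add

lemma wt_ne_zero (x : E) : wt x ≠ 0 := (zero_lt_one.trans_le (one_le_wt x)).ne'

lemma wt_ne_top (x : E) : wt x ≠ ∞ := by simp [wt]

/-- Submultiplicativity allows polynomial weights to be moved from one variable of a convolution to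
another. -/
lemma wt_add_le (x y : E) : wt (x + y) ≤ wt x * wt y := by
  unfold wt
  calc 1 + ‖x + y‖ₑ ≤ 1 + (‖x‖ₑ + ‖y‖ₑ) := by gcongr; exact enorm_add_le x y
    _ ≤ 1 + (‖x‖ₑ + ‖y‖ₑ) + ‖x‖ₑ * ‖y‖ₑ := le_self_add
    _ = _ := by ring

lemma wt_neg (x : E) : wt (-x) = wt x := by simp [wt]

lemma wt_sub_comm (x y : E) : wt (x - y) = wt (y - x) := by rw [← neg_sub, wt_neg]

lemma wt_le_of_norm_le {F : Type*} [NormedAddCommGroup F] {x : E} {y : F} (h : ‖x‖ ≤ ‖y‖) :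
    wt x ≤ wt y := by
  unfold wt
  gcongr
  exact enorm_le_iff_norm_le.2 h

lemma wt_eq_ofReal (x : E) : wt x = ENNReal.ofReal (1 + ‖x‖) := by
  rw [wt, ENNReal.ofReal_add zero_le_one (norm_nonneg x), ofReal_norm, ENNReal.ofReal_one]

lemma wt_le_ofReal {x : E} {r : ℝ} (h : ‖x‖ ≤ r) : wt x ≤ ENNReal.ofReal (1 + r) := by
  rw [wt_eq_ofReal]
  gcongr

lemma measurable_wt [MeasurableSpace E] [BorelSpace E] : Measurable (wt : E → ℝ≥0∞) := by
  unfold wt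
  fun_prop

lemma inv_wt_pow_mul_wt_pow (x : E) (a b : ℕ) :
    (wt x ^ (a + b))⁻¹ * wt x ^ b = (wt x ^ a)⁻¹ := by
  have h := wt_ne_zero x
  have h' := wt_ne_top x
  rw [pow_add, ENNReal.mul_inv (Or.inl (pow_ne_zero _ h)) (Or.inl (ENNReal.pow_ne_top h')),
    mul_assoc, ENNReal.inv_mul_cancel (pow_ne_zero _ h) (ENNReal.pow_ne_top h'), mul_one]

lemma inv_wt_pow_le_inv_wt_pow (x : E) {a b : ℕ} (h : a ≤ b) :
    (wt x ^ b)⁻¹ ≤ (wt x ^ a)⁻¹ :=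
  ENNReal.inv_le_inv.2 (pow_le_pow_right₀ (one_le_wt x) h)

lemma inv_wt_pow_le_one (x : E) (a : ℕ) : (wt x ^ a)⁻¹ ≤ 1 :=
  ENNReal.inv_le_one.2 (one_le_pow₀ (one_le_wt x))

variable [NormedSpace ℝ E]

lemma wt_smul_le_wt_smul {a b : ℝ} (h : |a| ≤ |b|) (x : E) : wt (a • x) ≤ wt (b • x) := by
  apply wt_le_of_norm_le
  rw [norm_smul, norm_smul]
  gcongr
  exact h

variable [FiniteDimensional ℝ E] [MeasurableSpace E] [BorelSpace E]
  (μ : Measure E) [μ.IsAddHaarMeasure]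

lemma lintegral_inv_wt_pow_lt_top {k : ℕ} (hk : Module.finrank ℝ E < k) :
    ∫⁻ x : E, (wt x ^ k)⁻¹ ∂μ < ∞ := by
  have := finite_integral_one_add_norm (μ := μ) (r := k) (E := E) (by exact_mod_cast hk)
  refine lt_of_eq_of_lt (lintegral_congr fun x => ?_) this
  rw [wt_eq_ofReal, Real.rpow_neg (by positivity), Real.rpow_natCast,
    ENNReal.ofReal_inv_of_pos (by positivity), ENNReal.ofReal_pow (by positivity)]

lemma lintegral_comp_smul_pos {ρ : ℝ} (hρ : 0 < ρ) {G : E → ℝ≥0∞} (hG : Measurable G) :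
    ENNReal.ofReal ρ ^ Module.finrank ℝ E * ∫⁻ x, G (ρ • x) ∂μ = ∫⁻ x, G x ∂μ := by
  have h := lintegral_map (μ := μ) hG (measurable_const_smul ρ)
  have h2 := Measure.map_addHaar_smul μ hρ.ne'
  rw [show (fun x : E => ρ • x) = (ρ • ·) from rfl] at h
  rw [← h, h2, lintegral_smul_measure, smul_eq_mul, ← mul_assoc,
    ← ENNReal.ofReal_pow hρ.le, ← ENNReal.ofReal_mul (by positivity), abs_of_pos (by positivity),
    mul_inv_cancel₀ (by positivity), ENNReal.ofReal_one, one_mul]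

end Weight

/-! ### Pairing a translated kernel with a function in 𝒟L²_R. -/

section Pairing

variable {n : ℕ}

lemma l2_restrict {s : Set (Sp n)} (hs : MeasurableSet s) (h : Sp n → ℝ≥0∞) :
    l2 (volume.restrict s) h = l2 volume (fun x => s.indicator (fun _ => 1) x * h x) := by
  unfold l2
  rw [← lintegral_indicator hs]
  congr 1
  refine lintegral_congr fun x => ?_
  by_cases hx : x ∈ s <;> simp [hx]

lemma volume_ball_smul {R : ℝ} (hR : 0 < R) (x : Sp n) :
    volume {q : Sp n | x ∈ Metric.ball (R • q) R} = volume (Metric.ball (0 : Sp n) 1) := by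
  have : {q : Sp n | x ∈ Metric.ball (R • q) R} = Metric.ball (R⁻¹ • x) 1 := by
    ext q
    have h : x - R • q = R • (R⁻¹ • x - q) := by
      rw [smul_sub, smul_smul, mul_inv_cancel₀ hR.ne', one_smul]
    rw [Set.mem_ofPred_eq, Metric.mem_ball, Metric.mem_ball', dist_eq_norm, dist_eq_norm, h,
      norm_smul, Real.norm_eq_abs, abs_of_pos hR]
    constructor
    · intro h; nlinarith
    · intro h; nlinarith
  rw [this, Measure.addHaar_ball_center]

/-- The indicator function of `x ∈ ball (R q) R`. -/
def ballInd (R : ℝ) (x q : Sp n) : ℝ≥0∞ := (Metric.ball (R • q) R).indicator (fun _ => 1) x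

lemma measurableSet_ballInd (R : ℝ) :
    MeasurableSet {p : Sp n × Sp n | p.1 ∈ Metric.ball (R • p.2) R} := by
  apply IsOpen.measurableSet
  simp only [Metric.mem_ball]
  exact isOpen_lt (by fun_prop) continuous_const

lemma measurable_ballInd (R : ℝ) : Measurable (Function.uncurry (ballInd (n := n) R)) := by
  have : Function.uncurry (ballInd (n := n) R)
      = {p : Sp n × Sp n | p.1 ∈ Metric.ball (R • p.2) R}.indicator (fun _ => 1) := by
    ext ⟨x, q⟩
    simp [ballInd, Function.uncurry, Set.indicator]
  rw [this]
  exact measurable_const.indicator (measurableSet_ballInd R)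

/-- For fixed x the admissible q fill a unit ball about x/R. Thus the balls of radius R about Rq
form a continuous partition of unity, up to a constant factor. -/
lemma lintegral_ballInd {R : ℝ} (hR : 0 < R) (x : Sp n) :
    ∫⁻ q, ballInd R x q = volume (Metric.ball (0 : Sp n) 1) := by
  have : (fun q => ballInd R x q)
      = {q : Sp n | x ∈ Metric.ball (R • q) R}.indicator (fun _ => 1) := by
    ext q
    simp [ballInd, Set.indicator]
  have hm : MeasurableSet {q : Sp n | x ∈ Metric.ball (R • q) R} :=
    measurable_prodMk_left (measurableSet_ballInd R)
  rw [this, lintegral_indicator_const hm, one_mul, volume_ball_smul hR]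

lemma measurable_ballInd_mul {a : Sp n → ℝ≥0∞} (ha : Measurable a) (R : ℝ) :
    Measurable (Function.uncurry fun x q => ballInd R x q * a x) :=
  (measurable_ballInd R).mul (ha.comp measurable_fst)

lemma measurable_ballInd_mul_left {a : Sp n → ℝ≥0∞} (ha : Measurable a) (R : ℝ) (q : Sp n) :
    Measurable (fun x => ballInd R x q * a x) :=
  (measurable_const.indicator Metric.isOpen_ball.measurableSet).mul ha

lemma lintegral_ballInd_mul {R : ℝ} (hR : 0 < R) (x : Sp n) (c : ℝ≥0∞) :
    ∫⁻ q, ballInd R x q * c = volume (Metric.ball (0 : Sp n) 1) * c := by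
  have hIx : Measurable (ballInd R x) :=
    (measurable_ballInd R).of_uncurry_left
  rw [lintegral_mul_const _ hIx, lintegral_ballInd hR]

/-- The mass of `a` in the balls `ball (R q) R`. -/
def ballMass (R : ℝ) (a : Sp n → ℝ≥0∞) (q : Sp n) : ℝ≥0∞ :=
  l2 volume (fun x => ballInd R x q * a x)

lemma measurable_ballMass {a : Sp n → ℝ≥0∞} (ha : Measurable a) (R : ℝ) :
    Measurable (ballMass R a) := measurable_l2_prod (measurable_ballInd_mul ha R)

lemma l2_ball_add (R : ℝ) (h : Sp n → ℝ≥0∞) (q cen : Sp n) :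
    l2 (volume.restrict (Metric.ball (R • q + cen) R)) h
      = ballMass R (fun x => h (x + cen)) q := by
  have := l2_restrict_ball_comp_sub (R • q) (-cen) R h
  simp only [sub_neg_eq_add] at this
  rw [← this, l2_restrict Metric.isOpen_ball.measurableSet]
  rfl

/-- Insert the continuous partition and apply Cauchy-Schwarz on each ball. -/
lemma volume_mul_lintegral_le {R : ℝ} (hR : 0 < R) {a h : Sp n → ℝ≥0∞} (ha : Measurable a)
    (hh : Measurable h) (cen : Sp n) :
    volume (Metric.ball (0 : Sp n) 1) * ∫⁻ x, a (x - cen) * h x ≤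
      ∫⁻ q, ballMass R a q * l2 (volume.restrict (Metric.ball (R • q + cen) R)) h := by
  have e1 : ∫⁻ x, a (x - cen) * h x = ∫⁻ x, a x * h (x + cen) := by
    rw [← lintegral_sub_right_eq_self (fun x => a x * h (x + cen)) cen]
    simp
  have hc : Measurable (fun x => h (x + cen)) := hh.comp (measurable_id.add_const cen)
  have hmul : Measurable (fun x => a x * h (x + cen)) := ha.mul hc
  rw [e1, ← lintegral_const_mul _ hmul]
  calc ∫⁻ x, volume (Metric.ball (0 : Sp n) 1) * (a x * h (x + cen))
      = ∫⁻ x, ∫⁻ q, ballInd R x q * (a x * h (x + cen)) := by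
        refine lintegral_congr fun x => ?_
        rw [lintegral_ballInd_mul hR]
    _ = ∫⁻ q, ∫⁻ x, ballInd R x q * (a x * h (x + cen)) :=
        lintegral_lintegral_swap (measurable_ballInd_mul hmul R).aemeasurable
    _ ≤ _ := by
        refine lintegral_mono fun q => ?_
        have m1 := measurable_ballInd_mul_left ha R q
        have m2 := measurable_ballInd_mul_left hc R q
        rw [l2_ball_add]
        refine le_trans (le_of_eq (lintegral_congr fun x => ?_)) (lintegral_mul_le_l2 m1 m2)
        by_cases hx : x ∈ Metric.ball (R • q) R <;> simp [ballInd, hx]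

/-- For fixed q, the balls that meet h as l varies are exactly those of the single ray starting at
Rq + x₀, so their sum is at most the 𝒟L²_R norm. -/
lemma volume_mul_tsum_le {R : ℝ} (hR : 0 < R) {a h : Sp n → ℝ≥0∞} (ha : Measurable a)
    (hh : Measurable h) (x₀ : Sp n) (θ : Metric.sphere (0 : Sp n) 1) :
    volume (Metric.ball (0 : Sp n) 1) *
        ∑' l : ℕ, ∫⁻ x, a (x - (x₀ + ((l : ℝ) * R) • (θ : Sp n))) * h x
      ≤ (∫⁻ q, ballMass R a q) * nDL R h := by
  rw [← ENNReal.tsum_mul_left]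
  calc _ ≤ ∑' l : ℕ, ∫⁻ q, ballMass R a q *
        l2 (volume.restrict (Metric.ball (R • q + (x₀ + ((l : ℝ) * R) • (θ : Sp n))) R)) h :=
        ENNReal.tsum_le_tsum fun l => volume_mul_lintegral_le hR ha hh _
    _ = ∫⁻ q, ∑' l : ℕ, ballMass R a q *
        l2 (volume.restrict (Metric.ball (R • q + (x₀ + ((l : ℝ) * R) • (θ : Sp n))) R)) h := by
        rw [lintegral_tsum]
        intro l
        simp_rw [l2_ball_add]
        exact ((measurable_ballMass ha R).mul (measurable_ballMass
          (hh.comp (measurable_id.add_const _)) R)).aemeasurable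
    _ ≤ ∫⁻ q, ballMass R a q * nDL R h := by
        refine lintegral_mono fun q => ?_
        rw [ENNReal.tsum_mul_left]
        gcongr
        refine le_trans (le_of_eq ?_) (tsum_le_nDL R h (R • q + x₀) θ)
        refine tsum_congr fun l => ?_
        rw [dBall, add_assoc]
    _ = _ := lintegral_mul_const _ (measurable_ballMass ha R)

lemma wt_le_of_mem_ball {R : ℝ} (hR : 0 < R) {x q : Sp n} (hx : x ∈ Metric.ball (R • q) R) :
    wt q ≤ 2 * wt (R⁻¹ • x) := by
  calc wt q = wt ((q - R⁻¹ • x) + R⁻¹ • x) := by rw [sub_add_cancel]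
    _ ≤ wt (q - R⁻¹ • x) * wt (R⁻¹ • x) := wt_add_le _ _
    _ ≤ _ := by
      gcongr
      refine (wt_le_ofReal (r := 1) ?_).trans (by norm_num)
      have h : q - R⁻¹ • x = (-R⁻¹) • (x - R • q) := by
        rw [smul_sub, smul_smul, neg_mul, inv_mul_cancel₀ hR.ne']
        simp only [neg_smul, one_smul]; abel
      rw [Metric.mem_ball, dist_eq_norm] at hx
      rw [h, norm_smul, norm_neg, norm_inv, Real.norm_eq_abs, abs_of_pos hR,
        inv_mul_le_iff₀ hR]
      linarith

/-- Since q is at distance at most 1 from x/R, the weight passes from q to x/R at the price 2^(n+1);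
then q is integrated out. -/
lemma lintegral_wt_mul_ballMass_le {R : ℝ} (hR : 0 < R) {a : Sp n → ℝ≥0∞} (ha : Measurable a) :
    ∫⁻ q, wt q ^ (n + 1) * ballMass R a q ^ 2 ≤
      (volume (Metric.ball (0 : Sp n) 1) * 2 ^ (n + 1)) *
        ∫⁻ x, a x ^ 2 * wt (R⁻¹ • x) ^ (n + 1) := by
  have hIa := measurable_ballInd_mul ha R
  calc ∫⁻ q, wt q ^ (n + 1) * ballMass R a q ^ 2
      = ∫⁻ q, ∫⁻ x, wt q ^ (n + 1) * (ballInd R x q * a x) ^ 2 := by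
        refine lintegral_congr fun q => ?_
        have := (measurable_ballInd_mul_left ha R q).pow_const 2
        rw [ballMass, l2_sq, ← lintegral_const_mul _ this]
    _ = ∫⁻ x, ∫⁻ q, wt q ^ (n + 1) * (ballInd R x q * a x) ^ 2 := by
        have hm : Measurable (fun p : Sp n × Sp n =>
            wt p.1 ^ (n + 1) * (ballInd R p.2 p.1 * a p.2) ^ 2) :=
          ((measurable_wt.comp measurable_fst).pow_const _).mul
            ((hIa.comp measurable_swap).pow_const 2)
        exact lintegral_lintegral_swap
          (f := fun q x : Sp n => wt q ^ (n + 1) * (ballInd R x q * a x) ^ 2) hm.aemeasurable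
    _ ≤ ∫⁻ x, ∫⁻ q, ballInd R x q * (2 ^ (n + 1) * (a x ^ 2 * wt (R⁻¹ • x) ^ (n + 1))) := by
        refine lintegral_mono fun x => lintegral_mono fun q => ?_
        by_cases hx : x ∈ Metric.ball (R • q) R
        · simp only [ballInd, Set.indicator_of_mem hx, one_mul]
          calc wt q ^ (n + 1) * a x ^ 2
              ≤ (2 * wt (R⁻¹ • x)) ^ (n + 1) * a x ^ 2 := by
                gcongr
                exact wt_le_of_mem_ball hR hx
            _ = _ := by ring
        · simp [ballInd, hx]
    _ = _ := by
        have hm : Measurable fun x => a x ^ 2 * wt (R⁻¹ • x) ^ (n + 1) :=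
          (ha.pow_const 2).mul ((measurable_wt.comp (measurable_const_smul _)).pow_const _)
        rw [mul_assoc, ← lintegral_const_mul _ hm, ← lintegral_const_mul _ (hm.const_mul _)]
        refine lintegral_congr fun x => ?_
        rw [lintegral_ballInd_mul hR]

/-- Cauchy-Schwarz against the weight of exponent n + 1, whose inverse is integrable on ℝⁿ. -/
lemma lintegral_ballMass_le {R : ℝ} (hR : 0 < R) {a : Sp n → ℝ≥0∞} (ha : Measurable a) :
    ∫⁻ q, ballMass R a q ≤ (∫⁻ x : Sp n, (wt x ^ (n + 1))⁻¹) ^ (1 / 2 : ℝ) *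
      ((volume (Metric.ball (0 : Sp n) 1) * 2 ^ (n + 1)) *
        ∫⁻ x, a x ^ 2 * wt (R⁻¹ • x) ^ (n + 1)) ^ (1 / 2 : ℝ) := by
  have hw : Measurable fun q : Sp n => wt q ^ (n + 1) := measurable_wt.pow_const _
  calc ∫⁻ q, ballMass R a q = ∫⁻ q : Sp n, ((wt q ^ (n + 1))⁻¹) ^ (1 / 2 : ℝ) *
      ((wt q ^ (n + 1)) ^ (1 / 2 : ℝ) * ballMass R a q) := by
        refine lintegral_congr fun q => ?_
        rw [← mul_assoc, ← ENNReal.mul_rpow_of_nonneg _ _ (by norm_num),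
          ENNReal.inv_mul_cancel (pow_ne_zero _ (wt_ne_zero q)) (ENNReal.pow_ne_top (wt_ne_top q)),
          ENNReal.one_rpow, one_mul]
    _ ≤ _ := lintegral_mul_le_l2 (hw.inv.pow_const _)
        ((hw.pow_const _).mul (measurable_ballMass ha R))
    _ ≤ _ := by
      unfold l2
      simp_rw [mul_pow, rpow_half_sq]
      gcongr
      exact lintegral_wt_mul_ballMass_le hR ha

/-- The pairing of a kernel `a`, moved along the points of a ray with spacing `R`, with `h` is
controlled by `𝒟L²_R`. -/
lemma exists_tsum_pairing_le (n : ℕ) : ∃ C : ℝ≥0∞, C ≠ ∞ ∧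
    ∀ (R : ℝ), 0 < R → ∀ a h : Sp n → ℝ≥0∞, Measurable a → Measurable h →
    ∀ (x₀ : Sp n) (θ : Metric.sphere (0 : Sp n) 1),
      ∑' l : ℕ, ∫⁻ x, a (x - (x₀ + ((l : ℝ) * R) • (θ : Sp n))) * h x ≤
        C * (∫⁻ x, a x ^ 2 * wt (R⁻¹ • x) ^ (n + 1)) ^ (1 / 2 : ℝ) * nDL R h := by
  have hv0 : volume (Metric.ball (0 : Sp n) 1) ≠ 0 :=
    (Metric.measure_ball_pos volume _ one_pos).ne'
  have hvt : volume (Metric.ball (0 : Sp n) 1) ≠ ∞ := measure_ball_lt_top.ne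
  have hct : ∫⁻ x : Sp n, (wt x ^ (n + 1))⁻¹ ≠ ∞ :=
    (lintegral_inv_wt_pow_lt_top volume (by simp)).ne
  refine ⟨(volume (Metric.ball (0 : Sp n) 1))⁻¹ *
    ((∫⁻ x : Sp n, (wt x ^ (n + 1))⁻¹) ^ (1 / 2 : ℝ) *
      (volume (Metric.ball (0 : Sp n) 1) * 2 ^ (n + 1)) ^ (1 / 2 : ℝ)), ?_, ?_⟩
  · exact ENNReal.mul_ne_top (ENNReal.inv_ne_top.2 hv0) (ENNReal.mul_ne_top
      (ENNReal.rpow_ne_top_of_nonneg (by norm_num) hct)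
      (ENNReal.rpow_ne_top_of_nonneg (by norm_num) (ENNReal.mul_ne_top hvt (by simp))))
  intro R hR a h ha hh x₀ θ
  rw [← one_mul (∑' l : ℕ, _), ← ENNReal.inv_mul_cancel hv0 hvt, mul_assoc, mul_assoc, mul_assoc]
  refine mul_le_mul_right ?_ _
  refine (volume_mul_tsum_le hR ha hh x₀ θ).trans ?_
  rw [← mul_assoc]
  gcongr
  refine (lintegral_ballMass_le hR ha).trans ?_
  rw [ENNReal.mul_rpow_of_nonneg _ (∫⁻ x, a x ^ 2 * wt (R⁻¹ • x) ^ (n + 1)) (by norm_num),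
    mul_assoc]

end Pairing

/-! ### Bernstein inequalities: from radius R to radius 1 and to the sup norm. -/

section Bernstein

variable {n : ℕ}

/-- The rapidly decreasing kernel `ρⁿ (1 + |ρ x|)^{-(2n+2)}`. -/
def decayKer (ρ : ℝ) (x : Sp n) : ℝ≥0∞ :=
  ENNReal.ofReal ρ ^ n * (wt (ρ • x) ^ (2 * n + 2))⁻¹

/-- Averages of `h` at scale `1/ρ`. -/
def smear (ρ : ℝ) (h : Sp n → ℝ≥0∞) (x : Sp n) : ℝ≥0∞ := ∫⁻ y, decayKer ρ (x - y) * h y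

lemma measurable_decayKer (ρ : ℝ) : Measurable (decayKer (n := n) ρ) :=
  ((measurable_wt.comp (measurable_const_smul ρ)).pow_const _).inv.const_mul _

lemma measurable_smear (ρ : ℝ) {h : Sp n → ℝ≥0∞} (hh : Measurable h) :
    Measurable (smear ρ h) := by
  have : Measurable (fun p : Sp n × Sp n => decayKer ρ (p.1 - p.2) * h p.2) :=
    ((measurable_decayKer ρ).comp (measurable_fst.sub measurable_snd)).mul (hh.comp measurable_snd)
  exact this.lintegral_prod_right'

lemma lintegral_scaled {ρ : ℝ} (hρ : 0 < ρ) {G : Sp n → ℝ≥0∞} (hG : Measurable G) (c : Sp n) :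
    ∫⁻ x, ENNReal.ofReal ρ ^ n * G (ρ • (x - c)) = ∫⁻ x, G x := by
  have h := lintegral_comp_smul_pos volume hρ hG
  rw [finrank_euclideanSpace_fin] at h
  rw [lintegral_sub_right_eq_self (fun x => ENNReal.ofReal ρ ^ n * G (ρ • x)) c,
    lintegral_const_mul _ (by fun_prop : Measurable fun x => G (ρ • x)), h]

/-- Moving the point by at most 2 moves the scaled argument by at most 8, which changes the weight
by a factor of at most 9 = 1 + 8. -/
lemma decayKer_sub_le {ρ : ℝ} (hρ : 0 < ρ) (hρ4 : ρ ≤ 4) {x x' : Sp n} (hx : ‖x - x'‖ ≤ 2)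
    (y : Sp n) : decayKer ρ (x - y) ≤ 9 ^ (2 * n + 2) * decayKer ρ (x' - y) := by
  have h1 : wt (ρ • (x' - y)) ≤ 9 * wt (ρ • (x - y)) := by
    have e : ρ • (x' - y) = ρ • (x' - x) + ρ • (x - y) := by rw [← smul_add]; congr 1; abel
    rw [e]
    refine (wt_add_le _ _).trans ?_
    gcongr
    refine (wt_le_ofReal (r := 8) ?_).trans (by norm_num)
    rw [norm_smul, Real.norm_eq_abs, abs_of_pos hρ, norm_sub_rev]
    nlinarith [norm_nonneg (x - x')]
  have h2 : (wt (ρ • (x - y)) ^ (2 * n + 2))⁻¹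
      ≤ 9 ^ (2 * n + 2) * (wt (ρ • (x' - y)) ^ (2 * n + 2))⁻¹ := by
    have : ((9 * wt (ρ • (x - y))) ^ (2 * n + 2))⁻¹ ≤ (wt (ρ • (x' - y)) ^ (2 * n + 2))⁻¹ :=
      ENNReal.inv_le_inv.2 (pow_le_pow_left₀ zero_le h1 _)
    refine le_trans (le_of_eq ?_) (mul_le_mul_right this _)
    rw [mul_pow, ENNReal.mul_inv (by simp) (by simp), ← mul_assoc, ENNReal.mul_inv_cancel
      (by simp) (by simp), one_mul]
  unfold decayKer
  calc _ ≤ ENNReal.ofReal ρ ^ n * (9 ^ (2 * n + 2) * (wt (ρ • (x' - y)) ^ (2 * n + 2))⁻¹) := by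
        gcongr
    _ = _ := by ring

lemma smear_le_of_near {ρ : ℝ} (hρ : 0 < ρ) (hρ4 : ρ ≤ 4) {h : Sp n → ℝ≥0∞} (hh : Measurable h)
    {x x' : Sp n} (hx : ‖x - x'‖ ≤ 2) : smear ρ h x ≤ 9 ^ (2 * n + 2) * smear ρ h x' := by
  unfold smear
  have : Measurable fun y => decayKer ρ (x' - y) * h y :=
    ((measurable_decayKer ρ).comp (measurable_id.const_sub x')).mul hh
  rw [← lintegral_const_mul _ this]
  refine lintegral_mono fun y => ?_
  rw [← mul_assoc]
  gcongr
  exact decayKer_sub_le hρ hρ4 hx y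

/-- Used with both spacings, 1 and R, to regroup the unit segments of a half-line into segments of
length R. -/
lemma tsum_lintegral_Ico {R : ℝ} (hR : 0 < R) (f : ℝ → ℝ≥0∞) :
    ∑' k : ℕ, ∫⁻ t in Set.Ico ((k : ℝ) * R) ((k + 1) * R), f t = ∫⁻ t in Set.Ici 0, f t := by
  have hU : Set.Ici (0 : ℝ) = ⋃ k : ℕ, Set.Ico ((k : ℝ) * R) ((k + 1) * R) := by
    ext t
    simp only [Set.mem_Ici, Set.mem_iUnion, Set.mem_Ico]
    constructor
    · intro ht
      refine ⟨⌊t / R⌋₊, ?_, ?_⟩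
      · rw [← le_div_iff₀ hR]; exact Nat.floor_le (by positivity)
      · rw [← div_lt_iff₀ hR]; exact Nat.lt_floor_add_one _
    · rintro ⟨k, hk, -⟩
      exact le_trans (by positivity) hk
  rw [hU, lintegral_iUnion (fun k => measurableSet_Ico)]
  intro i j hij
  rw [Function.onFun, Set.disjoint_left]
  rintro t ⟨h1, h2⟩ ⟨h3, h4⟩
  apply hij
  have a1 : (i : ℝ) < j + 1 := lt_of_mul_lt_mul_right (h1.trans_lt h4) hR.le
  have a2 : (j : ℝ) < i + 1 := lt_of_mul_lt_mul_right (h3.trans_lt h2) hR.le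
  have b1 : i < j + 1 := by exact_mod_cast a1
  have b2 : j < i + 1 := by exact_mod_cast a2
  omega

/-- A point of the k-th unit ball is within 2 of every point x₀ + tθ with k ≤ t < k + 1. The
averages there are comparable, so the supremum of H on the ball is bounded by an integral over the
unit segment. -/
lemma l2_dBall_one_le {ρ : ℝ} (hρ : 0 < ρ) (hρ4 : ρ ≤ 4) {h H : Sp n → ℝ≥0∞} (hh : Measurable h)
    (hH : ∀ x, H x ≤ smear ρ h x) (x₀ : Sp n) (θ : Metric.sphere (0 : Sp n) 1) (k : ℕ) :
    l2 (volume.restrict (dBall 1 x₀ θ k)) H ≤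
      (volume (Metric.ball (0 : Sp n) 1)) ^ (1 / 2 : ℝ) * 9 ^ (2 * n + 2) *
        ∫⁻ t in Set.Ico ((k : ℝ) * 1) ((k + 1) * 1), smear ρ h (x₀ + t • (θ : Sp n)) := by
  set D := 9 ^ (2 * n + 2) *
        ∫⁻ t in Set.Ico ((k : ℝ) * 1) ((k + 1) * 1), smear ρ h (x₀ + t • (θ : Sp n)) with hD
  have hθ : ‖(θ : Sp n)‖ = 1 := by simp
  have hms : Measurable fun t : ℝ => smear ρ h (x₀ + t • (θ : Sp n)) := by
    refine (measurable_smear ρ hh).comp ?_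
    fun_prop
  have hb : ∀ x ∈ dBall 1 x₀ θ k, H x ≤ D := by
    intro x hx
    refine (hH x).trans ?_
    rw [hD, ← lintegral_const_mul _ hms]
    calc smear ρ h x = ∫⁻ t in Set.Ico ((k : ℝ) * 1) ((k + 1) * 1), smear ρ h x := by
          simp
      _ ≤ _ := by
        refine setLIntegral_mono (hms.const_mul _) fun t ht => ?_
        refine smear_le_of_near hρ hρ4 hh ?_
        have e : x - (x₀ + t • (θ : Sp n))
            = (x - (x₀ + ((k : ℝ) * 1) • (θ : Sp n))) + ((k : ℝ) - t) • (θ : Sp n) := by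
          rw [sub_smul, mul_one]; abel
        rw [dBall, Metric.mem_ball, dist_eq_norm] at hx
        rw [e]
        refine (norm_add_le _ _).trans ?_
        rw [norm_smul, hθ, mul_one ‖_‖, Real.norm_eq_abs]
        have : |(k : ℝ) - t| ≤ 1 := by
          obtain ⟨h1, h2⟩ := ht
          rw [abs_le]; constructor <;> linarith
        linarith
  calc l2 (volume.restrict (dBall 1 x₀ θ k)) H
      ≤ l2 (volume.restrict (dBall 1 x₀ θ k)) (fun _ => D) := by
        refine l2_mono ?_
        rw [ae_restrict_iff' (by exact Metric.isOpen_ball.measurableSet)]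
        exact .of_forall hb
    _ = (volume (Metric.ball (0 : Sp n) 1)) ^ (1 / 2 : ℝ) * D := by
        unfold l2
        rw [lintegral_const, Measure.restrict_apply_univ, dBall, Measure.addHaar_ball_center,
          ENNReal.mul_rpow_of_nonneg _ _ (by norm_num), sq_rpow_half, mul_comm]
    _ = _ := by rw [hD, mul_assoc]

/-- The integral of `decayKer` over a segment of length `R`. -/
def segKer (ρ R : ℝ) (θ z : Sp n) : ℝ≥0∞ := ∫⁻ t in Set.Ico 0 R, decayKer ρ (t • θ - z)

lemma measurable_decayKer_seg (ρ : ℝ) (θ : Sp n) :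
    Measurable (fun p : Sp n × ℝ => decayKer ρ (p.2 • θ - p.1)) := by
  refine (measurable_decayKer ρ).comp ?_
  fun_prop

lemma measurable_segKer (ρ R : ℝ) (θ : Sp n) : Measurable (segKer ρ R θ) :=
  (measurable_decayKer_seg ρ θ).lintegral_prod_right'

/-- By Fubini, the line integral over the l-th segment pairs h with the translate, by the starting
point of that segment, of a kernel independent of l. This is the input of `exists_tsum_pairing_le`.
-/
lemma lintegral_smear_segment {ρ R : ℝ} {h : Sp n → ℝ≥0∞} (hh : Measurable h)
    (x₀ θ : Sp n) (l : ℕ) :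
    ∫⁻ t in Set.Ico ((l : ℝ) * R) ((l + 1) * R), smear ρ h (x₀ + t • θ)
      = ∫⁻ x, segKer ρ R θ (x - (x₀ + ((l : ℝ) * R) • θ)) * h x := by
  have h1 : ∫⁻ t in Set.Ico ((l : ℝ) * R) ((l + 1) * R), smear ρ h (x₀ + t • θ)
      = ∫⁻ t in Set.Ico 0 R, smear ρ h (x₀ + (t + (l : ℝ) * R) • θ) := by
    rw [← lintegral_indicator measurableSet_Ico, ← lintegral_indicator measurableSet_Ico,
      ← lintegral_add_right_eq_self _ ((l : ℝ) * R)]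
    refine lintegral_congr fun t => ?_
    have : t + (l : ℝ) * R ∈ Set.Ico ((l : ℝ) * R) ((l + 1) * R) ↔ t ∈ Set.Ico 0 R := by
      simp only [Set.mem_Ico]
      constructor <;> rintro ⟨h1, h2⟩ <;> constructor <;> linarith
    by_cases ht : t ∈ Set.Ico 0 R
    · rw [Set.indicator_of_mem ht, Set.indicator_of_mem (this.2 ht)]
    · rw [Set.indicator_of_notMem ht, Set.indicator_of_notMem (fun h => ht (this.1 h))]
  have hm : Measurable (fun p : ℝ × Sp n =>
      decayKer ρ (x₀ + (p.1 + (l : ℝ) * R) • θ - p.2) * h p.2) := by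
    refine Measurable.mul ((measurable_decayKer ρ).comp ?_) (hh.comp measurable_snd)
    fun_prop
  rw [h1]
  unfold smear
  rw [lintegral_lintegral_swap hm.aemeasurable]
  refine lintegral_congr fun x => ?_
  have hm2 : Measurable fun t : ℝ => decayKer ρ (x₀ + (t + (l : ℝ) * R) • θ - x) := by
    refine (measurable_decayKer ρ).comp ?_
    fun_prop
  rw [lintegral_mul_const _ hm2, segKer]
  congr 1
  refine lintegral_congr fun t => ?_
  congr 1
  rw [add_smul]
  abel

/-- Projection onto θ gives |tθ - z| ≥ |t - ⟨θ, z⟩|. Two powers of decay suffice to integrate over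
the whole line, and the change of variables gains ρ⁻¹. -/
lemma segKer_le {ρ : ℝ} (hρ : 0 < ρ) (R : ℝ) (θ : Metric.sphere (0 : Sp n) 1) (z : Sp n) :
    segKer ρ R (θ : Sp n) z ≤
      ENNReal.ofReal (ρ ^ n * ρ⁻¹) * ∫⁻ t : ℝ, (wt t ^ 2)⁻¹ := by
  have hθ : ‖(θ : Sp n)‖ = 1 := by simp
  set b : ℝ := inner ℝ (θ : Sp n) z
  have hpt : ∀ t : ℝ, decayKer ρ (t • (θ : Sp n) - z)
      ≤ ENNReal.ofReal ρ ^ n * (wt (ρ • (t - b)) ^ 2)⁻¹ := by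
    intro t
    unfold decayKer
    refine mul_le_mul' le_rfl ?_
    refine (inv_wt_pow_le_inv_wt_pow (ρ • (t • (θ : Sp n) - z))
      (show 2 ≤ 2 * n + 2 by omega)).trans ?_
    refine ENNReal.inv_le_inv.2 (pow_le_pow_left₀ zero_le ?_ _)
    apply wt_le_of_norm_le
    rw [norm_smul, norm_smul]
    gcongr
    have e : t - b = inner ℝ (θ : Sp n) (t • (θ : Sp n) - z) := by
      rw [inner_sub_right, inner_smul_right, real_inner_self_eq_norm_sq, hθ]; simp [b]
    rw [e]
    refine (norm_inner_le_norm _ _).trans ?_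
    rw [hθ, one_mul]
  have hG : Measurable fun t : ℝ => (wt t ^ 2)⁻¹ := (measurable_wt.pow_const 2).inv
  have hG2 : Measurable fun t : ℝ => (wt (ρ • (t - b)) ^ 2)⁻¹ := hG.comp (by fun_prop)
  calc segKer ρ R (θ : Sp n) z ≤ ∫⁻ t in Set.Ico 0 R, ENNReal.ofReal ρ ^ n * (wt (ρ • (t - b)) ^ 2)⁻¹ :=
        lintegral_mono hpt
    _ ≤ ∫⁻ t, ENNReal.ofReal ρ ^ n * (wt (ρ • (t - b)) ^ 2)⁻¹ := setLIntegral_le_lintegral _ _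
    _ = ENNReal.ofReal ρ ^ n * ∫⁻ t, (wt (ρ • t) ^ 2)⁻¹ := by
        rw [lintegral_const_mul _ hG2,
          lintegral_sub_right_eq_self (fun t => (wt (ρ • t) ^ 2)⁻¹) b]
    _ = ENNReal.ofReal (ρ ^ n * ρ⁻¹) * ∫⁻ t : ℝ, (wt t ^ 2)⁻¹ := by
        have h := lintegral_comp_smul_pos volume hρ hG
        rw [Module.finrank_self, pow_one] at h
        rw [← h, ← mul_assoc, ENNReal.ofReal_mul (by positivity), ENNReal.ofReal_pow hρ.le,
          mul_assoc (_ ^ n), ← ENNReal.ofReal_mul (by positivity), inv_mul_cancel₀ hρ.ne',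
          ENNReal.ofReal_one, mul_one]

/-- Since 1/R ≤ ρ, half of the exponent 2n + 2 of the kernel absorbs the weight; the remaining n + 1
powers are still integrable. -/
lemma decayKer_mul_wt_le {ρ R : ℝ} (hρ : 0 < ρ) (hR : 0 < R) (hρR : 1 ≤ ρ * R) (x : Sp n) :
    decayKer ρ x * wt (R⁻¹ • x) ^ (n + 1) ≤
      ENNReal.ofReal ρ ^ n * (wt (ρ • x) ^ (n + 1))⁻¹ := by
  have h : R⁻¹ ≤ ρ := by
    rw [inv_le_iff_one_le_mul₀ hR]; linarith
  have h1 : wt (R⁻¹ • x) ≤ wt (ρ • x) := by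
    apply wt_smul_le_wt_smul
    rw [abs_of_pos hρ, abs_of_pos (inv_pos.2 hR)]
    exact h
  unfold decayKer
  rw [mul_assoc]
  gcongr
  calc _ ≤ (wt (ρ • x) ^ (n + 1 + (n + 1)))⁻¹ * wt (ρ • x) ^ (n + 1) := by
        rw [show 2 * n + 2 = n + 1 + (n + 1) by ring]
        gcongr
    _ = _ := inv_wt_pow_mul_wt_pow _ _ _

lemma decayKer_neg (ρ : ℝ) (x : Sp n) : decayKer ρ (-x) = decayKer ρ x := by
  unfold decayKer
  rw [smul_neg, wt_neg]

/-- Every t in the segment contributes a bounded mass, hence the factor R. Recentring the weight at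
tθ costs only a factor 2 in its base, because |tθ| ≤ R. -/
lemma lintegral_segKer_mul_wt_le {ρ R : ℝ} (hρ : 0 < ρ) (hR : 0 < R) (hρR : 1 ≤ ρ * R)
    (θ : Metric.sphere (0 : Sp n) 1) :
    ∫⁻ x, segKer ρ R (θ : Sp n) x * wt (R⁻¹ • x) ^ (n + 1) ≤
      ENNReal.ofReal R * (2 ^ (n + 1) * ∫⁻ x : Sp n, (wt x ^ (n + 1))⁻¹) := by
  have hθ : ‖(θ : Sp n)‖ = 1 := by simp
  have hw : Measurable fun x : Sp n => wt (R⁻¹ • x) ^ (n + 1) :=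
    (measurable_wt.comp (measurable_const_smul _)).pow_const _
  have hG : Measurable fun x : Sp n => (wt x ^ (n + 1))⁻¹ := (measurable_wt.pow_const _).inv
  have hm : Measurable (fun p : Sp n × ℝ =>
      decayKer ρ (p.2 • (θ : Sp n) - p.1) * wt (R⁻¹ • p.1) ^ (n + 1)) :=
    (measurable_decayKer_seg ρ _).mul (hw.comp measurable_fst)
  calc ∫⁻ x, segKer ρ R (θ : Sp n) x * wt (R⁻¹ • x) ^ (n + 1)
      = ∫⁻ x, ∫⁻ t in Set.Ico 0 R,
          decayKer ρ (t • (θ : Sp n) - x) * wt (R⁻¹ • x) ^ (n + 1) := by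
        refine lintegral_congr fun x => ?_
        have : Measurable fun t : ℝ => decayKer ρ (t • (θ : Sp n) - x) :=
          (measurable_decayKer ρ).comp (by fun_prop)
        rw [lintegral_mul_const _ this, segKer]
    _ = ∫⁻ t in Set.Ico 0 R, ∫⁻ x,
          decayKer ρ (t • (θ : Sp n) - x) * wt (R⁻¹ • x) ^ (n + 1) :=
        lintegral_lintegral_swap hm.aemeasurable
    _ ≤ ∫⁻ t in Set.Ico 0 R, 2 ^ (n + 1) * ∫⁻ x : Sp n, (wt x ^ (n + 1))⁻¹ := by
        refine setLIntegral_mono measurable_const fun t ht => ?_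
        have hm' : Measurable fun x : Sp n =>
            ENNReal.ofReal ρ ^ n * (wt (ρ • (x - t • (θ : Sp n))) ^ (n + 1))⁻¹ :=
          (hG.comp ((measurable_const_smul ρ).comp (measurable_id.sub_const _))).const_mul _
        rw [← lintegral_scaled hρ hG (t • (θ : Sp n)), ← lintegral_const_mul _ hm']
        refine lintegral_mono fun x => ?_
        have h1 : wt (R⁻¹ • x) ≤ 2 * wt (R⁻¹ • (x - t • (θ : Sp n))) := by
          have e : R⁻¹ • x = R⁻¹ • t • (θ : Sp n) + R⁻¹ • (x - t • (θ : Sp n)) := by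
            rw [← smul_add]; congr 1; abel
          rw [e]
          refine (wt_add_le _ _).trans ?_
          gcongr
          refine (wt_le_ofReal (r := 1) ?_).trans (by norm_num)
          rw [norm_smul, norm_smul, hθ, mul_one, norm_inv, Real.norm_eq_abs, Real.norm_eq_abs,
            abs_of_pos hR, abs_of_nonneg ht.1, inv_mul_le_iff₀ hR, mul_one]
          exact ht.2.le
        rw [← neg_sub x, decayKer_neg]
        calc decayKer ρ (x - t • (θ : Sp n)) * wt (R⁻¹ • x) ^ (n + 1)
            ≤ decayKer ρ (x - t • (θ : Sp n)) *
              (2 * wt (R⁻¹ • (x - t • (θ : Sp n)))) ^ (n + 1) := by gcongr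
          _ = 2 ^ (n + 1) * (decayKer ρ (x - t • (θ : Sp n)) *
              wt (R⁻¹ • (x - t • (θ : Sp n))) ^ (n + 1)) := by rw [mul_pow]; ring
          _ ≤ _ := by
            exact mul_le_mul' le_rfl (decayKer_mul_wt_le hρ hR hρR _)
    _ = _ := by
        rw [lintegral_const, Measure.restrict_apply_univ, Real.volume_Ico, sub_zero, mul_comm]

/-- One factor is bounded by its supremum ρ^(n-1), the other by its weighted mass R. -/
lemma lintegral_segKer_sq_mul_wt_le {ρ R : ℝ} (hρ : 0 < ρ) (hR : 0 < R) (hρR : 1 ≤ ρ * R)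
    (θ : Metric.sphere (0 : Sp n) 1) :
    ∫⁻ x, segKer ρ R (θ : Sp n) x ^ 2 * wt (R⁻¹ • x) ^ (n + 1) ≤
      ((∫⁻ t : ℝ, (wt t ^ 2)⁻¹) * (2 ^ (n + 1) * ∫⁻ x : Sp n, (wt x ^ (n + 1))⁻¹)) *
        ENNReal.ofReal (ρ ^ n * ρ⁻¹ * R) := by
  have hw : Measurable fun x : Sp n => wt (R⁻¹ • x) ^ (n + 1) :=
    (measurable_wt.comp (measurable_const_smul _)).pow_const _
  have hm : Measurable fun x : Sp n => segKer ρ R (θ : Sp n) x * wt (R⁻¹ • x) ^ (n + 1) :=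
    (measurable_segKer ρ R (θ : Sp n)).mul hw
  calc ∫⁻ x, segKer ρ R (θ : Sp n) x ^ 2 * wt (R⁻¹ • x) ^ (n + 1)
      ≤ ∫⁻ x, (ENNReal.ofReal (ρ ^ n * ρ⁻¹) * ∫⁻ t : ℝ, (wt t ^ 2)⁻¹) *
          (segKer ρ R (θ : Sp n) x * wt (R⁻¹ • x) ^ (n + 1)) := by
        refine lintegral_mono fun x => ?_
        rw [sq, mul_assoc]
        exact mul_le_mul' (segKer_le hρ R θ x) le_rfl
    _ = (ENNReal.ofReal (ρ ^ n * ρ⁻¹) * ∫⁻ t : ℝ, (wt t ^ 2)⁻¹) *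
          ∫⁻ x, segKer ρ R (θ : Sp n) x * wt (R⁻¹ • x) ^ (n + 1) :=
        lintegral_const_mul _ hm
    _ ≤ (ENNReal.ofReal (ρ ^ n * ρ⁻¹) * ∫⁻ t : ℝ, (wt t ^ 2)⁻¹) *
          (ENNReal.ofReal R * (2 ^ (n + 1) * ∫⁻ x : Sp n, (wt x ^ (n + 1))⁻¹)) :=
        mul_le_mul' le_rfl (lintegral_segKer_mul_wt_le hρ hR hρR θ)
    _ = _ := by
        rw [ENNReal.ofReal_mul (by positivity : 0 ≤ ρ ^ n * ρ⁻¹)]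
        ring

/-- Bernstein's inequality for the `𝒟L²` norms. -/
lemma exists_nDL_one_le (n : ℕ) : ∃ C : ℝ≥0∞, C ≠ ∞ ∧
    ∀ ρ R : ℝ, 0 < ρ → ρ ≤ 4 → 0 < R → 1 ≤ ρ * R → ∀ h H : Sp n → ℝ≥0∞, Measurable h →
      (∀ x, H x ≤ smear ρ h x) →
      nDL 1 H ≤ C * ENNReal.ofReal (ρ ^ n * ρ⁻¹ * R) ^ (1 / 2 : ℝ) * nDL R h := by
  obtain ⟨C₁, hC₁, hpair⟩ := exists_tsum_pairing_le n
  set c₁ := ∫⁻ x : Sp n, (wt x ^ (n + 1))⁻¹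
  have hc₁ : c₁ ≠ ∞ := (lintegral_inv_wt_pow_lt_top volume (by simp)).ne
  set c₂ := ∫⁻ t : ℝ, (wt t ^ 2)⁻¹
  have hc₂ : c₂ ≠ ∞ := (lintegral_inv_wt_pow_lt_top volume (by simp)).ne
  set c₃ := (volume (Metric.ball (0 : Sp n) 1)) ^ (1 / 2 : ℝ) * 9 ^ (2 * n + 2)
  have hc₃ : c₃ ≠ ∞ := ENNReal.mul_ne_top
    (ENNReal.rpow_ne_top_of_nonneg (by norm_num) measure_ball_lt_top.ne) (by simp)
  refine ⟨c₃ * (C₁ * (c₂ * (2 ^ (n + 1) * c₁)) ^ (1 / 2 : ℝ)), ?_, ?_⟩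
  · exact ENNReal.mul_ne_top hc₃ (ENNReal.mul_ne_top hC₁ (ENNReal.rpow_ne_top_of_nonneg
      (by norm_num) (ENNReal.mul_ne_top hc₂ (ENNReal.mul_ne_top (by simp) hc₁))))
  intro ρ R hρ hρ4 hR hρR h H hh hH
  refine nDL_le fun x₀ θ => ?_
  have hseg : ∑' k : ℕ, l2 (volume.restrict (dBall 1 x₀ θ k)) H ≤ c₃ *
      ∑' l : ℕ, ∫⁻ x, segKer ρ R θ (x - (x₀ + ((l : ℝ) * R) • (θ : Sp n))) * h x := by
    calc _ ≤ ∑' k : ℕ, c₃ * ∫⁻ t in Set.Ico ((k : ℝ) * 1) ((k + 1) * 1),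
          smear ρ h (x₀ + t • (θ : Sp n)) :=
          ENNReal.tsum_le_tsum fun k => l2_dBall_one_le hρ hρ4 hh hH x₀ θ k
      _ = _ := by
          -- Unit segments are glued to the half-line, which is cut again into segments of length R.
          rw [ENNReal.tsum_mul_left, tsum_lintegral_Ico one_pos, ← tsum_lintegral_Ico hR]
          simp_rw [lintegral_smear_segment hh]
  refine hseg.trans ?_
  rw [mul_assoc c₃, mul_assoc c₃]
  gcongr
  refine (hpair R hR (segKer ρ R θ) h (measurable_segKer _ _ _) hh x₀ θ).trans ?_
  rw [mul_assoc C₁ _ (ENNReal.ofReal _ ^ _), ← ENNReal.mul_rpow_of_nonneg _ _ (by norm_num)]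
  gcongr
  exact lintegral_segKer_sq_mul_wt_le hρ hR hρR θ

/-- A single value of the average is the term l = 0 of the pairing sum. The positive dimension
supplies a direction θ, without which the supremum in the norm would be empty. In the square of the
kernel one factor is bounded by ρⁿ, the other is integrable against the weight. -/
lemma exists_smear_le {n : ℕ} (hn : 0 < n) : ∃ C : ℝ≥0∞, C ≠ ∞ ∧
    ∀ ρ R : ℝ, 0 < ρ → 0 < R → 1 ≤ ρ * R → ∀ h : Sp n → ℝ≥0∞, Measurable h →
      ∀ x, smear ρ h x ≤ C * ENNReal.ofReal (ρ ^ n) ^ (1 / 2 : ℝ) * nDL R h := by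
  obtain ⟨C₁, hC₁, hpair⟩ := exists_tsum_pairing_le n
  set c₁ := ∫⁻ x : Sp n, (wt x ^ (n + 1))⁻¹ with hc
  have hc₁ : c₁ ≠ ∞ := (lintegral_inv_wt_pow_lt_top volume (by simp)).ne
  refine ⟨C₁ * c₁ ^ (1 / 2 : ℝ),
    ENNReal.mul_ne_top hC₁ (ENNReal.rpow_ne_top_of_nonneg (by norm_num) hc₁), ?_⟩
  intro ρ R hρ hR hρR h hh x
  let θ : Metric.sphere (0 : Sp n) 1 := ⟨EuclideanSpace.single ⟨0, hn⟩ 1, by simp⟩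
  have hG : Measurable fun x : Sp n => (wt x ^ (n + 1))⁻¹ := (measurable_wt.pow_const _).inv
  have e : smear ρ h x = ∫⁻ y, decayKer ρ (y - (x + (((0 : ℕ) : ℝ) * R) • (θ : Sp n))) * h y := by
    unfold smear
    refine lintegral_congr fun y => ?_
    rw [← decayKer_neg, neg_sub]
    simp
  rw [e]
  refine (ENNReal.le_tsum (f := fun l : ℕ =>
    ∫⁻ y, decayKer ρ (y - (x + ((l : ℝ) * R) • (θ : Sp n))) * h y) 0).trans ?_
  refine (hpair R hR _ h (measurable_decayKer ρ) hh x θ).trans ?_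
  rw [mul_assoc C₁ _ (ENNReal.ofReal _ ^ _), ← ENNReal.mul_rpow_of_nonneg _ _ (by norm_num)]
  gcongr
  calc ∫⁻ x, decayKer ρ x ^ 2 * wt (R⁻¹ • x) ^ (n + 1)
      ≤ ∫⁻ x : Sp n, ENNReal.ofReal ρ ^ n *
          (ENNReal.ofReal ρ ^ n * (wt (ρ • (x - 0)) ^ (n + 1))⁻¹) := by
        refine lintegral_mono fun x => ?_
        rw [sq, mul_assoc, sub_zero]
        refine mul_le_mul' ?_ ?_
        · unfold decayKer
          calc _ ≤ ENNReal.ofReal ρ ^ n * 1 := by gcongr; exact inv_wt_pow_le_one _ _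
            _ = _ := mul_one _
        · exact decayKer_mul_wt_le hρ hR hρR x
    _ = _ := by
        have hm : Measurable fun x : Sp n =>
            ENNReal.ofReal ρ ^ n * (wt (ρ • (x - 0)) ^ (n + 1))⁻¹ :=
          (hG.comp (measurable_const_smul ρ |>.comp (measurable_id.sub_const 0))).const_mul _
        rw [lintegral_const_mul _ hm, lintegral_scaled hρ hG,
          ENNReal.ofReal_pow hρ.le, mul_comm]

lemma l2_restrict_biUnion_le {α ι : Type*} [MeasurableSpace α] {μ : Measure α} (T : Finset ι)
    (s : ι → Set α) (h : α → ℝ≥0∞) :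
    l2 (μ.restrict (⋃ i ∈ T, s i)) h ≤ ∑ i ∈ T, l2 (μ.restrict (s i)) h := by
  classical
  induction T using Finset.induction_on with
  | empty => simp [l2]
  | insert a T ha ih =>
    rw [Finset.sum_insert ha, Finset.set_biUnion_insert]
    refine le_trans ?_ (add_le_add le_rfl ih)
    unfold l2
    refine (ENNReal.rpow_le_rpow (lintegral_union_le _ _ _) (by norm_num)).trans ?_
    exact ENNReal.rpow_add_le_add_rpow _ _ (by norm_num) (by norm_num)

/-- The norm `𝒟L²_r` with `r` a positive integer is controlled by `𝒟L²_1`. -/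
lemma exists_nDL_natCast_le (n N : ℕ) (hN : 0 < N) : ∃ C : ℝ≥0∞, C ≠ ∞ ∧
    ∀ h : Sp n → ℝ≥0∞, nDL (N : ℝ) h ≤ C * nDL 1 h := by
  obtain ⟨T, hT⟩ := (isCompact_closedBall (0 : Sp n) N).elim_finite_subcover
    (fun z : Sp n => Metric.ball z 1) (fun _ => Metric.isOpen_ball)
    (fun x _ => Set.mem_iUnion.2 ⟨x, Metric.mem_ball_self one_pos⟩)
  refine ⟨T.card, by simp, fun h => nDL_le fun x₀ θ => ?_⟩
  -- Translates by z ∈ T of unit balls cover the ball of radius N. The translate at the k-th centre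
  -- is the ball of index kN on the unit ray from x₀ + z, so each z sees a subfamily of one ray.
  calc ∑' k : ℕ, l2 (volume.restrict (dBall N x₀ θ k)) h
      ≤ ∑' k : ℕ, ∑ z ∈ T, l2 (volume.restrict (dBall 1 (x₀ + z) θ (k * N))) h := by
        refine ENNReal.tsum_le_tsum fun k => le_trans ?_ (l2_restrict_biUnion_le T _ h)
        unfold l2
        refine ENNReal.rpow_le_rpow (lintegral_mono_set fun x hx => ?_) (by norm_num)
        have hx' : x - (x₀ + ((k : ℝ) * N) • (θ : Sp n)) ∈ Metric.closedBall (0 : Sp n) N := by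
          rw [dBall, Metric.mem_ball, dist_eq_norm] at hx
          simpa using hx.le
        obtain ⟨z, hz, hxz⟩ := Set.mem_iUnion₂.1 (hT hx')
        refine Set.mem_iUnion₂.2 ⟨z, hz, ?_⟩
        rw [dBall, Metric.mem_ball, dist_eq_norm] at *
        convert hxz using 2
        push_cast
        rw [mul_one]
        abel
    _ = ∑ z ∈ T, ∑' k : ℕ, l2 (volume.restrict (dBall 1 (x₀ + z) θ (k * N))) h :=
        Summable.tsum_finsetSum fun _ _ => ENNReal.summable
    _ ≤ ∑ z ∈ T, nDL 1 h := by
        refine Finset.sum_le_sum fun z _ => le_trans ?_ (tsum_le_nDL 1 h (x₀ + z) θ)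
        exact ENNReal.tsum_comp_le_tsum_of_injective
          (f := fun k : ℕ => k * N) (fun a b hab => Nat.eq_of_mul_eq_mul_right hN hab)
          (fun k => l2 (volume.restrict (dBall 1 (x₀ + z) θ k)) h)
    _ = _ := by simp

end Bernstein

/-! ### Convolution of Schwartz functions with tempered functions. -/

section Schwartz

variable {n m : ℕ} {F : Type*} [NormedAddCommGroup F] [NormedSpace ℂ F]

lemma exists_enorm_schwartz_le {G : Type*} [NormedAddCommGroup G] [NormedSpace ℝ G]
    (f : 𝓢(Sp n, G)) (k : ℕ) :
    ∃ C : ℝ≥0∞, C ≠ ∞ ∧ ∀ x, ‖f x‖ₑ ≤ C * (wt x ^ k)⁻¹ := by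
  refine ⟨ENNReal.ofReal (2 ^ k * (Finset.Iic (k, 0)).sup
    (fun m => SchwartzMap.seminorm ℝ m.1 m.2) f), ENNReal.ofReal_ne_top, fun x => ?_⟩
  have h := SchwartzMap.one_add_le_sup_seminorm_apply (𝕜 := ℝ) (m := (k, 0)) le_rfl le_rfl f x
  rw [norm_iteratedFDeriv_zero] at h
  rw [← div_eq_mul_inv, ENNReal.le_div_iff_mul_le (Or.inl (pow_ne_zero _ (wt_ne_zero x)))
    (Or.inl (ENNReal.pow_ne_top (wt_ne_top x))), wt_eq_ofReal, ← ofReal_norm,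
    ← ENNReal.ofReal_pow (by positivity), ← ENNReal.ofReal_mul (norm_nonneg _), mul_comm]
  exact ENNReal.ofReal_le_ofReal h

/-- Tempered functions, with values in any space. -/
def Temp {F : Type*} [NormedAddCommGroup F] (u : Sp n → F) : Prop :=
  AEStronglyMeasurable u volume ∧ ∃ N : ℕ, ∫⁻ x, (wt x ^ N)⁻¹ * ‖u x‖ₑ < ∞

/-- Bounded measurable functions. -/
def BddMeas {F : Type*} [NormedAddCommGroup F] (u : Sp n → F) : Prop :=
  AEStronglyMeasurable u volume ∧ ∃ C : ℝ≥0∞, C ≠ ∞ ∧ ∀ x, ‖u x‖ₑ ≤ C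

lemma enorm_inv_one_add_pow (x : Sp n) (N : ℕ) :
    ‖(((1 + ‖x‖) ^ N)⁻¹ : ℝ)‖ₑ = (wt x ^ N)⁻¹ := by
  rw [wt_eq_ofReal, Real.enorm_eq_ofReal (by positivity), ENNReal.ofReal_inv_of_pos (by positivity),
    ENNReal.ofReal_pow (by positivity)]

lemma isTempered_iff (u : Sp n → Val m) : IsTempered u ↔ Temp u := by
  constructor
  · rintro ⟨N, hN⟩
    refine ⟨?_, N, ?_⟩
    · have h1 : Continuous fun x : Sp n => (1 + ‖x‖) ^ N := by fun_prop
      have := h1.aestronglyMeasurable (μ := volume) |>.smul hN.aestronglyMeasurable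
      refine this.congr (.of_forall fun x => ?_)
      simp only [Pi.smul_apply', smul_smul]
      rw [mul_inv_cancel₀ (by positivity), one_smul]
    · have := hN.hasFiniteIntegral
      rw [HasFiniteIntegral] at this
      simpa only [enorm_smul, enorm_inv_one_add_pow] using this
  · rintro ⟨hu, N, hN⟩
    refine ⟨N, ?_, ?_⟩
    · have h1 : Continuous fun x : Sp n => ((1 + ‖x‖) ^ N)⁻¹ :=
        Continuous.inv₀ (by fun_prop) (fun x => by positivity)
      exact h1.aestronglyMeasurable.smul hu
    · rw [HasFiniteIntegral]
      simpa only [enorm_smul, enorm_inv_one_add_pow] using hN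

lemma BddMeas.temp {F : Type*} [NormedAddCommGroup F] {u : Sp n → F} (hu : BddMeas u) : Temp u := by
  obtain ⟨hm, C, hC, hb⟩ := hu
  refine ⟨hm, n + 1, ?_⟩
  calc ∫⁻ x : Sp n, (wt x ^ (n + 1))⁻¹ * ‖u x‖ₑ ≤ ∫⁻ x : Sp n, (wt x ^ (n + 1))⁻¹ * C := by
        refine lintegral_mono fun x => ?_
        gcongr
        exact hb x
    _ = (∫⁻ x : Sp n, (wt x ^ (n + 1))⁻¹) * C :=
        lintegral_mul_const _ (measurable_wt.pow_const _).inv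
    _ < ∞ := ENNReal.mul_lt_top (lintegral_inv_wt_pow_lt_top volume (by simp)) hC.lt_top

/-- The convolution of a Schwartz function with `u`. -/
def cv (f : 𝓢(Sp n, ℂ)) (u : Sp n → F) (x : Sp n) : F := ∫ y, f (x - y) • u y

/-- Peetre's inequality: decay in x - y is decay in y, at the cost of growth in x. -/
lemma inv_wt_sub_le (x y : Sp n) (N : ℕ) :
    (wt (x - y) ^ N)⁻¹ ≤ wt x ^ N * (wt y ^ N)⁻¹ := by
  have h : wt y ≤ wt x * wt (x - y) := by
    calc wt y = wt (x + (y - x)) := by rw [add_sub_cancel]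
      _ ≤ wt x * wt (y - x) := wt_add_le _ _
      _ = _ := by rw [wt_sub_comm]
  rw [← div_eq_mul_inv, ENNReal.le_div_iff_mul_le (Or.inl (pow_ne_zero _ (wt_ne_zero y)))
    (Or.inl (ENNReal.pow_ne_top (wt_ne_top y)))]
  calc (wt (x - y) ^ N)⁻¹ * wt y ^ N ≤ (wt (x - y) ^ N)⁻¹ * (wt x * wt (x - y)) ^ N := by gcongr
    _ = wt x ^ N * ((wt (x - y) ^ N)⁻¹ * wt (x - y) ^ N) := by rw [mul_pow]; ring
    _ = _ := by
      rw [ENNReal.inv_mul_cancel (pow_ne_zero _ (wt_ne_zero _)) (ENNReal.pow_ne_top (wt_ne_top _)),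
        mul_one]

lemma wt_pow_le (x y : Sp n) (N : ℕ) : wt y ^ N ≤ wt x ^ N * wt (x - y) ^ N := by
  rw [← mul_pow]
  gcongr
  calc wt y = wt (x + (y - x)) := by rw [add_sub_cancel]
      _ ≤ wt x * wt (y - x) := wt_add_le _ _
      _ = _ := by rw [wt_sub_comm]

lemma continuous_sub_left (f : 𝓢(Sp n, ℂ)) (x : Sp n) : Continuous fun y => f (x - y) :=
  f.continuous.comp (by fun_prop)

lemma Temp.integrable {u : Sp n → F} (hu : Temp u) (f : 𝓢(Sp n, ℂ)) (x : Sp n) :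
    Integrable (fun y => f (x - y) • u y) := by
  obtain ⟨hm, N, hN⟩ := hu
  refine ⟨(continuous_sub_left f x).aestronglyMeasurable.smul hm, ?_⟩
  obtain ⟨C, hC, hf⟩ := exists_enorm_schwartz_le f N
  rw [HasFiniteIntegral]
  calc ∫⁻ y, ‖f (x - y) • u y‖ₑ ≤ ∫⁻ y, (C * wt x ^ N) * ((wt y ^ N)⁻¹ * ‖u y‖ₑ) := by
        refine lintegral_mono fun y => ?_
        rw [enorm_smul, ← mul_assoc, mul_assoc C]
        gcongr
        refine (hf _).trans ?_
        gcongr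
        exact inv_wt_sub_le x y N
    _ = (C * wt x ^ N) * ∫⁻ y, (wt y ^ N)⁻¹ * ‖u y‖ₑ :=
        lintegral_const_mul'' _ ((measurable_wt.pow_const _).inv.aemeasurable.mul hm.enorm)
    _ < ∞ := ENNReal.mul_lt_top (ENNReal.mul_lt_top hC.lt_top
        (ENNReal.pow_lt_top (wt_ne_top x).lt_top)) hN

lemma cv_congr_ae {f : 𝓢(Sp n, ℂ)} {u v : Sp n → F} (h : u =ᵐ[volume] v) : cv f u = cv f v := by
  ext x
  exact integral_congr_ae (h.mono fun y hy => by simp only [hy])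

/-- Replacing u by a strongly measurable representative changes no value of the convolution, so
measurability holds everywhere and not only up to null sets. -/
lemma stronglyMeasurable_cv (f : 𝓢(Sp n, ℂ)) {u : Sp n → F}
    (hu : AEStronglyMeasurable u volume) : StronglyMeasurable (cv f u) := by
  rw [cv_congr_ae hu.ae_eq_mk]
  have h : StronglyMeasurable (fun p : Sp n × Sp n => f (p.1 - p.2) • hu.mk u p.2) :=
    (f.continuous.comp (by fun_prop : Continuous fun p : Sp n × Sp n => p.1 - p.2)).stronglyMeasurable.smul
      (hu.stronglyMeasurable_mk.comp_measurable measurable_snd)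
  exact h.integral_prod_right

lemma cv_sum {ι : Type*} (s : Finset ι) (f : ι → 𝓢(Sp n, ℂ)) {u : Sp n → F} (hu : Temp u)
    (g : 𝓢(Sp n, ℂ)) (hg : ∀ x, g x = ∑ i ∈ s, f i x) (x : Sp n) :
    cv g u x = ∑ i ∈ s, cv (f i) u x := by
  unfold cv
  rw [← integral_finsetSum s fun i _ => hu.integrable (f i) x]
  refine integral_congr_ae (.of_forall fun y => ?_)
  simp only [hg, Finset.sum_smul]

/-- Scalar valued convolution of Schwartz functions. -/
def scv (f g : 𝓢(Sp n, ℂ)) : 𝓢(Sp n, ℂ) :=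
  SchwartzMap.convolution (ContinuousLinearMap.mul ℂ ℂ) f g

lemma scv_apply (f g : 𝓢(Sp n, ℂ)) (x : Sp n) : scv f g x = ∫ y, f y * g (x - y) := by
  rw [scv, SchwartzMap.convolution_apply]
  rfl

lemma fourier_scv (f g : 𝓢(Sp n, ℂ)) (ξ : Sp n) : 𝓕 (scv f g) ξ = 𝓕 f ξ * 𝓕 g ξ := by
  rw [scv, SchwartzMap.fourier_convolution]
  rfl

lemma schwartz_ext_fourier {f g : 𝓢(Sp n, ℂ)} (h : ∀ ξ, 𝓕 f ξ = 𝓕 g ξ) : f = g := by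
  have h2 : 𝓕 f = 𝓕 g := SchwartzMap.ext h
  have h3 := congrArg (fun k => 𝓕⁻ k) h2
  simpa using h3

variable [CompleteSpace F]

/-- Associativity of the convolution. -/
lemma cv_cv (f g : 𝓢(Sp n, ℂ)) {u : Sp n → F} (hu : Temp u) : cv f (cv g u) = cv (scv g f) u := by
  ext x
  obtain ⟨hm, N, hN⟩ := hu
  obtain ⟨C, hC, hg⟩ := exists_enorm_schwartz_le g N
  -- N powers of decay absorb the growth of the inner convolution; the other n + 1 make the outer
  -- integral converge, which justifies Fubini.
  obtain ⟨C', hC', hf⟩ := exists_enorm_schwartz_le f (n + 1 + N)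
  have hcf : Continuous fun p : Sp n × Sp n => f (x - p.1) := f.continuous.comp (by fun_prop)
  have hcg : Continuous fun p : Sp n × Sp n => g (p.1 - p.2) := g.continuous.comp (by fun_prop)
  have hmeas : AEStronglyMeasurable
      (fun p : Sp n × Sp n => f (x - p.1) • g (p.1 - p.2) • u p.2) (volume.prod volume) :=
    hcf.aestronglyMeasurable.smul (hcg.aestronglyMeasurable.smul hm.comp_snd)
  have hint : Integrable (Function.uncurry fun y z => f (x - y) • g (y - z) • u z)
      (volume.prod volume) := by
    refine ⟨hmeas, ?_⟩
    rw [HasFiniteIntegral, lintegral_prod _ (by exact hmeas.enorm)]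
    have hw : Measurable fun y : Sp n => (wt (y - x) ^ (n + 1))⁻¹ :=
      (measurable_wt.comp (measurable_id.sub_const x)).pow_const _ |>.inv
    calc ∫⁻ y, ∫⁻ z, ‖f (x - y) • g (y - z) • u z‖ₑ
        ≤ ∫⁻ y, ∫⁻ z, (‖f (x - y)‖ₑ * (C * wt y ^ N)) * ((wt z ^ N)⁻¹ * ‖u z‖ₑ) := by
          refine lintegral_mono fun y => lintegral_mono fun z => ?_
          rw [enorm_smul, enorm_smul, mul_assoc]
          refine mul_le_mul' le_rfl ?_
          calc ‖g (y - z)‖ₑ * ‖u z‖ₑ ≤ (C * (wt y ^ N * (wt z ^ N)⁻¹)) * ‖u z‖ₑ :=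
                mul_le_mul' ((hg _).trans (mul_le_mul' le_rfl (inv_wt_sub_le y z N))) le_rfl
            _ = _ := by ring
      _ = ∫⁻ y, (‖f (x - y)‖ₑ * (C * wt y ^ N)) * ∫⁻ z, (wt z ^ N)⁻¹ * ‖u z‖ₑ := by
          refine lintegral_congr fun y => ?_
          exact lintegral_const_mul'' _
            ((measurable_wt.pow_const _).inv.aemeasurable.mul hm.enorm)
      _ ≤ ∫⁻ y, (C' * C * wt x ^ N * ∫⁻ z, (wt z ^ N)⁻¹ * ‖u z‖ₑ) * (wt (y - x) ^ (n + 1))⁻¹ := by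
          refine lintegral_mono fun y => ?_
          have h1 : ‖f (x - y)‖ₑ * wt y ^ N ≤ C' * wt x ^ N * (wt (y - x) ^ (n + 1))⁻¹ := by
            calc ‖f (x - y)‖ₑ * wt y ^ N
                ≤ (C' * (wt (x - y) ^ (n + 1 + N))⁻¹) * (wt x ^ N * wt (x - y) ^ N) :=
                  mul_le_mul' (hf _) (wt_pow_le x y N)
              _ = C' * wt x ^ N * ((wt (x - y) ^ (n + 1 + N))⁻¹ * wt (x - y) ^ N) := by ring
              _ = _ := by rw [inv_wt_pow_mul_wt_pow, wt_sub_comm]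
          calc _ = (‖f (x - y)‖ₑ * wt y ^ N) * (C * ∫⁻ z, (wt z ^ N)⁻¹ * ‖u z‖ₑ) := by ring
            _ ≤ (C' * wt x ^ N * (wt (y - x) ^ (n + 1))⁻¹) *
                (C * ∫⁻ z, (wt z ^ N)⁻¹ * ‖u z‖ₑ) := by gcongr
            _ = _ := by ring
      _ = (C' * C * wt x ^ N * ∫⁻ z, (wt z ^ N)⁻¹ * ‖u z‖ₑ) * ∫⁻ y : Sp n, (wt y ^ (n + 1))⁻¹ := by
          rw [lintegral_const_mul _ hw,
            lintegral_sub_right_eq_self (fun y : Sp n => (wt y ^ (n + 1))⁻¹) x]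
      _ < ∞ := by
          refine ENNReal.mul_lt_top (ENNReal.mul_lt_top (ENNReal.mul_lt_top (ENNReal.mul_lt_top
            hC'.lt_top hC.lt_top) (ENNReal.pow_lt_top (wt_ne_top x).lt_top)) hN)
            (lintegral_inv_wt_pow_lt_top volume (by simp))
  calc cv f (cv g u) x = ∫ y, ∫ z, f (x - y) • g (y - z) • u z := by
        unfold cv
        refine integral_congr_ae (.of_forall fun y => ?_)
        simp only [integral_smul]
    _ = ∫ z, ∫ y, f (x - y) • g (y - z) • u z := integral_integral_swap hint
    _ = ∫ z, scv g f (x - z) • u z := by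
        refine integral_congr_ae (.of_forall fun z => ?_)
        simp only [smul_smul]
        rw [integral_smul_const, scv_apply,
          ← integral_sub_right_eq_self (fun y => g y * f (x - z - y)) z]
        congr 1
        refine integral_congr_ae (.of_forall fun y => ?_)
        simp only
        rw [mul_comm, sub_sub_sub_cancel_right]

end Schwartz

/-! ### Derivatives of convolutions. -/

section Derivative

variable {n : ℕ} {F : Type*} [NormedAddCommGroup F] [NormedSpace ℂ F]

/-- The derivative of `x ↦ f x • w`, given the derivative of `f`. -/
def smulFDeriv (w : F) (T : Sp n →L[ℝ] ℂ) : Sp n →L[ℝ] F :=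
  ((ContinuousLinearMap.lsmul ℝ ℂ : ℂ →L[ℝ] F →L[ℝ] F).flip w).comp T

lemma norm_smulFDeriv_le (w : F) (T : Sp n →L[ℝ] ℂ) : ‖smulFDeriv w T‖ ≤ ‖T‖ * ‖w‖ := by
  refine ContinuousLinearMap.opNorm_le_bound _ (by positivity) fun v => ?_
  change ‖T v • w‖ ≤ _
  rw [norm_smul]
  calc ‖T v‖ * ‖w‖ ≤ (‖T‖ * ‖v‖) * ‖w‖ := by gcongr; exact T.le_opNorm v
    _ = _ := by ring

/-- An integrable majorant valid for all x' in a unit ball, as required for differentiation under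
the integral sign. -/
lemma exists_norm_smulFDeriv_le (f : 𝓢(Sp n, ℂ)) {w : Sp n → F} (hw : BddMeas w) (x : Sp n) :
    ∃ bound : Sp n → ℝ, Integrable bound ∧ ∀ y, ∀ x' ∈ Metric.ball x 1,
      ‖smulFDeriv (w y) (fderiv ℝ f (x' - y))‖ ≤ bound y := by
  obtain ⟨hm, C, hC, hb⟩ := hw
  have hbr : ∀ y, ‖w y‖ ≤ C.toReal := fun y => by
    rw [← toReal_enorm]
    exact ENNReal.toReal_mono hC (hb y)
  let f' := SchwartzMap.fderivCLM ℝ (Sp n) ℂ f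
  have hf' : ∀ z, f' z = fderiv ℝ f z := fun z => rfl
  obtain ⟨K, hK⟩ : ∃ K : ℝ, ∀ z, (1 + ‖z‖) ^ (n + 1) * ‖f' z‖ ≤ K := by
    refine ⟨2 ^ (n + 1) * (Finset.Iic (n + 1, 0)).sup
      (fun m => SchwartzMap.seminorm ℝ m.1 m.2) f', fun z => ?_⟩
    have h := SchwartzMap.one_add_le_sup_seminorm_apply (𝕜 := ℝ) (m := (n + 1, 0)) le_rfl le_rfl
      f' z
    rw [norm_iteratedFDeriv_zero] at h
    exact h
  have hK0 : 0 ≤ K := le_trans (by positivity) (hK 0)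
  have hC0 : 0 ≤ C.toReal := ENNReal.toReal_nonneg
  refine ⟨fun y => K * C.toReal * 2 ^ (n + 1) * (1 + ‖x - y‖) ^ (-((n + 1 : ℕ) : ℝ)), ?_, ?_⟩
  · refine Integrable.const_mul ?_ _
    have h := integrable_one_add_norm (E := Sp n) (μ := volume) (r := ((n + 1 : ℕ) : ℝ)) (by simp)
    exact h.comp_sub_left x
  intro y x' hx'
  refine (norm_smulFDeriv_le _ _).trans ?_
  beta_reduce
  rw [← hf', Real.rpow_neg (by positivity), Real.rpow_natCast]
  rw [Metric.mem_ball, dist_eq_norm] at hx'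
  have h1 : 1 + ‖x - y‖ ≤ 2 * (1 + ‖x' - y‖) := by
    have : ‖x - y‖ ≤ ‖x' - y‖ + ‖x' - x‖ := by
      calc ‖x - y‖ = ‖(x' - y) - (x' - x)‖ := by congr 1; abel
        _ ≤ _ := norm_sub_le _ _
    linarith [norm_nonneg (x' - y)]
  have h2 : (1 + ‖x - y‖) ^ (n + 1) ≤ 2 ^ (n + 1) * (1 + ‖x' - y‖) ^ (n + 1) := by
    rw [← mul_pow]
    exact pow_le_pow_left₀ (by positivity) h1 _
  have h3 : ‖f' (x' - y)‖ ≤ K * 2 ^ (n + 1) * ((1 + ‖x - y‖) ^ (n + 1))⁻¹ := by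
    rw [← div_eq_mul_inv, le_div_iff₀ (by positivity)]
    calc ‖f' (x' - y)‖ * (1 + ‖x - y‖) ^ (n + 1)
        ≤ ‖f' (x' - y)‖ * (2 ^ (n + 1) * (1 + ‖x' - y‖) ^ (n + 1)) := by gcongr
      _ = ((1 + ‖x' - y‖) ^ (n + 1) * ‖f' (x' - y)‖) * 2 ^ (n + 1) := by ring
      _ ≤ K * 2 ^ (n + 1) := by gcongr; exact hK _
  calc _ ≤ (K * 2 ^ (n + 1) * ((1 + ‖x - y‖) ^ (n + 1))⁻¹) * C.toReal := by
        gcongr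
        exact hbr y
    _ = _ := by ring

lemma aestronglyMeasurable_smulFDeriv (f : 𝓢(Sp n, ℂ)) {w : Sp n → F} (hw : BddMeas w)
    (x : Sp n) :
    AEStronglyMeasurable (fun y => smulFDeriv (w y) (fderiv ℝ f (x - y))) volume := by
  have h1 : Continuous fun y => SchwartzMap.fderivCLM ℝ (Sp n) ℂ f (x - y) :=
    (SchwartzMap.fderivCLM ℝ (Sp n) ℂ f).continuous.comp (by fun_prop)
  exact ((ContinuousLinearMap.compL ℝ (Sp n) ℂ F).comp
    (ContinuousLinearMap.lsmul ℝ ℂ : ℂ →L[ℝ] F →L[ℝ] F).flip).aestronglyMeasurable_comp₂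
      hw.1 h1.aestronglyMeasurable

lemma integrable_smulFDeriv (f : 𝓢(Sp n, ℂ)) {w : Sp n → F} (hw : BddMeas w) (x : Sp n) :
    Integrable (fun y => smulFDeriv (w y) (fderiv ℝ f (x - y))) := by
  obtain ⟨b, hb, hle⟩ := exists_norm_smulFDeriv_le f hw x
  exact hb.mono' (aestronglyMeasurable_smulFDeriv f hw x)
    (.of_forall fun y => hle y x (Metric.mem_ball_self one_pos))

lemma hasFDerivAt_cv (f : 𝓢(Sp n, ℂ)) {w : Sp n → F} (hw : BddMeas w) (x : Sp n) :
    HasFDerivAt (cv f w) (∫ y, smulFDeriv (w y) (fderiv ℝ f (x - y))) x := by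
  obtain ⟨b, hb, hle⟩ := exists_norm_smulFDeriv_le f hw x
  refine hasFDerivAt_integral_of_dominated_of_fderiv_le (𝕜 := ℝ) (μ := volume)
    (F := fun x y => f (x - y) • w y) (F' := fun x y => smulFDeriv (w y) (fderiv ℝ f (x - y)))
    (bound := b) (Metric.ball_mem_nhds x one_pos)
    (.of_forall fun x' => (continuous_sub_left f x').aestronglyMeasurable.smul hw.1)
    (hw.temp.integrable f x) (aestronglyMeasurable_smulFDeriv f hw x) (.of_forall hle) hb
    (.of_forall fun y x' _ => ?_)
  have h1 : HasFDerivAt (fun x' => f (x' - y)) (fderiv ℝ f (x' - y)) x' := by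
    rw [hasFDerivAt_comp_sub]
    exact f.hasFDerivAt _
  exact ((ContinuousLinearMap.lsmul ℝ ℂ : ℂ →L[ℝ] F →L[ℝ] F).flip (w y)).hasFDerivAt.comp x' h1

lemma differentiable_cv (f : 𝓢(Sp n, ℂ)) {w : Sp n → F} (hw : BddMeas w) :
    Differentiable ℝ (cv f w) := fun x => (hasFDerivAt_cv f hw x).differentiableAt

lemma fderiv_cv_apply (f : 𝓢(Sp n, ℂ)) {w : Sp n → F} (hw : BddMeas w) (x v : Sp n) :
    fderiv ℝ (cv f w) x v = cv (∂_{v} f) w x := by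
  rw [(hasFDerivAt_cv f hw x).fderiv]
  rw [ContinuousLinearMap.integral_apply (integrable_smulFDeriv f hw x)]
  rfl

/-- A directional derivative falls on the kernel and yields another convolution of the same kind, so
induction applies. -/
lemma contDiff_cv (f : 𝓢(Sp n, ℂ)) {w : Sp n → F} (hw : BddMeas w) (k : ℕ) :
    ContDiff ℝ k (cv f w) := by
  induction k generalizing f with
  | zero =>
    simpa using (differentiable_cv f hw).continuous
  | succ k ih =>
    push_cast
    rw [contDiff_succ_iff_fderiv_apply]
    refine ⟨differentiable_cv f hw, by simp, fun v => ?_⟩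
    simp_rw [fderiv_cv_apply f hw]
    exact ih _

lemma laplacian_cv (f : 𝓢(Sp n, ℂ)) {w : Sp n → F} (hw : BddMeas w) (x : Sp n) :
    Δ (cv f w) x = ∑ i : Fin n,
      cv (∂_{EuclideanSpace.single i (1 : ℝ)} (∂_{EuclideanSpace.single i (1 : ℝ)} f)) w x := by
  rw [InnerProductSpace.laplacian_eq_iteratedFDeriv_orthonormalBasis _
    (EuclideanSpace.basisFun (Fin n) ℝ)]
  refine Finset.sum_congr rfl fun i _ => ?_
  have hd : Differentiable ℝ (fderiv ℝ (cv f w)) :=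
    ((contDiff_cv f hw 2).fderiv_right (m := 1) (by norm_num)).differentiable (by norm_num)
  rw [iteratedFDeriv_two_apply]
  simp only [Matrix.cons_val_zero, Matrix.cons_val_one, EuclideanSpace.basisFun_apply]
  set e := EuclideanSpace.single i (1 : ℝ)
  have h1 : fderiv ℝ (fun y => fderiv ℝ (cv f w) y e) x = (fderiv ℝ (fderiv ℝ (cv f w)) x).flip e := by
    rw [fderiv_clm_apply (hd x) (differentiableAt_const _)]
    ext v
    simp
  have h2 : (fun y => fderiv ℝ (cv f w) y e) = cv (∂_{e} f) w :=
    funext fun y => fderiv_cv_apply f hw y e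
  rw [h2] at h1
  rw [← fderiv_cv_apply _ hw, h1]
  rfl

end Derivative

/-! ### Fourier supports of products and vanishing convolutions. -/

section FourierSupport

variable {n : ℕ}

/-- The Fourier transform of `f` is supported in the closed ball of radius `r`. -/
def FourierSuppBall (r : ℝ) (f : 𝓢(Sp n, ℂ)) : Prop := ∀ ξ, r < ‖ξ‖ → 𝓕 f ξ = 0

/-- The product of Schwartz functions. -/
def smulS (f g : 𝓢(Sp n, ℂ)) : 𝓢(Sp n, ℂ) :=
  SchwartzMap.pairing (ContinuousLinearMap.mul ℂ ℂ) f g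

lemma smulS_apply (f g : 𝓢(Sp n, ℂ)) (x : Sp n) : smulS f g x = f x * g x := rfl

/-- The translation of a Schwartz function. -/
def transS (y : Sp n) (f : 𝓢(Sp n, ℂ)) : 𝓢(Sp n, ℂ) := SchwartzMap.compSubConstCLM ℂ y f

lemma transS_apply (y : Sp n) (f : 𝓢(Sp n, ℂ)) (x : Sp n) : transS y f x = f (x - y) := rfl

/-- The complex conjugate of a Schwartz function. -/
def conjS (f : 𝓢(Sp n, ℂ)) : 𝓢(Sp n, ℂ) :=
  SchwartzMap.postcompCLM (𝕜 := ℝ) (Complex.conjCLE : ℂ →L[ℝ] ℂ) f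

lemma conjS_apply (f : 𝓢(Sp n, ℂ)) (x : Sp n) : conjS f x = starRingEnd ℂ (f x) := rfl

lemma fourierInv_schwartz_apply (f : 𝓢(Sp n, ℂ)) (ξ : Sp n) : 𝓕⁻ f ξ = 𝓕 f (-ξ) := by
  rw [SchwartzMap.fourierInv_coe, SchwartzMap.fourier_coe, Real.fourierInv_eq_fourier_neg]

/-- The transform of a product is the convolution of the transforms, and two frequencies that add up
to norm more than r₁ + r₂ cannot both lie in the supports. -/
lemma FourierSuppBall.mul {r₁ r₂ : ℝ} {f g : 𝓢(Sp n, ℂ)} (hf : FourierSuppBall r₁ f)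
    (hg : FourierSuppBall r₂ g) : FourierSuppBall (r₁ + r₂) (smulS f g) := by
  intro ξ hξ
  have h : smulS f g = 𝓕 (scv (𝓕⁻ f) (𝓕⁻ g)) := by
    rw [scv, SchwartzMap.fourier_convolution]
    simp [smulS]
  have h2 : 𝓕 (smulS f g) ξ = scv (𝓕⁻ f) (𝓕⁻ g) (-ξ) := by
    have : 𝓕⁻ (smulS f g) (-ξ) = 𝓕 (smulS f g) ξ := by
      rw [fourierInv_schwartz_apply, neg_neg]
    rw [← this, h]
    simp
  rw [h2, scv_apply]
  refine integral_eq_zero_of_ae (.of_forall fun y => ?_)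
  simp only [Pi.zero_apply, fourierInv_schwartz_apply]
  by_cases hy : r₁ < ‖y‖
  · rw [hf (-y) (by rwa [norm_neg]), zero_mul]
  · rw [hg _ ?_, mul_zero]
    have h3 : ‖ξ‖ ≤ ‖-(-ξ - y)‖ + ‖y‖ := by
      calc ‖ξ‖ = ‖-(-ξ - y) - y‖ := by congr 1; abel
        _ ≤ _ := norm_sub_le _ _
    linarith

lemma FourierSuppBall.trans {r : ℝ} {f : 𝓢(Sp n, ℂ)} (hf : FourierSuppBall r f) (y : Sp n) :
    FourierSuppBall r (transS y f) := by
  intro ξ hξ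
  have h0 := hf ξ hξ
  rw [SchwartzMap.fourier_coe, Real.fourier_eq] at h0 ⊢
  rw [← integral_add_right_eq_self _ y]
  have : ∀ v, Real.fourierChar (-inner ℝ (v + y) ξ) • transS y f (v + y)
      = Real.fourierChar (-inner ℝ y ξ) • (Real.fourierChar (-inner ℝ v ξ) • f v) := by
    intro v
    rw [transS_apply, add_sub_cancel_right, smul_smul, ← AddChar.map_add_eq_mul, inner_add_left,
      neg_add, add_comm]
  simp_rw [this, Circle.smul_def] at h0 ⊢
  rw [integral_smul, h0, smul_zero]

lemma FourierSuppBall.conj {r : ℝ} {f : 𝓢(Sp n, ℂ)} (hf : FourierSuppBall r f) :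
    FourierSuppBall r (conjS f) := by
  intro ξ hξ
  have h0 := hf (-ξ) (by rwa [norm_neg])
  rw [SchwartzMap.fourier_coe, Real.fourier_eq'] at h0 ⊢
  have : ∀ v, Complex.exp (↑(-2 * Real.pi * inner ℝ v ξ) * Complex.I) • conjS f v
      = starRingEnd ℂ (Complex.exp (↑(-2 * Real.pi * inner ℝ v (-ξ)) * Complex.I) • f v) := by
    intro v
    rw [conjS_apply, smul_eq_mul, smul_eq_mul, map_mul, ← Complex.exp_conj]
    congr 2
    simp only [inner_neg_right, map_mul, Complex.conj_ofReal, Complex.conj_I]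
    push_cast
    ring
  simp_rw [this]
  rw [integral_conj, h0, map_zero]

lemma FourierSuppBall.lineDeriv {r : ℝ} {f : 𝓢(Sp n, ℂ)} (hf : FourierSuppBall r f) (v : Sp n) :
    FourierSuppBall r (∂_{v} f) := by
  intro ξ hξ
  have : (inner ℝ · v : Sp n → ℝ).HasTemperateGrowth := by fun_prop
  rw [SchwartzMap.fourier_lineDerivOp_eq]
  simp [SchwartzMap.smulLeftCLM_apply_apply this, hf ξ hξ]

/-- At each frequency one of the two transforms vanishes. -/
lemma scv_eq_zero {r : ℝ} {k q : 𝓢(Sp n, ℂ)} (hk : ∀ ξ, ‖ξ‖ ≤ r → 𝓕 k ξ = 0)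
    (hq : FourierSuppBall r q) : scv q k = 0 := by
  apply schwartz_ext_fourier
  intro ξ
  rw [fourier_scv]
  have h0 : 𝓕 (0 : 𝓢(Sp n, ℂ)) = 0 := by simp
  rw [h0]
  by_cases hξ : ‖ξ‖ ≤ r
  · rw [hk ξ hξ, mul_zero]; rfl
  · rw [hq ξ (not_le.1 hξ), zero_mul]; rfl

lemma integral_mul_eq_zero {r : ℝ} {k q : 𝓢(Sp n, ℂ)} (hk : ∀ ξ, ‖ξ‖ ≤ r → 𝓕 k ξ = 0)
    (hq : FourierSuppBall r q) (x : Sp n) : ∫ y, k (x - y) * q y = 0 := by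
  have h := scv_eq_zero hk hq
  have := scv_apply q k x
  rw [h] at this
  simp_rw [mul_comm (k _)]
  rw [← this]
  rfl

/-- Fubini's theorem for the pairing of `Θ` with a convolution. -/
lemma integral_mul_cv {Θ : Sp n → ℂ} (hΘ : Integrable Θ) (f : 𝓢(Sp n, ℂ)) {a : Sp n → ℂ}
    (ha : BddMeas a) :
    ∫ x, Θ x * cv f a x = ∫ y, a y * ∫ x, Θ x * f (x - y) := by
  obtain ⟨hm, C, hC, hb⟩ := ha
  have hcf : Continuous fun p : Sp n × Sp n => f (p.1 - p.2) := f.continuous.comp (by fun_prop)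
  have hmeas : AEStronglyMeasurable (fun p : Sp n × Sp n => Θ p.1 * (f (p.1 - p.2) * a p.2))
      (volume.prod volume) :=
    hΘ.aestronglyMeasurable.comp_fst.mul (hcf.aestronglyMeasurable.mul hm.comp_snd)
  have hfe : Measurable fun y => ‖f y‖ₑ := f.continuous.measurable.enorm
  have hint : Integrable (Function.uncurry fun x y => Θ x * (f (x - y) * a y))
      (volume.prod volume) := by
    refine ⟨hmeas, ?_⟩
    rw [HasFiniteIntegral, lintegral_prod _ (by exact hmeas.enorm)]
    calc ∫⁻ x, ∫⁻ y, ‖Θ x * (f (x - y) * a y)‖ₑ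
        ≤ ∫⁻ x, ‖Θ x‖ₑ * (∫⁻ y, ‖f y‖ₑ) * C := by
          refine lintegral_mono fun x => ?_
          have hfx : Measurable fun y => ‖f (x - y)‖ₑ := hfe.comp (measurable_id.const_sub x)
          rw [← lintegral_sub_left_eq_self (fun y => ‖f y‖ₑ) x, mul_assoc,
            ← lintegral_mul_const _ hfx, ← lintegral_const_mul _ (hfx.mul_const C)]
          refine lintegral_mono fun y => ?_
          rw [enorm_mul, enorm_mul]
          exact mul_le_mul' le_rfl (mul_le_mul' le_rfl (hb y))
      _ = (∫⁻ x, ‖Θ x‖ₑ) * ((∫⁻ y, ‖f y‖ₑ) * C) := by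
          simp_rw [mul_assoc]
          exact lintegral_mul_const'' _ hΘ.aestronglyMeasurable.enorm
      _ < ∞ := ENNReal.mul_lt_top hΘ.hasFiniteIntegral
          (ENNReal.mul_lt_top f.integrable.hasFiniteIntegral hC.lt_top)
  calc ∫ x, Θ x * cv f a x = ∫ x, ∫ y, Θ x * (f (x - y) * a y) := by
        refine integral_congr_ae (.of_forall fun x => ?_)
        simp only [cv, smul_eq_mul]
        rw [integral_const_mul]
    _ = ∫ y, ∫ x, Θ x * (f (x - y) * a y) := integral_integral_swap hint
    _ = _ := by
        refine integral_congr_ae (.of_forall fun y => ?_)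
        simp only
        rw [← integral_const_mul]
        refine integral_congr_ae (.of_forall fun x => ?_)
        simp only
        ring

lemma enorm_cv_le {F : Type*} [NormedAddCommGroup F] [NormedSpace ℂ F] (f : 𝓢(Sp n, ℂ))
    (u : Sp n → F) (x : Sp n) : ‖cv f u x‖ₑ ≤ ∫⁻ y, ‖f (x - y)‖ₑ * ‖u y‖ₑ := by
  refine (enorm_integral_le_lintegral_enorm _).trans (le_of_eq ?_)
  simp_rw [enorm_smul]

lemma BddMeas.cv {F : Type*} [NormedAddCommGroup F] [NormedSpace ℂ F] (f : 𝓢(Sp n, ℂ))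
    {u : Sp n → F} (hu : BddMeas u) : BddMeas (cv f u) := by
  refine ⟨(stronglyMeasurable_cv f hu.1).aestronglyMeasurable, ?_⟩
  obtain ⟨-, C, hC, hb⟩ := hu
  refine ⟨(∫⁻ y, ‖f y‖ₑ) * C, ENNReal.mul_ne_top f.integrable.hasFiniteIntegral.ne hC,
    fun x => (enorm_cv_le f u x).trans ?_⟩
  have hfe : Measurable fun y => ‖f (x - y)‖ₑ := (continuous_sub_left f x).measurable.enorm
  rw [← lintegral_sub_left_eq_self (fun y => ‖f y‖ₑ) x, ← lintegral_mul_const _ hfe]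
  exact lintegral_mono fun y => mul_le_mul' le_rfl (hb y)

lemma cv_cv_eq_zero {F : Type*} [NormedAddCommGroup F] [NormedSpace ℂ F] [CompleteSpace F] {r : ℝ}
    {k f : 𝓢(Sp n, ℂ)} (hk : ∀ ξ, ‖ξ‖ ≤ r → 𝓕 k ξ = 0) (hf : FourierSuppBall r f)
    {a : Sp n → F} (ha : Temp a) : cv k (cv f a) = 0 := by
  rw [cv_cv _ _ ha, scv_eq_zero hk hf]
  ext1 x
  simp [DNLS.cv]

/-- The factors are merely bounded, so their Fourier transforms are not functions. Two applications
of Fubini move the integrals against a and b outside; inside remains k tested against a product of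
translates of f and g, which vanishes by the support of Schwartz products. -/
lemma cv_mul_eq_zero {r₁ r₂ : ℝ} {k f g : 𝓢(Sp n, ℂ)} (hk : ∀ ξ, ‖ξ‖ ≤ r₁ + r₂ → 𝓕 k ξ = 0)
    (hf : FourierSuppBall r₁ f) (hg : FourierSuppBall r₂ g) {a b : Sp n → ℂ} (ha : BddMeas a)
    (hb : BddMeas b) (x : Sp n) :
    ∫ y, k (x - y) * (cv f a y * cv g b y) = 0 := by
  have h1 : Integrable fun y => k (x - y) := k.integrable.comp_sub_left x
  obtain ⟨hgm, C, hC, hgb⟩ := hb.cv g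
  have h2 : Integrable fun y => k (x - y) * cv g b y := by
    refine h1.mul_bdd (c := C.toReal) hgm (.of_forall fun y => ?_)
    rw [← toReal_enorm]
    exact ENNReal.toReal_mono hC (hgb y)
  have h3 : ∀ y, k (x - y) * (cv f a y * cv g b y) = (k (x - y) * cv g b y) * cv f a y :=
    fun y => by ring
  simp_rw [h3]
  rw [integral_mul_cv h2 f ha]
  refine integral_eq_zero_of_ae (.of_forall fun y => ?_)
  simp only [Pi.zero_apply, mul_eq_zero]
  right
  have h4 : ∀ z, k (x - z) * cv g b z * f (z - y) = (k (x - z) * f (z - y)) * cv g b z :=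
    fun z => by ring
  simp_rw [h4]
  have h5 : Integrable fun z => k (x - z) * f (z - y) := by
    refine h1.mul_bdd (c := (SchwartzMap.seminorm ℝ 0 0) f)
      (f.continuous.comp (continuous_sub_right y)).aestronglyMeasurable (.of_forall fun z => ?_)
    exact SchwartzMap.norm_le_seminorm ℝ f _
  rw [integral_mul_cv h5 g hb]
  refine integral_eq_zero_of_ae (.of_forall fun z => ?_)
  have := integral_mul_eq_zero hk ((hf.trans y).mul (hg.trans z)) x
  simp only [smulS_apply, transS_apply, ← mul_assoc] at this
  simp [this]

end FourierSupport

/-! ### Fourier multipliers as convolutions with Schwartz kernels. -/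

section Symbols

variable {n m : ℕ}

/-- Smooth compactly supported symbols. -/
structure IsSymbol (p : Sp n → ℝ) : Prop where
  smooth : ContDiff ℝ ((⊤ : ℕ∞) : WithTop ℕ∞) p
  compact : HasCompactSupport p

lemma IsSymbol.mul {p q : Sp n → ℝ} (hp : IsSymbol p) (hq : IsSymbol q) :
    IsSymbol (fun ξ => p ξ * q ξ) :=
  ⟨hp.smooth.mul hq.smooth, hp.compact.mul_right⟩

lemma IsSymbol.sub {p q : Sp n → ℝ} (hp : IsSymbol p) (hq : IsSymbol q) :
    IsSymbol (fun ξ => p ξ - q ξ) :=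
  ⟨hp.smooth.sub hq.smooth, hp.compact.sub hq.compact⟩

lemma IsSymbol.comp_smul {p : Sp n → ℝ} (hp : IsSymbol p) {a : ℝ} (ha : a ≠ 0) :
    IsSymbol (fun ξ => p (a • ξ)) :=
  ⟨hp.smooth.comp (contDiff_const_smul a), hp.compact.comp_smul ha⟩

lemma LPCutoff.isSymbol (φ : LPCutoff n) : IsSymbol φ.toFun :=
  ⟨φ.smooth, HasCompactSupport.intro (isCompact_closedBall (0 : Sp n) 2) fun x hx =>
    φ.eq_zero x (by simpa using (not_le.1 (by simpa using hx) : 2 < ‖x‖).le)⟩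

lemma LPCutoff.isSymbol_symbol (φ : LPCutoff n) (j : ℕ) : IsSymbol (φ.symbol j) := by
  cases j with
  | zero => exact φ.isSymbol
  | succ j => exact (φ.isSymbol.comp_smul (by positivity)).sub (φ.isSymbol.comp_smul (by positivity))

lemma IsSymbol.hasCompactSupport_complex {p : Sp n → ℝ} (hp : IsSymbol p) :
    HasCompactSupport (fun η : Sp n => ((p ((2 * Real.pi) • η) : ℝ) : ℂ)) :=
  (hp.comp_smul (a := 2 * Real.pi) (by positivity)).compact.comp_left
    (g := fun r : ℝ => (r : ℂ)) Complex.ofReal_zero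

lemma IsSymbol.contDiff_complex {p : Sp n → ℝ} (hp : IsSymbol p) :
    ContDiff ℝ ((⊤ : ℕ∞) : WithTop ℕ∞) (fun η : Sp n => ((p ((2 * Real.pi) • η) : ℝ) : ℂ)) :=
  Complex.ofRealCLM.contDiff.comp
    (hp.comp_smul (a := 2 * Real.pi) (by positivity)).smooth

/-- The kernel of a Fourier multiplier, as a Schwartz function. -/
def IsSymbol.ker {p : Sp n → ℝ} (hp : IsSymbol p) : 𝓢(Sp n, ℂ) :=
  𝓕⁻ (hp.hasCompactSupport_complex.toSchwartzMap hp.contDiff_complex)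

lemma IsSymbol.ker_apply {p : Sp n → ℝ} (hp : IsSymbol p) (x : Sp n) : hp.ker x = kernel p x := by
  rw [IsSymbol.ker, SchwartzMap.fourierInv_coe]
  rfl

lemma IsSymbol.fourier_ker {p : Sp n → ℝ} (hp : IsSymbol p) (ξ : Sp n) :
    𝓕 hp.ker ξ = ((p ((2 * Real.pi) • ξ) : ℝ) : ℂ) := by
  rw [IsSymbol.ker]
  simp

lemma IsSymbol.multiplier_eq {p : Sp n → ℝ} (hp : IsSymbol p) (u : Sp n → Val m) :
    multiplier p u = cv hp.ker u := by
  ext1 x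
  simp only [multiplier, cv, hp.ker_apply]

lemma IsSymbol.scv_ker {p q : Sp n → ℝ} (hp : IsSymbol p) (hq : IsSymbol q) :
    scv hp.ker hq.ker = (hp.mul hq).ker := by
  apply schwartz_ext_fourier
  intro ξ
  rw [fourier_scv, IsSymbol.fourier_ker, IsSymbol.fourier_ker, IsSymbol.fourier_ker]
  push_cast
  rfl

lemma multiplier_multiplier {p q : Sp n → ℝ} (hp : IsSymbol p) (hq : IsSymbol q)
    {u : Sp n → Val m} (hu : Temp u) :
    multiplier p (multiplier q u) = multiplier (fun ξ => q ξ * p ξ) u := by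
  rw [hp.multiplier_eq, hq.multiplier_eq, (hq.mul hp).multiplier_eq, cv_cv _ _ hu, hq.scv_ker hp]

/-- The factor 2π converts between frequencies of the phase e^{ix·ξ} and those of the phase
e^{2πix·η}. -/
lemma IsSymbol.fourierSuppBall {p : Sp n → ℝ} (hp : IsSymbol p) {r : ℝ}
    (h : ∀ ξ, r < ‖ξ‖ → p ξ = 0) : FourierSuppBall (r / (2 * Real.pi)) hp.ker := by
  intro ξ hξ
  rw [hp.fourier_ker, h, Complex.ofReal_zero]
  rw [div_lt_iff₀ (by positivity)] at hξ
  rw [norm_smul, Real.norm_eq_abs, abs_of_pos (by positivity), mul_comm]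
  exact hξ

lemma IsSymbol.fourier_ker_eq_zero {p : Sp n → ℝ} (hp : IsSymbol p) {r : ℝ}
    (h : ∀ ξ, ‖ξ‖ ≤ r → p ξ = 0) (ξ : Sp n) (hξ : ‖ξ‖ ≤ r / (2 * Real.pi)) :
    𝓕 hp.ker ξ = 0 := by
  rw [hp.fourier_ker, h, Complex.ofReal_zero]
  rw [le_div_iff₀ (by positivity)] at hξ
  rw [norm_smul, Real.norm_eq_abs, abs_of_pos (by positivity), mul_comm]
  exact hξ

lemma kernel_comp_smul (p : Sp n → ℝ) {ρ : ℝ} (hρ : 0 < ρ) (x : Sp n) :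
    kernel (fun ξ => p (ρ⁻¹ • ξ)) x = (ρ ^ n : ℝ) • kernel p (ρ • x) := by
  unfold kernel
  rw [Real.fourierInv_eq, Real.fourierInv_eq]
  have h := Measure.integral_comp_inv_smul volume
    (fun v : Sp n => Real.fourierChar (inner ℝ v (ρ • x)) • ((p ((2 * Real.pi) • v) : ℝ) : ℂ)) ρ
  rw [finrank_euclideanSpace_fin, abs_of_pos (by positivity)] at h
  rw [← h]
  refine integral_congr_ae (.of_forall fun v => ?_)
  simp only
  rw [inner_smul_left, inner_smul_right, smul_comm ρ⁻¹]
  simp only [map_inv₀, conj_trivial]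
  rw [inv_mul_cancel_left₀ hρ.ne']

/-- The dilation `ρⁿ f(ρ x)`. -/
def dil (ρ : ℝ) (hρ : ρ ≠ 0) (f : 𝓢(Sp n, ℂ)) : 𝓢(Sp n, ℂ) :=
  (ρ ^ n : ℝ) • SchwartzMap.compCLMOfContinuousLinearEquiv ℝ
    (ContinuousLinearEquiv.smulLeft (Units.mk0 ρ hρ) : Sp n ≃L[ℝ] Sp n) f

lemma dil_apply (ρ : ℝ) (hρ : ρ ≠ 0) (f : 𝓢(Sp n, ℂ)) (x : Sp n) :
    dil ρ hρ f x = (ρ ^ n : ℝ) • f (ρ • x) := rfl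

lemma lineDeriv_dil (ρ : ℝ) (hρ : ρ ≠ 0) (f : 𝓢(Sp n, ℂ)) (v : Sp n) :
    ∂_{v} (dil ρ hρ f) = ρ • dil ρ hρ (∂_{v} f) := by
  unfold dil
  rw [LineDeriv.lineDerivOp_smul, SchwartzMap.lineDerivOp_compCLMOfContinuousLinearEquiv]
  have : (ContinuousLinearEquiv.smulLeft (Units.mk0 ρ hρ) : Sp n ≃L[ℝ] Sp n) v = ρ • v := rfl
  rw [this, LineDeriv.lineDerivOp_left_smul, map_smul, smul_comm]

lemma IsSymbol.ker_comp_smul {p : Sp n → ℝ} (hp : IsSymbol p) {ρ : ℝ} (hρ : 0 < ρ) :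
    (hp.comp_smul (a := ρ⁻¹) (by positivity)).ker = dil ρ hρ.ne' hp.ker := by
  ext x
  rw [IsSymbol.ker_apply, kernel_comp_smul p hρ, dil_apply, IsSymbol.ker_apply]

end Symbols

/-! ### Scaling of multipliers and of the 𝒟L² norms. -/

section Rescale

variable {n m : ℕ}

/-- Rescaling moves frequency λ to frequency ελ. -/
lemma rescale_multiplier (p : Sp n → ℝ) {ε : ℝ} (hε : 0 < ε) (u : Sp n → Val m) :
    rescale ε (multiplier p u) = multiplier (fun ξ => p (ε⁻¹ • ξ)) (rescale ε u) := by
  ext1 x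
  unfold rescale multiplier
  have h := Measure.integral_comp_smul volume (fun y => kernel p (ε • x - y) • u y) ε
  rw [finrank_euclideanSpace_fin, abs_of_pos (by positivity)] at h
  have h2 : ∀ y, kernel (fun ξ => p (ε⁻¹ • ξ)) (x - y) • ε • u (ε • y)
      = (ε * ε ^ n) • (kernel p (ε • x - ε • y) • u (ε • y)) := by
    intro y
    rw [kernel_comp_smul p hε, smul_sub, mul_comm ε, mul_smul, smul_comm ε, smul_assoc]
  simp_rw [h2]
  rw [integral_smul, h, smul_smul, mul_assoc, mul_inv_cancel₀ (by positivity), mul_one]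

lemma Temp.rescale {u : Sp n → Val m} (hu : Temp u) {ε : ℝ} (hε : 0 < ε) (hε1 : ε ≤ 1) :
    Temp (rescale ε u) := by
  rw [← isTempered_iff] at hu ⊢
  obtain ⟨N, hN⟩ := hu
  have h := hN.comp_smul hε.ne'
  have hm : AEStronglyMeasurable (fun x => u (ε • x)) volume := by
    have h1 : Continuous fun x : Sp n => (1 + ‖ε • x‖) ^ N := by fun_prop
    have := h1.aestronglyMeasurable (μ := volume) |>.smul h.aestronglyMeasurable
    refine this.congr (.of_forall fun x => ?_)
    simp only [Pi.smul_apply', smul_smul]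
    rw [mul_inv_cancel₀ (by positivity), one_smul]
  refine ⟨N, ?_⟩
  have hI : Integrable (fun x => ((1 + ‖x‖) ^ N)⁻¹ • u (ε • x)) := by
    refine h.mono ?_ (.of_forall fun x => ?_)
    · have h1 : Continuous fun x : Sp n => ((1 + ‖x‖) ^ N)⁻¹ :=
        Continuous.inv₀ (by fun_prop) (fun x => by positivity)
      exact h1.aestronglyMeasurable.smul hm
    · rw [norm_smul, norm_smul, norm_inv, norm_inv, Real.norm_of_nonneg (by positivity),
        Real.norm_of_nonneg (by positivity)]
      gcongr
      rw [norm_smul, Real.norm_of_nonneg hε.le]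
      nlinarith [norm_nonneg x]
  refine (hI.smul ε).congr (.of_forall fun x => ?_)
  simp only [DNLS.rescale, Pi.smul_apply]
  rw [smul_comm]

lemma l2_ball_comp_smul {ε r : ℝ} (hε : 0 < ε) (c : Sp n) {h : Sp n → ℝ≥0∞} (hh : Measurable h) :
    ENNReal.ofReal (ε ^ ((n : ℝ) / 2)) *
      l2 (volume.restrict (Metric.ball c (r / ε))) (fun x => h (ε • x))
      = l2 (volume.restrict (Metric.ball (ε • c) r)) h := by
  have hb : ∀ x, x ∈ Metric.ball c (r / ε) ↔ ε • x ∈ Metric.ball (ε • c) r := by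
    intro x
    rw [Metric.mem_ball, Metric.mem_ball, dist_eq_norm, dist_eq_norm, ← smul_sub, norm_smul,
      Real.norm_of_nonneg hε.le, lt_div_iff₀ hε, mul_comm]
  have hm : Measurable ((Metric.ball (ε • c) r).indicator fun x => h x ^ 2) :=
    (hh.pow_const 2).indicator Metric.isOpen_ball.measurableSet
  have hs := lintegral_comp_smul_pos volume hε hm
  rw [finrank_euclideanSpace_fin] at hs
  unfold l2
  rw [← lintegral_indicator Metric.isOpen_ball.measurableSet,
    ← lintegral_indicator Metric.isOpen_ball.measurableSet, ← hs,
    ENNReal.mul_rpow_of_nonneg _ _ (by norm_num)]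
  congr 1
  · rw [← ENNReal.ofReal_pow hε.le, ENNReal.ofReal_rpow_of_pos (by positivity),
      ← Real.rpow_natCast, ← Real.rpow_mul hε.le]
    congr 2
    ring
  · congr 1
    refine lintegral_congr fun x => ?_
    by_cases hx : x ∈ Metric.ball c (r / ε)
    · rw [Set.indicator_of_mem hx, Set.indicator_of_mem ((hb x).1 hx)]
    · rw [Set.indicator_of_notMem hx, Set.indicator_of_notMem (fun h => hx ((hb x).2 h))]

/-- The amplitude contributes ε and the dilation contributes ε^{-n/2} in L², while rays of balls of
radius r/ε go to rays of balls of radius r. -/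
lemma nDL_comp_smul_le {ε r : ℝ} (hε : 0 < ε) {h : Sp n → ℝ≥0∞} (hh : Measurable h) :
    nDL (r / ε) (fun x => ENNReal.ofReal ε * h (ε • x)) ≤
      ENNReal.ofReal (ε ^ (1 - (n : ℝ) / 2)) * nDL r h := by
  have hm : Measurable fun x => h (ε • x) := hh.comp (measurable_const_smul ε)
  refine nDL_le fun x₀ θ => ?_
  calc ∑' k : ℕ, l2 (volume.restrict (dBall (r / ε) x₀ θ k)) (fun x => ENNReal.ofReal ε * h (ε • x))
      = ∑' k : ℕ, ENNReal.ofReal (ε ^ (1 - (n : ℝ) / 2)) *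
          l2 (volume.restrict (dBall r (ε • x₀) θ k)) h := by
        refine tsum_congr fun k => ?_
        have hc : ε • (x₀ + ((k : ℝ) * (r / ε)) • (θ : Sp n))
            = ε • x₀ + ((k : ℝ) * r) • (θ : Sp n) := by
          rw [smul_add, smul_smul]
          congr 2
          field_simp
        rw [l2_const_mul hm, dBall, dBall, ← hc, ← l2_ball_comp_smul hε _ hh, ← mul_assoc,
          ← ENNReal.ofReal_mul (by positivity), ← Real.rpow_add hε]
        congr 2
        rw [sub_add_cancel, Real.rpow_one]
    _ ≤ _ := by
        rw [ENNReal.tsum_mul_left]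
        exact mul_le_mul' le_rfl (tsum_le_nDL r h _ θ)

end Rescale

/-! ### Dyadic decomposition of the low frequency part, and reproducing kernels. -/

section Decomposition

variable {n m : ℕ}

lemma LPCutoff.sum_symbol (φ : LPCutoff n) (J : ℕ) (ξ : Sp n) :
    ∑ j ∈ Finset.range (J + 1), φ.symbol j ξ = φ.toFun (((2 : ℝ) ^ J)⁻¹ • ξ) := by
  induction J with
  | zero => simp [LPCutoff.symbol]
  | succ J ih =>
    rw [Finset.sum_range_succ, ih]
    simp [LPCutoff.symbol]

lemma LPCutoff.symbol_eq_zero (φ : LPCutoff n) (j : ℕ) {ξ : Sp n} (h : 2 * 2 ^ j ≤ ‖ξ‖) :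
    φ.symbol j ξ = 0 := by
  cases j with
  | zero => exact φ.eq_zero ξ (by simpa using h)
  | succ j =>
    have h1 : ∀ k : ℕ, k ≤ j + 1 → φ.toFun (((2 : ℝ) ^ k)⁻¹ • ξ) = 0 := by
      intro k hk
      apply φ.eq_zero
      rw [norm_smul, norm_inv, Real.norm_of_nonneg (by positivity), le_inv_mul_iff₀ (by positivity)]
      refine le_trans ?_ h
      rw [mul_comm]
      have : (2 : ℝ) ^ k ≤ 2 ^ (j + 1) := pow_le_pow_right₀ (by norm_num) hk
      linarith
    simp only [LPCutoff.symbol]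
    rw [h1 _ le_rfl, h1 _ (Nat.le_succ j), sub_zero]

lemma LPCutoff.symbol_succ_eq_zero (φ : LPCutoff n) (j : ℕ) {ξ : Sp n} (h : ‖ξ‖ ≤ 2 ^ j) :
    φ.symbol (j + 1) ξ = 0 := by
  have h1 : ∀ k : ℕ, j ≤ k → φ.toFun (((2 : ℝ) ^ k)⁻¹ • ξ) = 1 := by
    intro k hk
    apply φ.eq_one
    rw [norm_smul, norm_inv, Real.norm_of_nonneg (by positivity), inv_mul_le_iff₀ (by positivity),
      mul_one]
    exact h.trans (pow_le_pow_right₀ (by norm_num) hk)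
  simp only [LPCutoff.symbol]
  rw [h1 _ le_rfl, h1 _ (Nat.le_succ j), sub_self]

/-- A multiplier equal to 1 where q is nonzero acts as the identity on functions q(D)u. This gives
the reproducing formulas below. -/
lemma cv_ker_eq_self {p q : Sp n → ℝ} (hp : IsSymbol p) (hq : IsSymbol q)
    (h : ∀ ξ, q ξ * p ξ = q ξ) {u : Sp n → Val m} (hu : Temp u) :
    cv hp.ker (multiplier q u) = multiplier q u := by
  rw [← hp.multiplier_eq, multiplier_multiplier hp hq hu]
  simp_rw [h]

lemma normDL_piece_le (φ : LPCutoff n) (s : ℝ) (u : Sp n → Val m) (j : ℕ) :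
    normDL ((2 : ℝ) ^ j) (φ.piece j u) ≤
      ENNReal.ofReal (((2 : ℝ) ^ j) ^ (-s)) * normDH φ s u := by
  have h2 : (0 : ℝ) < 2 ^ j := by positivity
  set A := normDL ((2 : ℝ) ^ j) (φ.piece j u)
  have h1 : ENNReal.ofReal (((2 : ℝ) ^ j) ^ s) * A ≤ normDH φ s u := by
    apply le_of_sq_le_sq
    unfold normDH
    rw [rpow_half_sq, mul_pow, ← ENNReal.ofReal_pow (by positivity), ← Real.rpow_natCast,
      ← Real.rpow_mul h2.le, show s * ((2 : ℕ) : ℝ) = 2 * s by push_cast; ring]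
    exact ENNReal.le_tsum (f := fun j : ℕ => ENNReal.ofReal (((2 : ℝ) ^ j) ^ (2 * s)) *
      normDL ((2 : ℝ) ^ j) (φ.piece j u) ^ 2) j
  calc A = ENNReal.ofReal (((2 : ℝ) ^ j) ^ (-s)) * (ENNReal.ofReal (((2 : ℝ) ^ j) ^ s) * A) := by
        rw [← mul_assoc, ← ENNReal.ofReal_mul (by positivity), ← Real.rpow_add h2]
        simp
    _ ≤ _ := mul_le_mul' le_rfl h1

/-- The low frequency part of the rescaled dyadic piece. -/
def lowPiece (φ : LPCutoff n) (ε : ℝ) (u : Sp n → Val m) (j : ℕ) : Sp n → Val m :=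
  multiplier (fun ξ => φ.symbol j (ε⁻¹ • ξ) * φ.toFun ξ) (rescale ε u)

/-- The cutoff to the frequencies `|ξ| ≤ 4`, which equals `1` for `|ξ| ≤ 2`. -/
def LPCutoff.wide (φ : LPCutoff n) (ξ : Sp n) : ℝ := φ.toFun ((2 : ℝ)⁻¹ • ξ)

lemma LPCutoff.isSymbol_wide (φ : LPCutoff n) : IsSymbol φ.wide :=
  φ.isSymbol.comp_smul (by norm_num)

lemma LPCutoff.wide_eq_one (φ : LPCutoff n) {ξ : Sp n} (h : ‖ξ‖ ≤ 2) : φ.wide ξ = 1 := by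
  apply φ.eq_one
  rw [norm_smul, Real.norm_of_nonneg (by norm_num)]
  linarith

lemma LPCutoff.wide_eq_zero (φ : LPCutoff n) {ξ : Sp n} (h : 4 ≤ ‖ξ‖) : φ.wide ξ = 0 := by
  apply φ.eq_zero
  rw [norm_smul, Real.norm_of_nonneg (by norm_num)]
  linarith

/-- The kernel of the wide cutoff. -/
def LPCutoff.wideKer (φ : LPCutoff n) : 𝓢(Sp n, ℂ) := φ.isSymbol_wide.ker

lemma LPCutoff.mul_wide (φ : LPCutoff n) (ξ : Sp n) : φ.toFun ξ * φ.wide ξ = φ.toFun ξ := by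
  by_cases h : ‖ξ‖ ≤ 2
  · rw [φ.wide_eq_one h, mul_one]
  · rw [φ.eq_zero ξ (not_le.1 h).le, zero_mul]

lemma isSymbol_lowPiece (φ : LPCutoff n) {ε : ℝ} (hε : 0 < ε) (j : ℕ) :
    IsSymbol (fun ξ => φ.symbol j (ε⁻¹ • ξ) * φ.toFun ξ) :=
  ((φ.isSymbol_symbol j).comp_smul (by positivity)).mul φ.isSymbol

lemma cv_wideKer_low (φ : LPCutoff n) {u : Sp n → Val m} (hu : Temp u) :
    cv φ.wideKer (φ.low u) = φ.low u :=
  cv_ker_eq_self φ.isSymbol_wide φ.isSymbol φ.mul_wide hu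

section

variable (φ : LPCutoff n) {ε : ℝ} (hε : 0 < ε) {u : Sp n → Val m}

include hε

lemma cv_wideKer_lowPiece (hU : Temp (rescale ε u)) (j : ℕ) :
    cv φ.wideKer (lowPiece φ ε u j) = lowPiece φ ε u j :=
  cv_ker_eq_self φ.isSymbol_wide (isSymbol_lowPiece φ hε j)
    (fun ξ => by rw [mul_assoc, φ.mul_wide]) hU

/-- The frequencies of the piece satisfy |ξ| ≤ 2ε2^j, where the dilated wide cutoff equals 1. This
expresses the piece as its own average at scale 1/(ε2^j), the form needed for Bernstein. -/
lemma cv_dil_lowPiece (hU : Temp (rescale ε u)) (j : ℕ) (hρ : ε * 2 ^ j ≠ 0) :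
    cv (dil (ε * 2 ^ j) hρ φ.wideKer) (lowPiece φ ε u j) = lowPiece φ ε u j := by
  have hρ0 : 0 < ε * 2 ^ j := by positivity
  rw [LPCutoff.wideKer, ← IsSymbol.ker_comp_smul φ.isSymbol_wide hρ0]
  refine cv_ker_eq_self _ (isSymbol_lowPiece φ hε j) (fun ξ => ?_) hU
  by_cases h : ‖ξ‖ ≤ 2 * (ε * 2 ^ j)
  · rw [φ.wide_eq_one, mul_one]
    rw [norm_smul, norm_inv, Real.norm_of_nonneg hρ0.le, inv_mul_le_iff₀ hρ0]
    linarith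
  · rw [φ.symbol_eq_zero j, zero_mul, zero_mul]
    rw [norm_smul, norm_inv, Real.norm_of_nonneg hε.le, le_inv_mul_iff₀ hε]
    linarith

lemma lowPiece_eq (hu : Temp (rescale ε u)) (j : ℕ) :
    lowPiece φ ε u j = cv φ.isSymbol.ker (rescale ε (φ.piece j u)) := by
  rw [LPCutoff.piece, rescale_multiplier _ hε, ← φ.isSymbol.multiplier_eq,
    multiplier_multiplier φ.isSymbol ((φ.isSymbol_symbol j).comp_smul (by positivity)) hu]
  rfl

/-- The partial sums of the symbols telescope to a cutoff that equals 1 for |ξ| ≤ ε2^J, hence on the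
support |ξ| ≤ 2 of φ. The sum is finite, so no convergence question arises. -/
lemma low_eq_sum (hU : Temp (rescale ε u)) {J : ℕ} (hJ : 2 ≤ ε * 2 ^ J) (x : Sp n) :
    φ.low (rescale ε u) x = ∑ j ∈ Finset.range (J + 1), lowPiece φ ε u j x := by
  have hS : ∀ ξ, φ.toFun ξ = ∑ j ∈ Finset.range (J + 1), φ.symbol j (ε⁻¹ • ξ) * φ.toFun ξ := by
    intro ξ
    rw [← Finset.sum_mul, φ.sum_symbol]
    by_cases h : ‖ξ‖ ≤ 2
    · rw [φ.eq_one (_ • _), one_mul]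
      rw [norm_smul, norm_smul, norm_inv, norm_inv, Real.norm_of_nonneg (by positivity),
        Real.norm_of_nonneg hε.le, inv_mul_le_iff₀ (by positivity), inv_mul_le_iff₀ hε]
      linarith
    · rw [φ.eq_zero ξ (not_le.1 h).le, mul_zero]
  have hk : ∀ y, φ.isSymbol.ker y
      = ∑ j ∈ Finset.range (J + 1), (isSymbol_lowPiece φ hε j).ker y := by
    intro y
    have : φ.isSymbol.ker = ∑ j ∈ Finset.range (J + 1), (isSymbol_lowPiece φ hε j).ker := by
      apply schwartz_ext_fourier
      intro ξ
      have h1 : 𝓕 (∑ j ∈ Finset.range (J + 1), (isSymbol_lowPiece φ hε j).ker)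
          = ∑ j ∈ Finset.range (J + 1), 𝓕 (isSymbol_lowPiece φ hε j).ker :=
        map_sum (FourierTransform.fourierCLM ℂ 𝓢(Sp n, ℂ)) _ _
      rw [h1, sum_apply, IsSymbol.fourier_ker, hS, Complex.ofReal_sum]
      exact Finset.sum_congr rfl fun j _ => ((isSymbol_lowPiece φ hε j).fourier_ker ξ).symm
    rw [this, sum_apply]
  have h := cv_sum (Finset.range (J + 1)) (fun j => (isSymbol_lowPiece φ hε j).ker) hU _ hk x
  rw [← φ.isSymbol.multiplier_eq] at h
  rw [LPCutoff.low, LPCutoff.piece]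
  refine h.trans (Finset.sum_congr rfl fun j _ => ?_)
  rw [← IsSymbol.multiplier_eq]
  rfl

end

lemma exists_enorm_cv_dil_le (f : 𝓢(Sp n, ℂ)) : ∃ C : ℝ≥0∞, C ≠ ∞ ∧
    ∀ (ρ : ℝ) (hρ : 0 < ρ) (u : Sp n → Val m), Measurable u → ∀ x,
      ‖cv (dil ρ hρ.ne' f) u x‖ₑ ≤ C * smear ρ (fun y => ‖u y‖ₑ) x := by
  obtain ⟨C, hC, hf⟩ := exists_enorm_schwartz_le f (2 * n + 2)
  refine ⟨C, hC, fun ρ hρ u hu x => (enorm_cv_le _ _ _).trans ?_⟩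
  have hm : Measurable fun y => decayKer ρ (x - y) * ‖u y‖ₑ :=
    ((measurable_decayKer ρ).comp (measurable_id.const_sub x)).mul hu.enorm
  rw [smear, ← lintegral_const_mul _ hm]
  refine lintegral_mono fun y => ?_
  rw [← mul_assoc]
  refine mul_le_mul' ?_ le_rfl
  rw [dil_apply, enorm_smul, decayKer, Real.enorm_eq_ofReal (by positivity),
    ENNReal.ofReal_pow hρ.le]
  calc _ ≤ ENNReal.ofReal ρ ^ n * (C * (wt (ρ • (x - y)) ^ (2 * n + 2))⁻¹) :=
        mul_le_mul' le_rfl (hf _)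
    _ = _ := by ring

lemma cv_smul_left (c : ℝ) (f : 𝓢(Sp n, ℂ)) (u : Sp n → Val m) (x : Sp n) :
    cv (c • f) u x = c • cv f u x := by
  unfold cv
  rw [← integral_smul]
  refine integral_congr_ae (.of_forall fun y => ?_)
  simp only [smul_apply, smul_assoc]

lemma cv_add (f : 𝓢(Sp n, ℂ)) {u v : Sp n → Val m} (hu : Temp u) (hv : Temp v) (x : Sp n) :
    cv f (fun y => u y + v y) x = cv f u x + cv f v x := by
  unfold cv
  rw [← integral_add (hu.integrable f x) (hv.integrable f x)]
  simp only [smul_add]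

lemma cv_finset_sum {ι : Type*} (t : Finset ι) (f : 𝓢(Sp n, ℂ)) {u : ι → Sp n → Val m}
    (hu : ∀ i, Temp (u i)) (x : Sp n) :
    cv f (fun y => ∑ i ∈ t, u i y) x = ∑ i ∈ t, cv f (u i) x := by
  unfold cv
  rw [← integral_finsetSum t fun i _ => (hu i).integrable f x]
  refine integral_congr_ae (.of_forall fun y => ?_)
  simp only [Finset.smul_sum]

/-- Convolution with a Schwartz function is bounded on `𝒟L²_r`. -/
lemma nDL_cv_le (r : ℝ) (f : 𝓢(Sp n, ℂ)) {u : Sp n → Val m} (hu : Measurable u) :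
    nDL r (fun x => ‖cv f u x‖ₑ) ≤ (∫⁻ y, ‖f y‖ₑ) * nDL r (fun x => ‖u x‖ₑ) := by
  refine le_trans (nDL_mono fun x => ?_)
    (nDL_convolution_le r f.continuous.measurable.enorm hu.enorm)
  refine (enorm_cv_le f u x).trans (le_of_eq ?_)
  rw [← lintegral_sub_left_eq_self _ x]
  simp

end Decomposition

/-! ### Estimates for a single rescaled dyadic piece. -/

section PieceEstimates

variable {n m : ℕ}

lemma Temp.measurable_piece {u : Sp n → Val m} (hu : Temp u) (φ : LPCutoff n) (j : ℕ) :
    Measurable (φ.piece j u) := by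
  rw [LPCutoff.piece, (φ.isSymbol_symbol j).multiplier_eq]
  exact (stronglyMeasurable_cv _ hu.1).measurable

lemma Temp.measurable_lowPiece {φ : LPCutoff n} {ε : ℝ} (hε : 0 < ε) {u : Sp n → Val m}
    (hU : Temp (DNLS.rescale ε u)) (j : ℕ) : Measurable (lowPiece φ ε u j) := by
  rw [lowPiece, (isSymbol_lowPiece φ hε j).multiplier_eq]
  exact (stronglyMeasurable_cv _ hU.1).measurable

lemma nDL_lowPiece_le (φ : LPCutoff n) (s : ℝ) {ε : ℝ} (hε : 0 < ε) (hε1 : ε ≤ 1)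
    {u : Sp n → Val m} (hu : Temp u) (j : ℕ) :
    nDL ((2 : ℝ) ^ j / ε) (fun x => ‖lowPiece φ ε u j x‖ₑ) ≤
      (∫⁻ y, ‖φ.isSymbol.ker y‖ₑ) * (ENNReal.ofReal (ε ^ (1 - (n : ℝ) / 2) *
        ((2 : ℝ) ^ j) ^ (-s)) * normDH φ s u) := by
  have hm := hu.measurable_piece φ j
  have hg : Measurable (rescale ε (φ.piece j u)) :=
    (hm.comp (measurable_const_smul ε)).const_smul ε
  rw [lowPiece_eq φ hε (hu.rescale hε hε1)]
  refine (nDL_cv_le _ _ hg).trans (mul_le_mul' le_rfl ?_)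
  have e : ∀ x, ‖rescale ε (φ.piece j u) x‖ₑ
      = ENNReal.ofReal ε * ‖φ.piece j u (ε • x)‖ₑ := by
    intro x
    rw [rescale, enorm_smul, Real.enorm_eq_ofReal hε.le]
  simp_rw [e]
  refine (nDL_comp_smul_le hε hm.enorm).trans ?_
  rw [← normDL_eq (by positivity), ENNReal.ofReal_mul (by positivity), mul_assoc]
  exact mul_le_mul' le_rfl (normDL_piece_le φ s u j)

lemma ofReal_rpow_half {a : ℝ} (ha : 0 ≤ a) :
    ENNReal.ofReal a ^ (1 / 2 : ℝ) = ENNReal.ofReal (a ^ (1 / 2 : ℝ)) :=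
  ENNReal.ofReal_rpow_of_nonneg ha (by norm_num)

/-- The Bernstein factor for ρ = εa and R = a/ε, times the scaling factor of the piece: ε^{n/2-1}
and ε^{1-n/2} cancel. -/
lemma scaling_identity {ε a : ℝ} (hε : 0 < ε) (ha : 0 < a) (s : ℝ) :
    ((ε * a) ^ n * (ε * a)⁻¹ * (a / ε)) ^ (1 / 2 : ℝ) *
      (ε ^ (1 - (n : ℝ) / 2) * a ^ (-s)) = a ^ ((n : ℝ) / 2 - s) := by
  have h1 : (ε * a) ^ n * (ε * a)⁻¹ * (a / ε) = ε ^ ((n : ℝ) - 2) * a ^ (n : ℝ) := by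
    rw [Real.rpow_sub hε, Real.rpow_natCast, Real.rpow_natCast, mul_pow]
    have : ε ^ (2 : ℝ) = ε ^ 2 := by norm_cast
    rw [this]
    field_simp
  rw [h1, Real.mul_rpow (by positivity) (by positivity), ← Real.rpow_mul hε.le,
    ← Real.rpow_mul ha.le]
  calc _ = (ε ^ (((n : ℝ) - 2) * (1 / 2)) * ε ^ (1 - (n : ℝ) / 2)) *
        (a ^ ((n : ℝ) * (1 / 2)) * a ^ (-s)) := by ring
    _ = _ := by
      rw [← Real.rpow_add hε, ← Real.rpow_add ha]
      have e1 : ((n : ℝ) - 2) * (1 / 2) + (1 - (n : ℝ) / 2) = 0 := by ring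
      rw [e1, Real.rpow_zero, one_mul]
      congr 1
      ring

lemma scaling_identity_sup {ε a : ℝ} (hε : 0 < ε) (ha : 0 < a) (s : ℝ) :
    ((ε * a) ^ n) ^ (1 / 2 : ℝ) * (ε ^ (1 - (n : ℝ) / 2) * a ^ (-s))
      = ε * a ^ ((n : ℝ) / 2 - s) := by
  rw [← Real.rpow_natCast, Real.mul_rpow hε.le ha.le, Real.mul_rpow (by positivity) (by positivity),
    ← Real.rpow_mul hε.le, ← Real.rpow_mul ha.le]
  calc _ = (ε ^ ((n : ℝ) * (1 / 2)) * ε ^ (1 - (n : ℝ) / 2)) *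
        (a ^ ((n : ℝ) * (1 / 2)) * a ^ (-s)) := by ring
    _ = _ := by
      rw [← Real.rpow_add hε, ← Real.rpow_add ha]
      have e1 : ((n : ℝ) * (1 / 2)) + (1 - (n : ℝ) / 2) = 1 := by ring
      rw [e1, Real.rpow_one]
      congr 2
      ring

/-- Bernstein with ρ = ε2^j and R = 2^j/ε; the condition ρR ≥ 1 holds because ρR = 4^j. The kernel f
is arbitrary so that derivatives of the reproducing kernel are covered. -/
lemma exists_nDL_cv_dil_lowPiece_le (m : ℕ) (φ : LPCutoff n) (f : 𝓢(Sp n, ℂ)) :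
    ∃ C : ℝ≥0∞, C ≠ ∞ ∧ ∀ (s ε : ℝ) (_ : 0 < ε) (_ : ε ≤ 1) (u : Sp n → Val m), Temp u →
      ∀ (j : ℕ) (hρ : 0 < ε * 2 ^ j), ε * 2 ^ j ≤ 4 →
      nDL 1 (fun x => ‖cv (dil (ε * 2 ^ j) hρ.ne' f) (lowPiece φ ε u j) x‖ₑ) ≤
        C * (ENNReal.ofReal (((2 : ℝ) ^ j) ^ ((n : ℝ) / 2 - s)) * normDH φ s u) := by
  obtain ⟨C₁, hC₁, h1⟩ := exists_enorm_cv_dil_le (m := m) f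
  obtain ⟨C₂, hC₂, h2⟩ := exists_nDL_one_le n
  refine ⟨C₁ * (C₂ * ∫⁻ y, ‖φ.isSymbol.ker y‖ₑ), ENNReal.mul_ne_top hC₁ (ENNReal.mul_ne_top hC₂
    φ.isSymbol.ker.integrable.hasFiniteIntegral.ne), ?_⟩
  intro s ε hε hε1 u hu j hρ hρ4
  have hW : Measurable (lowPiece φ ε u j) := (hu.rescale hε hε1).measurable_lowPiece hε j
  set a : ℝ := 2 ^ j with ha
  have ha1 : 1 ≤ a := one_le_pow₀ (by norm_num)
  have ha0 : 0 < a := by positivity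
  have hρR : 1 ≤ ε * a * (a / ε) := by
    have : ε * a * (a / ε) = a * a := by field_simp
    rw [this]; nlinarith
  calc _ ≤ nDL 1 (fun x => C₁ * smear (ε * a) (fun y => ‖lowPiece φ ε u j y‖ₑ) x) :=
        nDL_mono fun x => h1 _ hρ _ hW x
    _ ≤ C₁ * nDL 1 (smear (ε * a) (fun y => ‖lowPiece φ ε u j y‖ₑ)) :=
        nDL_const_mul (measurable_smear _ hW.enorm)
    _ ≤ C₁ * (C₂ * ENNReal.ofReal ((ε * a) ^ n * (ε * a)⁻¹ * (a / ε)) ^ (1 / 2 : ℝ) *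
          nDL (a / ε) (fun y => ‖lowPiece φ ε u j y‖ₑ)) :=
        mul_le_mul' le_rfl (h2 _ _ hρ hρ4 (by positivity) hρR _ _ hW.enorm fun x => le_rfl)
    _ ≤ C₁ * (C₂ * ENNReal.ofReal ((ε * a) ^ n * (ε * a)⁻¹ * (a / ε)) ^ (1 / 2 : ℝ) *
          ((∫⁻ y, ‖φ.isSymbol.ker y‖ₑ) * (ENNReal.ofReal (ε ^ (1 - (n : ℝ) / 2) *
            a ^ (-s)) * normDH φ s u))) :=
        mul_le_mul' le_rfl (mul_le_mul' le_rfl (nDL_lowPiece_le φ s hε hε1 hu j))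
    _ = _ := by
        rw [ofReal_rpow_half (by positivity), ← scaling_identity hε ha0 s,
          ENNReal.ofReal_mul (by positivity : 0 ≤ ((ε * a) ^ n * (ε * a)⁻¹ * (a / ε)) ^ (1 / 2 : ℝ))]
        ring

lemma exists_enorm_lowPiece_le (hn : 0 < n) (m : ℕ) (φ : LPCutoff n) :
    ∃ C : ℝ≥0∞, C ≠ ∞ ∧ ∀ (s ε : ℝ) (_ : 0 < ε) (_ : ε ≤ 1) (u : Sp n → Val m), Temp u →
      ∀ (j : ℕ) (x : Sp n), ‖lowPiece φ ε u j x‖ₑ ≤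
        C * (ENNReal.ofReal (ε * ((2 : ℝ) ^ j) ^ ((n : ℝ) / 2 - s)) * normDH φ s u) := by
  obtain ⟨C₁, hC₁, h1⟩ := exists_enorm_cv_dil_le (m := m) φ.wideKer
  obtain ⟨C₂, hC₂, h2⟩ := exists_smear_le hn
  refine ⟨C₁ * (C₂ * ∫⁻ y, ‖φ.isSymbol.ker y‖ₑ), ENNReal.mul_ne_top hC₁ (ENNReal.mul_ne_top hC₂
    φ.isSymbol.ker.integrable.hasFiniteIntegral.ne), ?_⟩
  intro s ε hε hε1 u hu j x
  have hU := hu.rescale hε hε1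
  have hW : Measurable (lowPiece φ ε u j) := hU.measurable_lowPiece hε j
  have hρ : 0 < ε * 2 ^ j := by positivity
  have hrep := cv_dil_lowPiece φ hε hU j hρ.ne'
  set a : ℝ := 2 ^ j with ha
  have ha1 : 1 ≤ a := one_le_pow₀ (by norm_num)
  have ha0 : 0 < a := by positivity
  have hρR : 1 ≤ ε * a * (a / ε) := by
    have : ε * a * (a / ε) = a * a := by field_simp
    rw [this]; nlinarith
  calc ‖lowPiece φ ε u j x‖ₑ = ‖cv (dil (ε * a) hρ.ne' φ.wideKer) (lowPiece φ ε u j) x‖ₑ := by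
        rw [hrep]
    _ ≤ C₁ * smear (ε * a) (fun y => ‖lowPiece φ ε u j y‖ₑ) x := h1 _ hρ _ hW x
    _ ≤ C₁ * (C₂ * ENNReal.ofReal ((ε * a) ^ n) ^ (1 / 2 : ℝ) *
          nDL (a / ε) (fun y => ‖lowPiece φ ε u j y‖ₑ)) :=
        mul_le_mul' le_rfl (h2 _ _ hρ (by positivity) hρR _ hW.enorm x)
    _ ≤ C₁ * (C₂ * ENNReal.ofReal ((ε * a) ^ n) ^ (1 / 2 : ℝ) *
          ((∫⁻ y, ‖φ.isSymbol.ker y‖ₑ) * (ENNReal.ofReal (ε ^ (1 - (n : ℝ) / 2) *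
            a ^ (-s)) * normDH φ s u))) :=
        mul_le_mul' le_rfl (mul_le_mul' le_rfl (nDL_lowPiece_le φ s hε hε1 hu j))
    _ = _ := by
        rw [ofReal_rpow_half (by positivity), ← scaling_identity_sup hε ha0 s,
          ENNReal.ofReal_mul (by positivity : 0 ≤ ((ε * a) ^ n) ^ (1 / 2 : ℝ))]
        ring

section Deriv

variable (φ : LPCutoff n) {ε : ℝ} (hε : 0 < ε) {u : Sp n → Val m} (hU : Temp (DNLS.rescale ε u)) (j : ℕ)
  (hb : BddMeas (lowPiece φ ε u j)) (hρ : ε * 2 ^ j ≠ 0) (v x : Sp n)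

include hε hU hb

/-- Both the fixed and the dilated wide kernel reproduce the piece. Differentiating the two
representations and comparing extracts the factor ε2^j. -/
lemma cv_lineDeriv_lowPiece : cv (∂_{v} φ.wideKer) (lowPiece φ ε u j) x =
    (ε * 2 ^ j) • cv (dil (ε * 2 ^ j) hρ (∂_{v} φ.wideKer)) (lowPiece φ ε u j) x := by
  rw [← cv_smul_left, ← lineDeriv_dil, ← fderiv_cv_apply _ hb, ← fderiv_cv_apply _ hb,
    cv_wideKer_lowPiece φ hε hU, cv_dil_lowPiece φ hε hU]

lemma cv_lineDeriv_lineDeriv_lowPiece :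
    cv (∂_{v} (∂_{v} φ.wideKer)) (lowPiece φ ε u j) x = (ε * 2 ^ j) ^ 2 •
      cv (dil (ε * 2 ^ j) hρ (∂_{v} (∂_{v} φ.wideKer))) (lowPiece φ ε u j) x := by
  have h1 : cv (∂_{v} φ.wideKer) (lowPiece φ ε u j)
      = cv (∂_{v} (dil (ε * 2 ^ j) hρ φ.wideKer)) (lowPiece φ ε u j) := by
    ext1 x
    rw [lineDeriv_dil, cv_smul_left]
    exact cv_lineDeriv_lowPiece φ hε hU j hb hρ v x
  rw [← fderiv_cv_apply _ hb, h1, fderiv_cv_apply _ hb, lineDeriv_dil, LineDeriv.lineDerivOp_smul,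
    lineDeriv_dil, cv_smul_left, cv_smul_left, smul_smul, sq]

end Deriv

lemma nDL_real_smul_le (r : ℝ) {c : ℝ} (hc : 0 ≤ c) {v : Sp n → Val m} (hv : Measurable v) :
    nDL r (fun x => ‖c • v x‖ₑ) ≤ ENNReal.ofReal c * nDL r (fun x => ‖v x‖ₑ) := by
  simp_rw [enorm_smul, Real.enorm_eq_ofReal hc]
  exact nDL_const_mul hv.enorm

/-- The estimates for the low frequency part of a rescaled dyadic piece and its derivatives. -/
lemma exists_lowPiece_le (hn : 0 < n) (m : ℕ) (φ : LPCutoff n) :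
    ∃ C : ℝ≥0∞, C ≠ ∞ ∧ ∀ (s ε : ℝ) (_ : 0 < ε) (_ : ε ≤ 1) (u : Sp n → Val m), Temp u →
      normDH φ s u < ∞ → ∀ j : ℕ, ε * 2 ^ j ≤ 4 →
      BddMeas (lowPiece φ ε u j) ∧
      (∀ x : Sp n, ‖lowPiece φ ε u j x‖ₑ ≤
        C * (ENNReal.ofReal (ε * ((2 : ℝ) ^ j) ^ ((n : ℝ) / 2 - s)) * normDH φ s u)) ∧
      (∀ i : Fin n, nDL 1 (fun x =>
        ‖cv (∂_{EuclideanSpace.single i (1 : ℝ)} φ.wideKer) (lowPiece φ ε u j) x‖ₑ) ≤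
        C * (ENNReal.ofReal ((ε * 2 ^ j) * ((2 : ℝ) ^ j) ^ ((n : ℝ) / 2 - s)) *
          normDH φ s u)) ∧
      (∀ i : Fin n, nDL 1 (fun x =>
        ‖cv (∂_{EuclideanSpace.single i (1 : ℝ)} (∂_{EuclideanSpace.single i (1 : ℝ)} φ.wideKer))
          (lowPiece φ ε u j) x‖ₑ) ≤
        C * (ENNReal.ofReal ((ε * 2 ^ j) ^ 2 * ((2 : ℝ) ^ j) ^ ((n : ℝ) / 2 - s)) *
          normDH φ s u)) := by
  obtain ⟨C₀, hC₀, h0⟩ := exists_enorm_lowPiece_le hn m φ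
  choose C₁ hC₁ h1 using fun i : Fin n => exists_nDL_cv_dil_lowPiece_le m φ
    (∂_{EuclideanSpace.single i (1 : ℝ)} φ.wideKer)
  choose C₂ hC₂ h2 using fun i : Fin n => exists_nDL_cv_dil_lowPiece_le m φ
    (∂_{EuclideanSpace.single i (1 : ℝ)} (∂_{EuclideanSpace.single i (1 : ℝ)} φ.wideKer))
  have l1 : ∀ i, C₁ i ≤ C₀ + ∑ i, C₁ i + ∑ i, C₂ i := fun i =>
    (Finset.single_le_sum (fun _ _ => zero_le) (Finset.mem_univ i)).trans
      (le_add_self.trans le_self_add)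
  have l2 : ∀ i, C₂ i ≤ C₀ + ∑ i, C₁ i + ∑ i, C₂ i := fun i =>
    (Finset.single_le_sum (fun _ _ => zero_le) (Finset.mem_univ i)).trans le_add_self
  refine ⟨C₀ + ∑ i, C₁ i + ∑ i, C₂ i, ?_, ?_⟩
  · simp [hC₀, hC₁, hC₂, ENNReal.sum_eq_top]
  intro s ε hε hε1 u hu hM j hj
  have hU := hu.rescale hε hε1
  have hW : Measurable (lowPiece φ ε u j) := hU.measurable_lowPiece hε j
  have hρ : 0 < ε * 2 ^ j := by positivity
  have hb : BddMeas (lowPiece φ ε u j) :=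
    ⟨hW.aestronglyMeasurable, _, ENNReal.mul_ne_top hC₀ (ENNReal.mul_ne_top
      ENNReal.ofReal_ne_top hM.ne), h0 s ε hε hε1 u hu j⟩
  have hm : ∀ f : 𝓢(Sp n, ℂ), Measurable (cv f (lowPiece φ ε u j)) := fun f =>
    (stronglyMeasurable_cv f hb.1).measurable
  refine ⟨hb, fun x => (h0 s ε hε hε1 u hu j x).trans ?_, fun i => ?_, fun i => ?_⟩
  · exact mul_le_mul' (le_self_add.trans le_self_add) le_rfl
  · simp_rw [cv_lineDeriv_lowPiece φ hε hU j hb hρ.ne']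
    refine (nDL_real_smul_le 1 hρ.le (hm _)).trans ?_
    calc _ ≤ ENNReal.ofReal (ε * 2 ^ j) * (C₁ i *
          (ENNReal.ofReal (((2 : ℝ) ^ j) ^ ((n : ℝ) / 2 - s)) * normDH φ s u)) :=
          mul_le_mul' le_rfl (h1 i s ε hε hε1 u hu j hρ hj)
      _ ≤ ENNReal.ofReal (ε * 2 ^ j) * ((C₀ + ∑ i, C₁ i + ∑ i, C₂ i) *
          (ENNReal.ofReal (((2 : ℝ) ^ j) ^ ((n : ℝ) / 2 - s)) * normDH φ s u)) :=
          mul_le_mul' le_rfl (mul_le_mul' (l1 i) le_rfl)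
      _ = _ := by
          rw [ENNReal.ofReal_mul hρ.le]
          ring
  · simp_rw [cv_lineDeriv_lineDeriv_lowPiece φ hε hU j hb hρ.ne']
    refine (nDL_real_smul_le 1 (by positivity) (hm _)).trans ?_
    calc _ ≤ ENNReal.ofReal ((ε * 2 ^ j) ^ 2) * (C₂ i *
          (ENNReal.ofReal (((2 : ℝ) ^ j) ^ ((n : ℝ) / 2 - s)) * normDH φ s u)) :=
          mul_le_mul' le_rfl (h2 i s ε hε hε1 u hu j hρ hj)
      _ ≤ ENNReal.ofReal ((ε * 2 ^ j) ^ 2) * ((C₀ + ∑ i, C₁ i + ∑ i, C₂ i) *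
          (ENNReal.ofReal (((2 : ℝ) ^ j) ^ ((n : ℝ) / 2 - s)) * normDH φ s u)) :=
          mul_le_mul' le_rfl (mul_le_mul' (l2 i) le_rfl)
      _ = _ := by
          rw [ENNReal.ofReal_mul (by positivity : 0 ≤ (ε * 2 ^ j) ^ 2)]
          ring

end PieceEstimates

/-! ### Sums over the dyadic frequencies. -/

section DyadicSums

lemma exists_dyadic_scale {ε : ℝ} (hε : 0 < ε) (hε1 : ε ≤ 1) :
    ∃ J : ℕ, 2 ≤ ε * 2 ^ J ∧ ε * 2 ^ J ≤ 4 := by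
  have h : ∃ J : ℕ, 2 ≤ ε * 2 ^ J := by
    obtain ⟨J, hJ⟩ := pow_unbounded_of_one_lt (2 / ε) (one_lt_two (α := ℝ))
    exact ⟨J, by rw [div_lt_iff₀ hε] at hJ; linarith⟩
  refine ⟨Nat.find h, Nat.find_spec h, ?_⟩
  rcases hk : Nat.find h with _ | k
  · simp only [pow_zero]; linarith
  · have := Nat.find_min h (m := k) (by omega)
    rw [pow_succ]; linarith

lemma sum_pow_le {r : ℝ} (h0 : 0 ≤ r) (h1 : r < 1) (J : ℕ) :
    ∑ j ∈ Finset.range J, r ^ j ≤ (1 - r)⁻¹ := by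
  rw [← tsum_geometric_of_lt_one h0 h1]
  exact (summable_geometric_of_lt_one h0 h1).sum_le_tsum _ fun _ _ => pow_nonneg h0 _

lemma two_pow_rpow (j : ℕ) (p : ℝ) : ((2 : ℝ) ^ j) ^ p = ((2 : ℝ) ^ p) ^ j := by
  rw [← Real.rpow_natCast, ← Real.rpow_natCast, ← Real.rpow_mul (by norm_num),
    ← Real.rpow_mul (by norm_num), mul_comm]

lemma rpow_two_neg_lt_one {q : ℝ} (hq : 0 < q) : (2 : ℝ) ^ (-q) < 1 :=
  Real.rpow_lt_one_of_one_lt_of_neg one_lt_two (by linarith)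

lemma sum_two_pow_rpow_neg_le {q : ℝ} (hq : 0 < q) (J : ℕ) :
    ∑ j ∈ Finset.range J, ((2 : ℝ) ^ j) ^ (-q) ≤ (1 - (2 : ℝ) ^ (-q))⁻¹ := by
  simp_rw [two_pow_rpow]
  exact sum_pow_le (by positivity) (rpow_two_neg_lt_one hq) J

lemma mul_two_pow_le_four {ε : ℝ} (hε : 0 < ε) {j J : ℕ} (hJ : ε * 2 ^ J ≤ 4) (hj : j ≤ J) :
    ε * 2 ^ j ≤ 4 :=
  (mul_le_mul_of_nonneg_left (pow_le_pow_right₀ (by norm_num) hj) hε.le).trans hJ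

/-- The sum is dominated by its top term, which is at most 4^q; reversing the order turns it into a
decreasing geometric series. -/
lemma sum_rpow_le {ε q : ℝ} (hε : 0 < ε) (hq : 0 < q) {J : ℕ} (hJ : ε * 2 ^ J ≤ 4) :
    ∑ j ∈ Finset.range (J + 1), (ε * 2 ^ j) ^ q ≤ 4 ^ q * (1 - (2 : ℝ) ^ (-q))⁻¹ := by
  rw [← Finset.sum_range_reflect]
  refine le_trans (Finset.sum_le_sum (g := fun j => 4 ^ q * ((2 : ℝ) ^ j) ^ (-q)) ?_) ?_
  · intro j hj
    have hj' : j ≤ J := by simpa [Nat.lt_succ_iff] using hj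
    rw [Real.rpow_neg (by positivity), ← Real.inv_rpow (by positivity),
      ← Real.mul_rpow (by norm_num) (by positivity)]
    refine Real.rpow_le_rpow (by positivity) ?_ hq.le
    rw [← div_eq_mul_inv, le_div_iff₀ (by positivity), mul_assoc, ← pow_add]
    rwa [show J + 1 - 1 - j + j = J by omega]
  · rw [← Finset.mul_sum]
    exact mul_le_mul_of_nonneg_left (sum_two_pow_rpow_neg_le hq _) (by positivity)

lemma sq_mul_rpow_neg {ε a : ℝ} (hε : 0 < ε) (ha : 0 < a) (δ : ℝ) :
    (ε * a) ^ 2 * a ^ (-δ) = ε ^ δ * (ε * a) ^ (2 - δ) := by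
  have h2 : ∀ x : ℝ, x ^ 2 = x ^ (2 : ℝ) := fun x => by norm_cast
  rw [h2, Real.mul_rpow hε.le ha.le, Real.mul_rpow hε.le ha.le, mul_assoc, ← Real.rpow_add ha,
    ← mul_assoc, ← Real.rpow_add hε]
  ring_nf

/-- The dyadic sums that bound the nonlinear and the linear part of the forcing term. -/
lemma exists_dyadic_sums_le {δ : ℝ} (hδ : 0 < δ) :
    ∃ K : ℝ, 0 < K ∧ ∀ ε : ℝ, 0 < ε → ε ≤ 1 → ∃ J : ℕ, 2 ≤ ε * 2 ^ J ∧ ε * 2 ^ J ≤ 4 ∧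
      ∑ j ∈ Finset.range (J + 1), ε * ((2 : ℝ) ^ j) ^ (-δ) ≤ K * ε ∧
      ε * ∑ j ∈ Finset.range (J + 1), ε * 2 ^ j * ((2 : ℝ) ^ j) ^ (-δ) +
        ∑ j ∈ Finset.range (J + 1), (ε * 2 ^ j) ^ 2 * ((2 : ℝ) ^ j) ^ (-δ) ≤
          K * max ε (ε ^ δ) ∧
      (1 ≤ δ → δ < 2 →
        ε * ∑ j ∈ Finset.range (J + 1), ε * 2 ^ j * ((2 : ℝ) ^ j) ^ (-δ) +
          ∑ j ∈ Finset.range (J + 1), (ε * 2 ^ j) ^ 2 * ((2 : ℝ) ^ j) ^ (-δ) ≤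
            K * min ε (ε ^ δ)) := by
  set A : ℝ := (1 - (2 : ℝ) ^ (-δ))⁻¹ with hA
  have hA0 : 0 < A := inv_pos.2 (sub_pos.2 (rpow_two_neg_lt_one hδ))
  -- D is meaningful only for δ < 2; it is not positive otherwise, and its absolute value keeps the
  -- final constant positive for every δ.
  set D : ℝ := 4 ^ (2 - δ) * (1 - (2 : ℝ) ^ (-(2 - δ)))⁻¹ with hD
  refine ⟨4 * A + |D| + 8 + 2 * 4 ^ (2 - δ), by positivity, fun ε hε hε1 => ?_⟩
  obtain ⟨J, hJ2, hJ4⟩ := exists_dyadic_scale hε hε1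
  have h4 : ∀ j ∈ Finset.range (J + 1), ε * 2 ^ j ≤ 4 := fun j hj =>
    mul_two_pow_le_four hε hJ4 (by simpa [Nat.lt_succ_iff] using hj)
  have h1 : ∑ j ∈ Finset.range (J + 1), ((2 : ℝ) ^ j) ^ (-δ) ≤ A := sum_two_pow_rpow_neg_le hδ _
  have hhalf : ∑ j ∈ Finset.range (J + 1), ((2 : ℝ) ^ j)⁻¹ ≤ 2 := by
    have := sum_pow_le (r := 2⁻¹) (by norm_num) (by norm_num) (J + 1)
    norm_num at this ⊢
    simpa using this
  have hP : (0 : ℝ) < ε ^ δ := by positivity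
  have hS1 : ε * ∑ j ∈ Finset.range (J + 1), ε * 2 ^ j * ((2 : ℝ) ^ j) ^ (-δ) ≤ 4 * A * ε := by
    have : ∑ j ∈ Finset.range (J + 1), ε * 2 ^ j * ((2 : ℝ) ^ j) ^ (-δ) ≤ 4 * A :=
      calc _ ≤ ∑ j ∈ Finset.range (J + 1), 4 * ((2 : ℝ) ^ j) ^ (-δ) :=
            Finset.sum_le_sum fun j hj =>
              mul_le_mul_of_nonneg_right (h4 j hj) (by positivity)
        _ ≤ 4 * A := by rw [← Finset.mul_sum]; linarith
    nlinarith
  have hS2 : δ < 2 → ∑ j ∈ Finset.range (J + 1), (ε * 2 ^ j) ^ 2 * ((2 : ℝ) ^ j) ^ (-δ) ≤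
      |D| * ε ^ δ := by
    intro h
    simp_rw [sq_mul_rpow_neg hε (pow_pos (two_pos (α := ℝ)) _) δ]
    rw [← Finset.mul_sum, mul_comm]
    exact mul_le_mul_of_nonneg_right
      ((sum_rpow_le hε (by linarith) hJ4).trans (le_abs_self D)) hP.le
  refine ⟨J, hJ2, hJ4, ?_, ?_, ?_⟩
  · rw [← Finset.mul_sum, mul_comm]
    have : (0 : ℝ) < 4 ^ (2 - δ) := by positivity
    refine mul_le_mul_of_nonneg_right (h1.trans ?_) hε.le
    linarith [abs_nonneg D]
  · have hp : (0 : ℝ) < 4 ^ (2 - δ) := by positivity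
    have m1 : ε ≤ max ε (ε ^ δ) := le_max_left _ _
    have m2 : ε ^ δ ≤ max ε (ε ^ δ) := le_max_right _ _
    have hm : 0 < max ε (ε ^ δ) := hε.trans_le m1
    have hS2' : ∑ j ∈ Finset.range (J + 1), (ε * 2 ^ j) ^ 2 * ((2 : ℝ) ^ j) ^ (-δ) ≤
        (|D| + 8) * max ε (ε ^ δ) := by
      rcases lt_or_ge δ 2 with h | h
      · exact (hS2 h).trans (mul_le_mul (by linarith) m2 hP.le (by positivity))
      -- For δ ≥ 2 use λ^{-δ} ≤ λ^{-2}. Then (ελ)²λ^{-2} = (ελ)·ε·λ⁻¹ ≤ 4ελ⁻¹ avoids a sum without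
      -- decay, which would lose a logarithm at δ = 2.
      · calc _ ≤ ∑ j ∈ Finset.range (J + 1), 4 * ε * ((2 : ℝ) ^ j)⁻¹ := by
              refine Finset.sum_le_sum fun j hj => ?_
              have ha : (0 : ℝ) < 2 ^ j := by positivity
              have hl : ((2 : ℝ) ^ j) ^ (-δ) ≤ ((2 : ℝ) ^ j)⁻¹ * ((2 : ℝ) ^ j)⁻¹ := by
                calc _ ≤ ((2 : ℝ) ^ j) ^ (-2 : ℝ) :=
                      Real.rpow_le_rpow_of_exponent_le (one_le_pow₀ (by norm_num)) (by linarith)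
                  _ = _ := by
                      rw [Real.rpow_neg ha.le, ← mul_inv, ← sq]; norm_cast
              calc _ ≤ (ε * 2 ^ j) ^ 2 * (((2 : ℝ) ^ j)⁻¹ * ((2 : ℝ) ^ j)⁻¹) :=
                    mul_le_mul_of_nonneg_left hl (by positivity)
                _ = (ε * 2 ^ j) * ε * ((2 : ℝ) ^ j)⁻¹ := by field_simp
                _ ≤ _ := by gcongr; exact h4 j hj
          _ ≤ 4 * ε * 2 := by
              rw [← Finset.mul_sum]; exact mul_le_mul_of_nonneg_left hhalf (by positivity)
          _ ≤ _ := by nlinarith [abs_nonneg D]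
    nlinarith
  · intro hd1 hd2
    rw [min_eq_right (by simpa using Real.rpow_le_rpow_of_exponent_ge hε hε1 hd1)]
    have hS1' : ε * ∑ j ∈ Finset.range (J + 1), ε * 2 ^ j * ((2 : ℝ) ^ j) ^ (-δ) ≤
        2 * 4 ^ (2 - δ) * ε ^ δ := by
      rw [Finset.mul_sum]
      calc _ ≤ ∑ j ∈ Finset.range (J + 1), ε ^ δ * 4 ^ (2 - δ) * ((2 : ℝ) ^ j)⁻¹ := by
            refine Finset.sum_le_sum fun j hj => ?_
            have ha : (0 : ℝ) < 2 ^ j := by positivity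
            -- The extra ε equals ελ·λ⁻¹: the term becomes a term of S₂ times the summable factor
            -- λ⁻¹.
            calc _ = (ε * 2 ^ j) ^ 2 * ((2 : ℝ) ^ j) ^ (-δ) * ((2 : ℝ) ^ j)⁻¹ := by field_simp
              _ ≤ _ := by
                rw [sq_mul_rpow_neg hε ha]
                have : (ε * 2 ^ j) ^ (2 - δ) ≤ (4 : ℝ) ^ (2 - δ) :=
                  Real.rpow_le_rpow (by positivity) (h4 j hj) (by linarith)
                gcongr
        _ ≤ ε ^ δ * 4 ^ (2 - δ) * 2 := by
            rw [← Finset.mul_sum]; exact mul_le_mul_of_nonneg_left hhalf (by positivity)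
        _ = _ := by ring
    nlinarith [hS2 hd2]

end DyadicSums

/-! ### Summation over the pieces: bounds for w and its derivatives. -/

section LowFrequency

variable {n m : ℕ}

lemma sum_mul_ofReal_mul {ι : Type*} (t : Finset ι) (C M : ℝ≥0∞) {b : ι → ℝ}
    (hb : ∀ i ∈ t, 0 ≤ b i) :
    ∑ i ∈ t, C * (ENNReal.ofReal (b i) * M) = C * (ENNReal.ofReal (∑ i ∈ t, b i) * M) := by
  rw [← Finset.mul_sum, ← Finset.sum_mul, ENNReal.ofReal_sum_of_nonneg hb]

lemma nDL_cv_sum_le {ι : Type*} [Fintype ι] (f : 𝓢(Sp n, ℂ)) {W : ι → Sp n → Val m}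
    (hW : ∀ i, BddMeas (W i)) {C M : ℝ≥0∞} {b : ι → ℝ} (hb : ∀ i, 0 ≤ b i)
    (h : ∀ i, nDL 1 (fun x => ‖cv f (W i) x‖ₑ) ≤ C * (ENNReal.ofReal (b i) * M)) :
    nDL 1 (fun x => ‖cv f (fun y => ∑ i, W i y) x‖ₑ) ≤ C * (ENNReal.ofReal (∑ i, b i) * M) := by
  simp_rw [cv_finset_sum Finset.univ f fun i => (hW i).temp]
  calc _ ≤ nDL 1 (fun x => ∑ i, ‖cv f (W i) x‖ₑ) := nDL_mono fun x => enorm_sum_le _ _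
    _ ≤ ∑ i, nDL 1 (fun x => ‖cv f (W i) x‖ₑ) :=
        nDL_sum_le _ fun i => (stronglyMeasurable_cv f (hW i).1).measurable.enorm
    _ ≤ ∑ i, C * (ENNReal.ofReal (b i) * M) := Finset.sum_le_sum fun i _ => h i
    _ = _ := sum_mul_ofReal_mul _ _ _ fun i _ => hb i

lemma BddMeas.finset_sum {F ι : Type*} [NormedAddCommGroup F] (t : Finset ι) {u : ι → Sp n → F}
    (hu : ∀ i, BddMeas (u i)) : BddMeas (fun x => ∑ i ∈ t, u i x) := by
  choose hm C hC hb using hu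
  refine ⟨Finset.aestronglyMeasurable_fun_sum t fun i _ => hm i, ∑ i ∈ t, C i,
    ENNReal.sum_ne_top.2 fun i _ => hC i, fun x => ?_⟩
  exact (enorm_sum_le _ _).trans (Finset.sum_le_sum fun i _ => hb i x)

/-- The low frequency part of the rescaled data, and its first and second derivatives. -/
lemma exists_low_rescale_le (hn : 0 < n) (m : ℕ) (φ : LPCutoff n) {s : ℝ}
    (hs : (n : ℝ) / 2 < s) :
    ∃ (C : ℝ≥0∞) (K : ℝ), C ≠ ∞ ∧ 0 < K ∧ ∀ ε : ℝ, 0 < ε → ε ≤ 1 →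
      ∃ S₁ S₂ : ℝ, 0 ≤ S₁ ∧ 0 ≤ S₂ ∧
        ε * S₁ + S₂ ≤ K * max ε (ε ^ (s - (n : ℝ) / 2)) ∧
        (1 ≤ s - (n : ℝ) / 2 → s - (n : ℝ) / 2 < 2 →
          ε * S₁ + S₂ ≤ K * min ε (ε ^ (s - (n : ℝ) / 2))) ∧
        ∀ u : Sp n → Val m, Temp u → normDH φ s u < ∞ →
          BddMeas (φ.low (rescale ε u)) ∧
          (∀ x, ‖φ.low (rescale ε u) x‖ₑ ≤ C * (ENNReal.ofReal ε * normDH φ s u)) ∧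
          (∀ i, nDL 1 (fun x => ‖cv (∂_{(EuclideanSpace.single i 1 : Sp n)} φ.wideKer)
            (φ.low (rescale ε u)) x‖ₑ) ≤ C * (ENNReal.ofReal S₁ * normDH φ s u)) ∧
          (∀ i, nDL 1 (fun x => ‖cv (∂_{(EuclideanSpace.single i 1 : Sp n)}
            (∂_{(EuclideanSpace.single i 1 : Sp n)} φ.wideKer))
            (φ.low (rescale ε u)) x‖ₑ) ≤ C * (ENNReal.ofReal S₂ * normDH φ s u)) := by
  obtain ⟨C, hC, h⟩ := exists_lowPiece_le hn m φ
  obtain ⟨K, hK, hsum⟩ := exists_dyadic_sums_le (sub_pos.2 hs)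
  -- The sup bound needs the factor K of the dyadic sum; the derivative bounds keep their sums S₁
  -- and S₂ and need only the factor 1.
  refine ⟨C * ENNReal.ofReal (max 1 K), K, ENNReal.mul_ne_top hC ENNReal.ofReal_ne_top, hK,
    fun ε hε hε1 => ?_⟩
  obtain ⟨J, hJ2, hJ4, h0, hmax, hmin⟩ := hsum ε hε hε1
  refine ⟨_, _, Finset.sum_nonneg fun j _ => ?_, Finset.sum_nonneg fun j _ => ?_, hmax, hmin,
    fun u hu hM => ?_⟩
  · positivity
  · positivity
  have hj : ∀ j : Fin (J + 1), ε * 2 ^ (j : ℕ) ≤ 4 := fun j =>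
    mul_two_pow_le_four hε hJ4 (Nat.lt_succ_iff.1 j.2)
  have hW := fun j : Fin (J + 1) => h s ε hε hε1 u hu hM j (hj j)
  have hw : φ.low (rescale ε u) = fun x => ∑ j : Fin (J + 1), lowPiece φ ε u j x := by
    funext x
    rw [low_eq_sum φ hε (hu.rescale hε hε1) hJ2, Finset.sum_range]
  have hC1 : C ≤ C * ENNReal.ofReal (max 1 K) :=
    le_mul_of_one_le_right zero_le (by simp)
  simp only [neg_sub] at h0 ⊢
  rw [hw]
  refine ⟨BddMeas.finset_sum _ fun j => (hW j).1, fun x => ?_, fun i => ?_, fun i => ?_⟩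
  · calc _ ≤ ∑ j : Fin (J + 1), ‖lowPiece φ ε u j x‖ₑ := enorm_sum_le _ _
      _ ≤ ∑ j : Fin (J + 1), C * (ENNReal.ofReal (ε * ((2 : ℝ) ^ (j : ℕ)) ^ ((n : ℝ) / 2 - s)) *
          normDH φ s u) := Finset.sum_le_sum fun j _ => (hW j).2.1 x
      _ = C * (ENNReal.ofReal (∑ j ∈ Finset.range (J + 1),
          ε * ((2 : ℝ) ^ j) ^ ((n : ℝ) / 2 - s)) * normDH φ s u) := by
          rw [sum_mul_ofReal_mul _ _ _ fun j _ => by positivity, Finset.sum_range]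
      _ ≤ C * (ENNReal.ofReal (max 1 K * ε) * normDH φ s u) := by
          gcongr
          exact h0.trans (mul_le_mul_of_nonneg_right (le_max_right _ _) hε.le)
      _ = _ := by rw [ENNReal.ofReal_mul (by positivity)]; ring
  · refine (nDL_cv_sum_le _ (fun j => (hW j).1) (fun j => by positivity)
      fun j => (hW j).2.2.1 i).trans ?_
    rw [Finset.sum_range]
    gcongr
  · refine (nDL_cv_sum_le _ (fun j => (hW j).1) (fun j => by positivity)
      fun j => (hW j).2.2.2 i).trans ?_
    rw [Finset.sum_range]
    gcongr

end LowFrequency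

/-! ### The forcing term at unit scale. -/

section Forcing

variable {n m : ℕ}

@[simp] lemma conjV_apply (v : Val m) (i : Fin m) : conjV v i = starRingEnd ℂ (v i) := rfl

@[simp] lemma norm_conjV (v : Val m) : ‖conjV v‖ = ‖v‖ := by
  simp [EuclideanSpace.norm_eq]

lemma continuous_conjV : Continuous (conjV : Val m → Val m) :=
  (PiLp.continuous_toLp 2 _).comp (by fun_prop)

/-- The bilinear form as a continuous bilinear map. -/
def bilinCLM (B : BilinForm n m) :
    (Val m × Val m) →L[ℂ] ((Fin n → Val m) × (Fin n → Val m)) →L[ℂ] Val m :=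
  LinearMap.toContinuousLinearMap (LinearMap.toContinuousLinearMap.toLinearMap ∘ₗ B)

lemma bilinCLM_apply (B : BilinForm n m) (a : Val m × Val m)
    (b : (Fin n → Val m) × (Fin n → Val m)) : bilinCLM B a b = B a b := rfl

lemma enorm_pi_le_sum (G : Fin n → Val m) : ‖G‖ₑ ≤ ∑ i, ‖G i‖ₑ := by
  conv_lhs => rw [← Finset.univ_sum_single G]
  refine (enorm_sum_le _ _).trans (Finset.sum_le_sum fun i _ => le_of_eq ?_)
  rw [enorm_eq_iff_norm_eq, Pi.norm_single]

lemma enorm_bilin_le (B : BilinForm n m) (v : Val m) (G : Fin n → Val m) :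
    ‖B (v, conjV v) (G, fun i => conjV (G i))‖ₑ ≤ ‖bilinCLM B‖ₑ * ‖v‖ₑ * ∑ i, ‖G i‖ₑ := by
  have h1 : ‖(v, conjV v)‖ₑ = ‖v‖ₑ := by
    rw [enorm_eq_iff_norm_eq, Prod.norm_def]; simp
  have h2 : ‖(G, fun i => conjV (G i))‖ₑ = ‖G‖ₑ := by
    rw [enorm_eq_iff_norm_eq, Prod.norm_def]
    have : ‖fun i => conjV (G i)‖ = ‖G‖ := by
      have h : ∀ i, ‖conjV (G i)‖₊ = ‖G i‖₊ := fun i => NNReal.eq (norm_conjV _)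
      simp only [Pi.norm_def, h]
    simp [this]
  rw [← bilinCLM_apply]
  calc _ ≤ ‖bilinCLM B (v, conjV v)‖ₑ * ‖(G, fun i => conjV (G i))‖ₑ :=
        ContinuousLinearMap.le_opENorm _ _
    _ ≤ ‖bilinCLM B‖ₑ * ‖(v, conjV v)‖ₑ * ‖(G, fun i => conjV (G i))‖ₑ := by
        gcongr; exact ContinuousLinearMap.le_opENorm _ _
    _ ≤ _ := by rw [h1, h2]; gcongr; exact enorm_pi_le_sum G

variable {Ψ : 𝓢(Sp n, ℂ)} {w : Sp n → Val m}

/-- Differentiate the reproducing formula for w; the derivative falls on Ψ. -/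
lemma grad_eq (hw : BddMeas w) (hΨ : cv Ψ w = w) (x : Sp n) :
    grad w x = fun i => cv (∂_{(EuclideanSpace.single i 1 : Sp n)} Ψ) w x := by
  funext i
  have := fderiv_cv_apply Ψ hw x (EuclideanSpace.single i 1)
  rwa [hΨ] at this

lemma laplacian_eq (hw : BddMeas w) (hΨ : cv Ψ w = w) (x : Sp n) :
    Δ w x = ∑ i, cv (∂_{(EuclideanSpace.single i 1 : Sp n)}
      (∂_{(EuclideanSpace.single i 1 : Sp n)} Ψ)) w x := by
  have := laplacian_cv Ψ hw x
  rwa [hΨ] at this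

lemma measurable_forcing (B : BilinForm n m) (hw : BddMeas w) (hΨ : cv Ψ w = w) :
    Measurable (forcing B w) := by
  have hwm : Measurable w := by
    rw [← hΨ]; exact (stronglyMeasurable_cv Ψ hw.1).measurable
  have hG : Measurable (grad w) := by
    rw [funext (grad_eq hw hΨ)]
    exact measurable_pi_iff.2 fun i => (stronglyMeasurable_cv _ hw.1).measurable
  have hL : Measurable (Δ w) := by
    rw [funext (laplacian_eq hw hΨ)]
    exact Finset.measurable_fun_sum _ fun i _ => (stronglyMeasurable_cv _ hw.1).measurable
  have hc : Continuous fun p : Val m × (Fin n → Val m) =>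
      bilinCLM B (p.1, conjV p.1) (p.2, fun i => conjV (p.2 i)) := by
    have hcj := continuous_conjV (m := m)
    fun_prop
  exact (hc.measurable.comp (hwm.prodMk hG)).add hL

lemma enorm_forcing_le (B : BilinForm n m) (hw : BddMeas w) (hΨ : cv Ψ w = w) (x : Sp n) :
    ‖forcing B w x‖ₑ ≤ ‖bilinCLM B‖ₑ * ‖w x‖ₑ *
        ∑ i, ‖cv (∂_{(EuclideanSpace.single i 1 : Sp n)} Ψ) w x‖ₑ +
      ∑ i, ‖cv (∂_{(EuclideanSpace.single i 1 : Sp n)}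
        (∂_{(EuclideanSpace.single i 1 : Sp n)} Ψ)) w x‖ₑ := by
  refine (enorm_add_le _ _).trans (add_le_add ?_ ?_)
  · refine (enorm_bilin_le B _ _).trans_eq ?_
    rw [grad_eq hw hΨ]
  · rw [laplacian_eq hw hΨ]
    exact enorm_sum_le _ _

lemma bddMeas_forcing (B : BilinForm n m) (hw : BddMeas w) (hΨ : cv Ψ w = w) :
    BddMeas (forcing B w) := by
  refine ⟨(measurable_forcing B hw hΨ).aestronglyMeasurable, ?_⟩
  choose C₁ hC₁ h1 using fun i : Fin n => (hw.cv (∂_{(EuclideanSpace.single i 1 : Sp n)} Ψ)).2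
  choose C₂ hC₂ h2 using fun i : Fin n => (hw.cv (∂_{(EuclideanSpace.single i 1 : Sp n)}
    (∂_{(EuclideanSpace.single i 1 : Sp n)} Ψ))).2
  obtain ⟨C, hC, h0⟩ := hw.2
  refine ⟨‖bilinCLM B‖ₑ * C * ∑ i, C₁ i + ∑ i, C₂ i, ?_, fun x => ?_⟩
  · exact ENNReal.add_ne_top.2 ⟨ENNReal.mul_ne_top (ENNReal.mul_ne_top enorm_ne_top hC)
      (ENNReal.sum_ne_top.2 fun i _ => hC₁ i), ENNReal.sum_ne_top.2 fun i _ => hC₂ i⟩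
  · refine (enorm_forcing_le B hw hΨ x).trans ?_
    gcongr with i _ i _
    · exact h0 x
    · exact h1 i x
    · exact h2 i x

/-- The undifferentiated factor is taken in L^∞ and only the gradient in 𝒟L²_1; no product estimate
beyond this is needed. -/
lemma nDL_forcing_le (B : BilinForm n m) (hw : BddMeas w) (hΨ : cv Ψ w = w) {A A₁ A₂ : ℝ≥0∞}
    (h0 : ∀ x, ‖w x‖ₑ ≤ A)
    (h1 : ∀ i, nDL 1 (fun x => ‖cv (∂_{(EuclideanSpace.single i 1 : Sp n)} Ψ) w x‖ₑ) ≤ A₁)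
    (h2 : ∀ i, nDL 1 (fun x => ‖cv (∂_{(EuclideanSpace.single i 1 : Sp n)}
      (∂_{(EuclideanSpace.single i 1 : Sp n)} Ψ)) w x‖ₑ) ≤ A₂) :
    nDL 1 (fun x => ‖forcing B w x‖ₑ) ≤ ‖bilinCLM B‖ₑ * A * (n * A₁) + n * A₂ := by
  have hm : ∀ f : 𝓢(Sp n, ℂ), Measurable fun x => ‖cv f w x‖ₑ := fun f =>
    (stronglyMeasurable_cv f hw.1).measurable.enorm
  have hs1 := Finset.measurable_fun_sum Finset.univ
    fun i (_ : i ∈ (Finset.univ : Finset (Fin n))) => hm (∂_{(EuclideanSpace.single i 1 : Sp n)} Ψ)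
  have hs2 := Finset.measurable_fun_sum Finset.univ
    fun i (_ : i ∈ (Finset.univ : Finset (Fin n))) => hm (∂_{(EuclideanSpace.single i 1 : Sp n)}
      (∂_{(EuclideanSpace.single i 1 : Sp n)} Ψ))
  have hc : ∀ a : ℝ≥0∞, ∑ _i : Fin n, a = n * a := fun a => by simp
  calc _ ≤ nDL 1 (fun x => ‖bilinCLM B‖ₑ * A *
        ∑ i, ‖cv (∂_{(EuclideanSpace.single i 1 : Sp n)} Ψ) w x‖ₑ +
      ∑ i, ‖cv (∂_{(EuclideanSpace.single i 1 : Sp n)}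
        (∂_{(EuclideanSpace.single i 1 : Sp n)} Ψ)) w x‖ₑ) := nDL_mono fun x => by
        refine (enorm_forcing_le B hw hΨ x).trans ?_
        gcongr
        exact h0 x
    _ ≤ _ := (nDL_add_le (hs1.const_mul _) hs2).trans (add_le_add
        ((nDL_const_mul hs1).trans (mul_le_mul' le_rfl ?_)) ?_)
  · rw [← hc]
    exact (nDL_sum_le _ fun i => hm _).trans (Finset.sum_le_sum fun i _ => h1 i)
  · rw [← hc]
    exact (nDL_sum_le _ fun i => hm _).trans (Finset.sum_le_sum fun i _ => h2 i)

end Forcing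

/-! ### Bounded frequencies of the forcing term. -/

section FrequencySupport

variable {n m : ℕ}

/-- Bounded functions with frequencies in a ball, written as a convolution. -/
def BandLimited (r : ℝ) (a : Sp n → ℂ) : Prop :=
  ∃ (f : 𝓢(Sp n, ℂ)) (b : Sp n → ℂ), FourierSuppBall r f ∧ BddMeas b ∧ a = cv f b

lemma BandLimited.bddMeas {r : ℝ} {a : Sp n → ℂ} (h : BandLimited r a) : BddMeas a := by
  obtain ⟨f, b, -, hb, rfl⟩ := h
  exact hb.cv f

/-- Conjugation reflects frequencies through the origin, and balls are symmetric. This covers the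
conjugated arguments of B. -/
lemma BandLimited.conj {r : ℝ} {a : Sp n → ℂ} (h : BandLimited r a) :
    BandLimited r (fun x => starRingEnd ℂ (a x)) := by
  obtain ⟨f, b, hf, ⟨hm, C, hC, hb⟩, rfl⟩ := h
  refine ⟨conjS f, fun x => starRingEnd ℂ (b x), hf.conj,
    ⟨Complex.continuous_conj.comp_aestronglyMeasurable hm, C, hC, fun x => ?_⟩, ?_⟩
  · refine le_of_eq_of_le ?_ (hb x)
    rw [enorm_eq_iff_norm_eq, RCLike.norm_conj]
  · funext x
    unfold cv
    rw [← integral_conj]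
    simp [conjS_apply]

lemma BddMeas.coord {w : Sp n → Val m} (hw : BddMeas w) (c : Fin m) :
    BddMeas (fun x => w x c) := by
  obtain ⟨hm, C, hC, hb⟩ := hw
  refine ⟨(EuclideanSpace.proj (𝕜 := ℂ) c).continuous.comp_aestronglyMeasurable hm, C, hC,
    fun x => le_trans ?_ (hb x)⟩
  rw [enorm_le_iff_norm_le]
  exact PiLp.norm_apply_le (w x) c

lemma cv_apply_coord (f : 𝓢(Sp n, ℂ)) {w : Sp n → Val m} (hw : Temp w) (x : Sp n) (c : Fin m) :
    cv f w x c = cv f (fun y => w y c) x :=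
  ((EuclideanSpace.proj (𝕜 := ℂ) c).integral_comp_comm (hw.integrable f x)).symm

lemma bandLimited_cv_coord {r : ℝ} {f : 𝓢(Sp n, ℂ)} (hf : FourierSuppBall r f)
    {w : Sp n → Val m} (hw : BddMeas w) (c : Fin m) : BandLimited r (fun x => cv f w x c) :=
  ⟨f, fun x => w x c, hf, hw.coord c, funext fun x => cv_apply_coord f hw.temp x c⟩

lemma BddMeas.mul_smul_const {a b : Sp n → ℂ} (ha : BddMeas a) (hb : BddMeas b) (e : Val m) :
    BddMeas (fun x => (a x * b x) • e) := by
  obtain ⟨ham, A, hA, ha⟩ := ha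
  obtain ⟨hbm, B, hB, hb⟩ := hb
  refine ⟨(ham.mul hbm).smul_const e, A * B * ‖e‖ₑ,
    ENNReal.mul_ne_top (ENNReal.mul_ne_top hA hB) enorm_ne_top, fun x => ?_⟩
  rw [enorm_smul, enorm_mul]
  exact mul_le_mul' (mul_le_mul' (ha x) (hb x)) le_rfl

lemma cv_mul_smul_eq_zero {r₁ r₂ : ℝ} {k : 𝓢(Sp n, ℂ)}
    (hk : ∀ ξ, ‖ξ‖ ≤ r₁ + r₂ → 𝓕 k ξ = 0) {a b : Sp n → ℂ} (ha : BandLimited r₁ a)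
    (hb : BandLimited r₂ b) (e : Val m) (x : Sp n) :
    cv k (fun y => (a y * b y) • e) x = 0 := by
  obtain ⟨f, a, hf, ha, rfl⟩ := ha
  obtain ⟨g, b, hg, hb, rfl⟩ := hb
  unfold cv
  simp_rw [smul_smul]
  rw [integral_smul_const]
  have := cv_mul_eq_zero hk hf hg ha hb x
  unfold cv at this
  rw [this, zero_smul]

lemma val_eq_sum (v : Val m) : v = ∑ i, v i • EuclideanSpace.single i (1 : ℂ) := by
  ext j
  simp [Pi.single_apply]

/-- The standard basis of `ℂᵐ × ℂᵐ`. -/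
def pairBasis : Fin m ⊕ Fin m → Val m × Val m :=
  Sum.elim (fun i => (EuclideanSpace.single i 1, 0)) (fun i => (0, EuclideanSpace.single i 1))

/-- The standard basis of `(ℂᵐ)ⁿ × (ℂᵐ)ⁿ`. -/
def gradPairBasis : (Fin n × Fin m) ⊕ (Fin n × Fin m) → (Fin n → Val m) × (Fin n → Val m) :=
  Sum.elim (fun q => (Pi.single q.1 (EuclideanSpace.single q.2 1), 0))
    (fun q => (0, Pi.single q.1 (EuclideanSpace.single q.2 1)))

lemma prod_eq_sum (v v' : Val m) :
    (v, v') = ∑ p : Fin m ⊕ Fin m, Sum.elim (fun i => v i) (fun i => v' i) p • pairBasis p := by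
  rw [Fintype.sum_sum_type]
  refine Prod.ext ?_ ?_
  · simpa [Prod.fst_sum, pairBasis] using val_eq_sum v
  · simpa [Prod.snd_sum, pairBasis] using val_eq_sum v'

lemma pi_eq_sum (G : Fin n → Val m) :
    G = ∑ q : Fin n × Fin m, G q.1 q.2 • Pi.single q.1 (EuclideanSpace.single q.2 (1 : ℂ)) := by
  rw [Fintype.sum_prod_type]
  conv_lhs => rw [← Finset.univ_sum_single G]
  refine Finset.sum_congr rfl fun i _ => ?_
  conv_lhs => rw [val_eq_sum (G i)]
  simp_rw [← Pi.single_smul]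
  exact map_sum (AddMonoidHom.single (fun _ : Fin n => Val m) i) _ _

lemma prod_pi_eq_sum (G G' : Fin n → Val m) :
    (G, G') = ∑ q : (Fin n × Fin m) ⊕ (Fin n × Fin m),
      Sum.elim (fun q => G q.1 q.2) (fun q => G' q.1 q.2) q • gradPairBasis q := by
  rw [Fintype.sum_sum_type]
  refine Prod.ext ?_ ?_
  · simpa [Prod.fst_sum, gradPairBasis] using pi_eq_sum G
  · simpa [Prod.snd_sum, gradPairBasis] using pi_eq_sum G'

/-- Reduces the vector-valued bilinear term to products of two scalar band-limited functions times
fixed vectors. -/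
lemma bilin_expand {E F : Type*} [AddCommGroup E] [Module ℂ E] [AddCommGroup F] [Module ℂ F]
    (B : E →ₗ[ℂ] F →ₗ[ℂ] Val m) {P Q : Type*} [Fintype P] [Fintype Q] (a : P → ℂ) (e : P → E)
    (b : Q → ℂ) (f : Q → F) :
    B (∑ p, a p • e p) (∑ q, b q • f q) =
      ∑ pq : P × Q, (a pq.1 * b pq.2) • B (e pq.1) (f pq.2) := by
  rw [Fintype.sum_prod_type, map_sum B, LinearMap.sum_apply]
  refine Finset.sum_congr rfl fun p _ => ?_
  rw [map_sum]
  refine Finset.sum_congr rfl fun q _ => ?_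
  rw [map_smul, map_smul, LinearMap.smul_apply, smul_smul, mul_comm]

lemma FourierSuppBall.mono {r r' : ℝ} {f : 𝓢(Sp n, ℂ)} (hf : FourierSuppBall r f) (h : r ≤ r') :
    FourierSuppBall r' f := fun ξ hξ => hf ξ (h.trans_lt hξ)

/-- The forcing term of a function with frequencies in the ball of radius `r` has no frequencies
outside of the ball of radius `2 r`. -/
lemma cv_forcing_eq_zero (B : BilinForm n m) {r : ℝ} (hr : 0 ≤ r) {k Ψ : 𝓢(Sp n, ℂ)}
    (hk : ∀ ξ, ‖ξ‖ ≤ r + r → 𝓕 k ξ = 0) (hf : FourierSuppBall r Ψ) {w : Sp n → Val m}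
    (hw : BddMeas w) (hΨ : cv Ψ w = w) : cv k (forcing B w) = 0 := by
  have hG : ∀ i : Fin n, FourierSuppBall r (∂_{(EuclideanSpace.single i 1 : Sp n)} Ψ) :=
    fun i => hf.lineDeriv _
  set α : (Fin m ⊕ Fin m) → Sp n → ℂ := fun p x =>
    Sum.elim (fun i => w x i) (fun i => conjV (w x) i) p with hα
  set β : ((Fin n × Fin m) ⊕ (Fin n × Fin m)) → Sp n → ℂ := fun q x =>
    Sum.elim (fun q => grad w x q.1 q.2) (fun q => conjV (grad w x q.1) q.2) q with hβ
  have hwb : ∀ i, BandLimited r (fun x => w x i) := fun i => by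
    have := bandLimited_cv_coord hf hw i
    rwa [hΨ] at this
  have hgb : ∀ q : Fin n × Fin m, BandLimited r (fun x => grad w x q.1 q.2) := fun q => by
    simp_rw [grad_eq hw hΨ]
    exact bandLimited_cv_coord (hG q.1) hw q.2
  have hαb : ∀ p, BandLimited r (α p) := by
    rintro (i | i)
    · exact hwb i
    · exact (hwb i).conj
  have hβb : ∀ q, BandLimited r (β q) := by
    rintro (q | q)
    · exact hgb q
    · exact (hgb q).conj
  have hN : forcing B w = fun x =>
      (∑ pq : (Fin m ⊕ Fin m) × ((Fin n × Fin m) ⊕ (Fin n × Fin m)),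
        (α pq.1 x * β pq.2 x) • B (pairBasis pq.1) (gradPairBasis pq.2)) +
      ∑ i, cv (∂_{(EuclideanSpace.single i 1 : Sp n)}
        (∂_{(EuclideanSpace.single i 1 : Sp n)} Ψ)) w x := by
    funext x
    rw [forcing, laplacian_eq hw hΨ, prod_eq_sum, prod_pi_eq_sum, bilin_expand]
  have hT1 := fun pq : (Fin m ⊕ Fin m) × ((Fin n × Fin m) ⊕ (Fin n × Fin m)) =>
    (hαb pq.1).bddMeas.mul_smul_const (hβb pq.2).bddMeas (B (pairBasis pq.1) (gradPairBasis pq.2))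
  have hT2 := fun i : Fin n => hw.cv (∂_{(EuclideanSpace.single i 1 : Sp n)}
    (∂_{(EuclideanSpace.single i 1 : Sp n)} Ψ))
  funext x
  rw [hN, cv_add k (BddMeas.finset_sum _ hT1).temp (BddMeas.finset_sum _ hT2).temp,
    cv_finset_sum _ k fun pq => (hT1 pq).temp, cv_finset_sum _ k fun i => (hT2 i).temp]
  rw [Finset.sum_eq_zero fun pq _ => cv_mul_smul_eq_zero hk (hαb pq.1) (hβb pq.2) _ x,
    Finset.sum_eq_zero fun i _ => ?_]
  · simp
  · rw [cv_cv_eq_zero hk (((hG i).lineDeriv _).mono (by linarith)) hw.temp]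
    rfl

/-- The reproducing kernel has frequencies at most 4, so the quadratic term has frequencies at most
8 = 2³; the symbol of index j = i + 1 vanishes for |ξ| ≤ 2^i, and i ≥ 3. -/
lemma piece_forcing_eq_zero (φ : LPCutoff n) (B : BilinForm n m) {w : Sp n → Val m}
    (hw : BddMeas w) (hΨ : cv φ.wideKer w = w) {j : ℕ} (hj : 4 ≤ j) :
    φ.piece j (forcing B w) = 0 := by
  obtain ⟨i, rfl⟩ : ∃ i, j = i + 1 := ⟨j - 1, by omega⟩
  have hi : 3 ≤ i := by omega
  rw [LPCutoff.piece, (φ.isSymbol_symbol (i + 1)).multiplier_eq]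
  refine cv_forcing_eq_zero B (r := 4 / (2 * Real.pi)) (by positivity) (fun ξ hξ => ?_)
    (φ.isSymbol_wide.fourierSuppBall fun ξ hξ => φ.wide_eq_zero hξ.le) hw hΨ
  refine (φ.isSymbol_symbol (i + 1)).fourier_ker_eq_zero (r := 8)
    (fun ξ hξ => φ.symbol_succ_eq_zero i (hξ.trans ?_)) ξ (hξ.trans_eq (by ring))
  calc (8 : ℝ) = 2 ^ 3 := by norm_num
    _ ≤ 2 ^ i := pow_le_pow_right₀ (by norm_num) hi

/-- For functions with bounded frequencies the norm `𝒟Hˢ` is controlled at unit scale. -/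
lemma exists_normDH_forcing_le (φ : LPCutoff n) (s : ℝ) (B : BilinForm n m) :
    ∃ C : ℝ≥0∞, C ≠ ∞ ∧ ∀ w : Sp n → Val m, BddMeas w → cv φ.wideKer w = w →
      normDH φ s (forcing B w) ≤ C * nDL 1 (fun x => ‖forcing B w x‖ₑ) := by
  choose C hC h using fun j : ℕ => exists_nDL_natCast_le n (2 ^ j) (by positivity)
  refine ⟨(∑ j ∈ Finset.range 4, ENNReal.ofReal (((2 : ℝ) ^ j) ^ (2 * s)) *
    ((∫⁻ y, ‖(φ.isSymbol_symbol j).ker y‖ₑ) * C j) ^ 2) ^ (1 / 2 : ℝ), ?_, fun w hw hΨ => ?_⟩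
  · refine ENNReal.rpow_ne_top_of_nonneg (by norm_num) (ENNReal.sum_ne_top.2 fun j _ => ?_)
    exact ENNReal.mul_ne_top ENNReal.ofReal_ne_top (ENNReal.pow_ne_top (ENNReal.mul_ne_top
      (φ.isSymbol_symbol j).ker.integrable.hasFiniteIntegral.ne (hC j)))
  · have h0 : ∀ j ∉ Finset.range 4, ENNReal.ofReal (((2 : ℝ) ^ j) ^ (2 * s)) *
        normDL ((2 : ℝ) ^ j) (φ.piece j (forcing B w)) ^ 2 = 0 := by
      intro j hj
      rw [piece_forcing_eq_zero φ B hw hΨ (by simpa using hj), normDL_eq (by positivity)]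
      simp [nDL_zero]
    rw [normDH, tsum_eq_sum h0]
    set D := nDL 1 (fun x => ‖forcing B w x‖ₑ) with hD
    have hj : ∀ j, normDL ((2 : ℝ) ^ j) (φ.piece j (forcing B w)) ≤
        (∫⁻ y, ‖(φ.isSymbol_symbol j).ker y‖ₑ) * C j * D := by
      intro j
      rw [normDL_eq (by positivity), LPCutoff.piece, (φ.isSymbol_symbol j).multiplier_eq,
        mul_assoc]
      refine (nDL_cv_le _ _ (measurable_forcing B hw hΨ)).trans (mul_le_mul' le_rfl ?_)
      simpa using h j (fun x => ‖forcing B w x‖ₑ)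
    calc _ ≤ (∑ j ∈ Finset.range 4, ENNReal.ofReal (((2 : ℝ) ^ j) ^ (2 * s)) *
          ((∫⁻ y, ‖(φ.isSymbol_symbol j).ker y‖ₑ) * C j * D) ^ 2) ^ (1 / 2 : ℝ) := by
          gcongr with j _
          exact hj j
      _ = _ := by
          simp_rw [mul_pow _ D, ← mul_assoc]
          rw [← Finset.sum_mul, ENNReal.mul_rpow_of_nonneg _ _ (by norm_num), sq_rpow_half]

end FrequencySupport

/-! ### Assembling the estimate. -/

section Main

variable {n m : ℕ}

lemma quadratic_add_linear_le (β C N M : ℝ≥0∞) {ε S₁ S₂ : ℝ} (hε : 0 ≤ ε) (h1 : 0 ≤ S₁)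
    (h2 : 0 ≤ S₂) :
    β * (C * (ENNReal.ofReal ε * M)) * (N * (C * (ENNReal.ofReal S₁ * M))) +
        N * (C * (ENNReal.ofReal S₂ * M)) ≤
      (β * C * (N * C) + N * C) * (ENNReal.ofReal (ε * S₁ + S₂) * max M (M ^ 2)) := by
  rw [add_mul]
  refine add_le_add ?_ ?_
  · calc _ = β * C * (N * C) * (ENNReal.ofReal (ε * S₁) * M ^ 2) := by
          rw [ENNReal.ofReal_mul hε]; ring
      _ ≤ _ := by
          gcongr
          · linarith
          · exact le_max_right _ _
  · calc _ = N * C * (ENNReal.ofReal S₂ * M) := by ring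
      _ ≤ _ := by
          gcongr
          · linarith [mul_nonneg hε h1]
          · exact le_max_left _ _

/-- The factor T is a constant times εS₁ + S₂. It depends on ε but not on u, and serves in both the
maximum and the minimum bound. -/
lemma exists_normDH_forcing_low_le (hn : 0 < n) (φ : LPCutoff n) (B : BilinForm n m) {s : ℝ}
    (hs : (n : ℝ) / 2 < s) :
    ∃ C : ℝ, 0 < C ∧ ∀ ε : ℝ, 0 < ε → ε ≤ 1 → ∃ T : ℝ,
      T ≤ C * max ε (ε ^ (s - (n : ℝ) / 2)) ∧
      (1 ≤ s - (n : ℝ) / 2 → s - (n : ℝ) / 2 < 2 → T ≤ C * min ε (ε ^ (s - (n : ℝ) / 2))) ∧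
      ∀ u : Sp n → Val m, MemDH φ s u →
        IsTempered (forcing B (φ.low (rescale ε u))) ∧
        normDH φ s (forcing B (φ.low (rescale ε u))) ≤
          ENNReal.ofReal T * max (normDH φ s u) (normDH φ s u ^ 2) := by
  obtain ⟨C₁, hC₁, h1⟩ := exists_normDH_forcing_le φ s B
  obtain ⟨C₂, K, hC₂, hK, h2⟩ := exists_low_rescale_le hn m φ hs
  set A : ℝ≥0∞ := C₁ * (‖bilinCLM B‖ₑ * C₂ * (n * C₂) + n * C₂) with hA
  have hAt : A ≠ ∞ := by
    have hnt : (n : ℝ≥0∞) ≠ ∞ := ENNReal.natCast_ne_top n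
    have hnC := ENNReal.mul_ne_top hnt hC₂
    exact ENNReal.mul_ne_top hC₁ (ENNReal.add_ne_top.2
      ⟨ENNReal.mul_ne_top (ENNReal.mul_ne_top enorm_ne_top hC₂) hnC, hnC⟩)
  -- A may vanish, for instance if the bound for a degenerate target is zero; adding 1 keeps the
  -- constant positive.
  have hA0 : 0 < A.toReal + 1 := by positivity
  refine ⟨(A.toReal + 1) * K, by positivity, fun ε hε hε1 => ?_⟩
  obtain ⟨S₁, S₂, hS₁, hS₂, hmax, hmin, h⟩ := h2 ε hε hε1
  refine ⟨(A.toReal + 1) * (ε * S₁ + S₂), ?_, fun ha hb => ?_, fun u hu => ?_⟩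
  · rw [mul_assoc]; exact mul_le_mul_of_nonneg_left hmax hA0.le
  · rw [mul_assoc]; exact mul_le_mul_of_nonneg_left (hmin ha hb) hA0.le
  have hut := (isTempered_iff u).1 hu.1
  obtain ⟨hw, hw0, hw1, hw2⟩ := h u hut hu.2
  have hΨ := cv_wideKer_low φ (hut.rescale hε hε1)
  refine ⟨(isTempered_iff _).2 (bddMeas_forcing B hw hΨ).temp, ?_⟩
  calc _ ≤ C₁ * nDL 1 (fun x => ‖forcing B (φ.low (rescale ε u)) x‖ₑ) := h1 _ hw hΨ
    _ ≤ C₁ * ((‖bilinCLM B‖ₑ * C₂ * (n * C₂) + n * C₂) *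
        (ENNReal.ofReal (ε * S₁ + S₂) * max (normDH φ s u) (normDH φ s u ^ 2))) :=
        mul_le_mul' le_rfl ((nDL_forcing_le B hw hΨ hw0 hw1 hw2).trans
          (quadratic_add_linear_le _ _ _ _ hε.le hS₁ hS₂))
    _ = A * ENNReal.ofReal (ε * S₁ + S₂) * max (normDH φ s u) (normDH φ s u ^ 2) := by
        rw [hA]; ring
    _ ≤ _ := by
        rw [ENNReal.ofReal_mul hA0.le]
        gcongr
        rw [ENNReal.le_ofReal_iff_toReal_le hAt hA0.le]
        linarith

end Main

end DNLS

end

theorem mainTheorem10 (n m : ℕ) (hn : 2 ≤ n) (φ : DNLS.LPCutoff n) (B : DNLS.BilinForm n m)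
    (s : ℝ) (hs : (n : ℝ) / 2 < s) :
    ∃ C : ℝ, 0 < C ∧
      ∀ (ε : ℝ), 0 < ε → ε ≤ 1 →
        ∀ u₀ : DNLS.Sp n → DNLS.Val m, DNLS.MemDH φ s u₀ →
          DNLS.MemDH φ s (DNLS.forcing B (φ.low (DNLS.rescale ε u₀))) ∧
          DNLS.normDH φ s (DNLS.forcing B (φ.low (DNLS.rescale ε u₀))) ≤
            ENNReal.ofReal (C * max ε (ε ^ (s - (n : ℝ) / 2))) *
              max (DNLS.normDH φ s u₀) (DNLS.normDH φ s u₀ ^ 2) ∧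
          ((n : ℝ) / 2 + 1 ≤ s → s < (n : ℝ) / 2 + 2 →
            DNLS.normDH φ s (DNLS.forcing B (φ.low (DNLS.rescale ε u₀))) ≤
              ENNReal.ofReal (C * min ε (ε ^ (s - (n : ℝ) / 2))) *
                max (DNLS.normDH φ s u₀) (DNLS.normDH φ s u₀ ^ 2)) := by
  obtain ⟨C, hC, h⟩ := DNLS.exists_normDH_forcing_low_le (m := m) (by omega : 0 < n) φ B hs
  refine ⟨C, hC, fun ε hε hε1 u hu => ?_⟩
  obtain ⟨T, hmax, hmin, hT⟩ := h ε hε hε1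
  obtain ⟨ht, hb⟩ := hT u hu
  refine ⟨⟨ht, hb.trans_lt (ENNReal.mul_lt_top ENNReal.ofReal_lt_top ?_)⟩, ?_, fun h1 h2 => ?_⟩
  · exact max_lt hu.2 (ENNReal.pow_lt_top hu.2)
  · exact hb.trans (mul_le_mul' (ENNReal.ofReal_le_ofReal hmax) le_rfl)
  · exact hb.trans (mul_le_mul' (ENNReal.ofReal_le_ofReal
      (hmin (by linarith) (by linarith))) le_rfl)
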